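/- **Setting.** Let $d\in\{2,3\}$ and let $\Omega\subset\mathbb R^d$ be a non-empty bounded open polygonal/polyhedral set with $\operatorname{int}\overline\Omega=\Omega$ (for instance a polygonal domain with Lipschitz boundary). Let $\mathcal T_H$ and $\mathcal T_h$ be conforming meshes of $\Omega$ (no hanging nodes), each consisting of closed simplices or of closed quadrilaterals/hexahedra with flat faces, $T=F_T(\hat T)$, where $\hat T$ is the reference simplex or cube and $F_T$ is affine (simplices) or multilinear (quadrilaterals/hexahedra). Both are shape regular with constant $\rho$, i.e. $\rho^{-1}\operatorname{diam}(T)|x-y|\le|F_T(x)-F_T(y)|\le\rho\operatorname{diam}(T)|x-y|$ on $\hat T$. Let $H$ be the piecewise constant mesh function of $\mathcal T_H$, $H|_T=\operatorname{diam}T$. For $k\in\{h,H\}$ let $\mathcal V_k$ be the space of $v$ such that $v|_T\circ F_T$ is a polynomial of degree $\le1$ (simplices) or of degree $\le 1$ in each variable (quadrilaterals/hexahedra) for all $T\in\mathcal T_k$. The mesh $\mathcal T_h$ is a refinement of $\mathcal T_H$ and $\mathcal V_H\subset\mathcal V_h$ (automatic for simplices). Let $\Pi_H:L^2(\Omega)\to\mathcal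 V_H$ be the $L^2$-projection. Let $A$ be a symmetric matrix field whose restriction to each $T\in\mathcal T_h$ is continuous up to $\partial T$ (so that $A$ has one-sided traces on the edges; e.g. $A$ piecewise constant on $\mathcal T_h$), with $\alpha|\xi|^2\le A\xi\cdot\xi\le\beta|\xi|^2$, $0<\alpha\le\beta<\infty$; put $C_A=(\beta/\alpha)^{1/2}$. Let $\mathbf b\in W^{1,\infty}(\Omega)^d$, continuous on $\overline\Omega$, with $\nabla\cdot\mathbf b=0$ a.e., and let $f\in L^2(\Omega)$. Let $\mathcal E_h$ be the set of edges (faces if $d=3$) of $\mathcal T_h$, $\mathcal E_h(\Omega)$ the interior and $\mathcal E_h(\Gamma)$ the boundary ones, and $h_e=\operatorname{diam}e$. On $e=T^-\cap T^+\in\mathcal E_h(\Omega)$ let $\nu_e$ be the unit normal pointing from $T^-$ to $T^+$, $[v]=v^--v^+$, $\{v\}=(v^-+v^+)/2$; on $e\in\mathcal E_h(\Gamma)$ let $\nu_e$ be the outward unit normal and $[v]=\{v\}=v$. Write $x^\ominus=(|x|-x)/2$, $b_e=|\mathbf b\cdot\nu_e|/2$, let $\nabla_h$ be the broken gradient, and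 define on $\mathcal V_h$ the form $a_h=a_h^{\rm d}+a_h^{\rm c}$ by $$a_h^{\rm d}(u,v)=(A\nabla_hu,\nabla_hv)_{L^2(\Omega)}+\sum_{e\in\mathcal E_h}\Big(\tfrac{\sigma_e}{h_e}([u],[v])_{L^2(e)}-(\{\nu_e\cdot A\nabla u\},[v])_{L^2(e)}-(\{\nu_e\cdot A\nabla v\},[u])_{L^2(e)}\Big),$$ $$a_h^{\rm c}(u,v)=(\mathbf b\cdot\nabla_hu,v)_{L^2(\Omega)}+\sum_{e\in\mathcal E_h(\Omega)}\big((b_e[u],[v])_{L^2(e)}-(\nu_e\cdot\mathbf b\,[u],\{v\})_{L^2(e)}\big)+\sum_{e\in\mathcal E_h(\Gamma)}((\nu_e\cdot\mathbf b)^\ominus u,v)_{L^2(e)},$$ and the energy norm by $|||v|||^2=|||v|||_{\rm d}^2+|||v|||_{\rm c}^2$ with $$|||v|||_{\rm d}^2=\|A^{1/2}\nabla_hv\|_{L^2(\Omega)}^2+\sum_{e\in\mathcal E_h}\tfrac{\sigma_e}{h_e}\|[v]\|_{L^2(e)}^2,\qquad |||v|||_{\rm c}^2=\sum_{e\in\mathcal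 E_h}\|b_e^{1/2}[v]\|_{L^2(e)}^2 .$$ The penalty parameters $\sigma_e$ are large enough that $a_h^{\rm d}(v,v)\ge c_0|||v|||_{\rm d}^2$ for all $v\in\mathcal V_h$, and $\sigma_e\ge c_0\alpha$ for all $e\in\mathcal E_h$, where $c_0>0$. Let $\mathcal V^f=\{v\in\mathcal V_h:\Pi_Hv=0\}$, let $\mathfrak F:\mathcal V_h\to\mathcal V^f$ be given by $a_h(\mathfrak Fv,w)=a_h(v,w)$ for all $w\in\mathcal V^f$, and let $\mathcal V_H^{ms}=(1-\mathfrak F)\mathcal V_H$. **Theorem.** For given $d$, kinds of elements, $\rho$ and $c_0$ there is a constant $C$, depending on nothing else (in particular not on $\Omega$, the mesh sizes, $A$, $\mathbf b$, $\sigma$ or $f$), such that in the above setting the following holds. The operator $\mathfrak F$ is well defined: for each $v\in\mathcal V_h$ there is exactly one such $\mathfrak Fv\in\mathcal V^f$. If $u_h\in\mathcal V_h$ satisfies $a_h(u_h,v)=\int_\Omega fv$ for all $v\in\mathcal V_h$ and $u_H^{ms}\in\mathcal V_H^{ms}$ satisfies $a_h(u_H^{ms},v)=\int_\Omega fv$ for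 all $v\in\mathcal V_H^{ms}$, then $$|||u_h-u_H^{ms}|||\le C\,C_1\,\alpha^{-1/2}\,\|H(f-\Pi_Hf)\|_{L^2(\Omega)},\qquad C_1=C_A+\frac{\|H\mathbf b\|_{L^\infty(\Omega)}}{\alpha}.$$ -/

import Mathlib

open MeasureTheory Set
open scoped ContDiff RealInnerProductSpace ENNReal

noncomputable section

namespace DGMS

/-- Euclidean space of dimension `d`. -/
abbrev Sp (d : ℕ) := EuclideanSpace ℝ (Fin d)

/-! ### Reference elements -/

/-- The two kinds of elements: simplices, or quadrilaterals/hexahedra. -/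
inductive Shape
  | simplex
  | cube

/-- Index type of the facets of the reference element: for the simplex `none` is the facet
`∑ xᵢ = 1` and `some i` the facet `xᵢ = 0`; for the cube `(i, false)` and `(i, true)` are the
facets `xᵢ = 0` and `xᵢ = 1`. -/
def Shape.Facet (s : Shape) (d : ℕ) : Type :=
  match s with
  | .simplex => Option (Fin d)
  | .cube => Fin d × Bool

instance (s : Shape) (d : ℕ) : Fintype (s.Facet d) :=
  match s with
  | .simplex => inferInstanceAs (Fintype (Option (Fin d)))
  | .cube => inferInstanceAs (Fintype (Fin d × Bool))

/-- The closed reference simplex or reference cube. -/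
def Shape.ref (s : Shape) (d : ℕ) : Set (Sp d) :=
  match s with
  | .simplex => {x | (∀ i, 0 ≤ x i) ∧ ∑ i, x i ≤ 1}
  | .cube => {x | ∀ i, 0 ≤ x i ∧ x i ≤ 1}

/-- The closed facets of the reference element. -/
def Shape.refFacet (s : Shape) (d : ℕ) : s.Facet d → Set (Sp d) :=
  match s with
  | .simplex => fun i =>
      match i with
      | none => {x | x ∈ Shape.simplex.ref d ∧ ∑ j, x j = 1}
      | some j => {x | x ∈ Shape.simplex.ref d ∧ x j = 0}
  | .cube => fun i => {x | x ∈ Shape.cube.ref d ∧ x i.1 = if i.2 then 1 else 0}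

/-- The polynomial space `𝒫₁` of the reference element: total degree at most one on the simplex,
degree at most one in each variable on the cube. -/
def Shape.IsP1 (s : Shape) {d : ℕ} (p : MvPolynomial (Fin d) ℝ) : Prop :=
  match s with
  | .simplex => p.totalDegree ≤ 1
  | .cube => ∀ i, p.degreeOf i ≤ 1

theorem Shape.isP1_zero (s : Shape) {d : ℕ} : s.IsP1 (0 : MvPolynomial (Fin d) ℝ) := by
  cases s <;> simp [Shape.IsP1]

theorem Shape.isP1_add (s : Shape) {d : ℕ} {p q : MvPolynomial (Fin d) ℝ}
    (hp : s.IsP1 p) (hq : s.IsP1 q) : s.IsP1 (p + q) := by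
  cases s with
  | simplex => exact (MvPolynomial.totalDegree_add p q).trans (max_le hp hq)
  | cube => exact fun i => (MvPolynomial.degreeOf_add_le i p q).trans (max_le (hp i) (hq i))

theorem Shape.isP1_C_mul (s : Shape) {d : ℕ} (c : ℝ) {p : MvPolynomial (Fin d) ℝ}
    (hp : s.IsP1 p) : s.IsP1 (MvPolynomial.C c * p) := by
  cases s with
  | simplex =>
    change (MvPolynomial.C c * p).totalDegree ≤ 1
    rw [MvPolynomial.C_mul']
    exact (MvPolynomial.totalDegree_smul_le c p).trans hp
  | cube => exact fun i => (MvPolynomial.degreeOf_C_mul_le p i c).trans (hp i)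

/-! ### Meshes -/

/-- A conforming (no hanging nodes) mesh of simplices, or of quadrilaterals/hexahedra.
The element `T` is the image of the closed reference element under the injective element map `F T`,
whose components belong to `𝒫₁` (affine maps for simplices, multilinear maps for
quadrilaterals/hexahedra). `ν T i` is the outward unit normal of `T` on its (flat) facet `i`: it is
determined by the fact that the facet lies in a supporting hyperplane of `T`. -/
structure Mesh (d : ℕ) (s : Shape) where
  /-- number of elements -/
  N : ℕ
  /-- element maps -/
  F : Fin N → Sp d → Sp d
  F_poly : ∀ T i, ∃ p : MvPolynomial (Fin d) ℝ,
    s.IsP1 p ∧ ∀ x : Sp d, F T x i = MvPolynomial.eval (fun j => x j) p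
  F_inj : ∀ T, InjOn (F T) (s.ref d)
  /-- outward unit normals -/
  ν : Fin N → s.Facet d → Sp d
  norm_ν : ∀ T i, ‖ν T i‖ = 1
  ν_outward : ∀ T i, ∀ x ∈ F T '' s.refFacet d i, ∀ y ∈ F T '' s.ref d, ⟪ν T i, y - x⟫ ≤ 0
  /-- two different elements meet in a common (possibly empty) proper face; a proper face is an
  intersection of facets -/
  conforming : ∀ T T', T ≠ T' → ∃ (I J : Set (s.Facet d)), I.Nonempty ∧ J.Nonempty ∧
    (F T '' s.ref d) ∩ (F T' '' s.ref d) = F T '' (⋂ i ∈ I, s.refFacet d i) ∧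
    (F T '' s.ref d) ∩ (F T' '' s.ref d) = F T' '' (⋂ j ∈ J, s.refFacet d j)

namespace Mesh

variable {d : ℕ} {s : Shape} (M : Mesh d s)

/-- The closed element with index `T`. -/
def elem (T : Fin M.N) : Set (Sp d) := M.F T '' s.ref d

/-- The closed facet `i` of the element `T`. -/
def face (T : Fin M.N) (i : s.Facet d) : Set (Sp d) := M.F T '' s.refFacet d i

/-- The elements subdivide `Ω`. -/
def IsMeshOf (Ω : Set (Sp d)) : Prop := (⋃ T, M.elem T) = closure Ω

/-- Shape regularity with constant `ρ`: every element map, scaled by the diameter of its element,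
is bi-Lipschitz on the reference element with constant `ρ`. -/
def ShapeRegular (ρ : ℝ) : Prop :=
  ∀ T, ∀ x ∈ s.ref d, ∀ y ∈ s.ref d,
    dist (M.F T x) (M.F T y) ≤ ρ * Metric.diam (M.elem T) * dist x y ∧
    Metric.diam (M.elem T) * dist x y ≤ ρ * dist (M.F T x) (M.F T y)

/-- The mesh function: on (the interior of) each element, the diameter of that element. -/
def meshFun (x : Sp d) : ℝ :=
  ∑ T, (interior (M.elem T)).indicator (fun _ => Metric.diam (M.elem T)) x

/-- The space `P₁(𝒯)` of discontinuous piecewise polynomials. A broken function is the family of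
its restrictions `v T` to the closed elements (extended by zero outside of the element), so that
`v T x` for `x` on a facet of `T` is the trace of `v` from inside `T`. -/
def P1 : Submodule ℝ (Fin M.N → Sp d → ℝ) where
  carrier := {v | ∀ T,
    (∃ p : MvPolynomial (Fin d) ℝ, s.IsP1 p ∧
      ∀ x ∈ s.ref d, v T (M.F T x) = MvPolynomial.eval (fun j => x j) p) ∧
    ∀ x, x ∉ M.elem T → v T x = 0}
  zero_mem' := fun T => ⟨⟨0, s.isP1_zero, by simp⟩, by simp⟩
  add_mem' := by
    intro u v hu hv T
    obtain ⟨⟨p, hp, hpu⟩, hu0⟩ := hu T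
    obtain ⟨⟨q, hq, hqv⟩, hv0⟩ := hv T
    exact ⟨⟨p + q, s.isP1_add hp hq, fun x hx => by simp [hpu x hx, hqv x hx]⟩,
      fun x hx => by simp [hu0 x hx, hv0 x hx]⟩
  smul_mem' := by
    intro c v hv T
    obtain ⟨⟨p, hp, hpv⟩, hv0⟩ := hv T
    exact ⟨⟨MvPolynomial.C c * p, s.isP1_C_mul c hp, fun x hx => by simp [hpv x hx]⟩,
      fun x hx => by simp [hv0 x hx]⟩

/-- The function on the domain given (off the mesh skeleton, a null set) by a broken function. -/
def toFun (v : Fin M.N → Sp d → ℝ) (x : Sp d) : ℝ :=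
  ∑ T, (interior (M.elem T)).indicator (v T) x

/-- The broken gradient on the closed element `T`. -/
def grad (v : Fin M.N → Sp d → ℝ) (T : Fin M.N) (x : Sp d) : Sp d :=
  gradientWithin (v T) (M.elem T) x

open Classical in
/-- The interior edges/faces `e = T⁻ ∩ T⁺`, each listed once, as a facet `e.1 = (T⁻, i)` which
coincides with a facet `e.2 = (T⁺, j)`; `T⁻` is the element with the smaller number. -/
def intEdges : Finset ((Fin M.N × s.Facet d) × (Fin M.N × s.Facet d)) :=
  Finset.univ.filter fun e => e.1.1 < e.2.1 ∧ M.face e.1.1 e.1.2 = M.face e.2.1 e.2.2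

open Classical in
/-- The boundary edges/faces. -/
def bdEdges (Ω : Set (Sp d)) : Finset (Fin M.N × s.Facet d) :=
  Finset.univ.filter fun e => M.face e.1 e.2 ⊆ frontier Ω

/-- Integral over a facet with respect to the surface measure (the Hausdorff measure of dimension
`d - 1`, normalised so as to agree with Lebesgue measure on hyperplanes). -/
def faceInt (e : Fin M.N × s.Facet d) (g : Sp d → ℝ) : ℝ :=
  ∫ x in M.face e.1 e.2, g x ∂(Measure.euclideanHausdorffMeasure (d - 1))

/-- The jump `[v] = v⁻ - v⁺` on an interior edge. -/
def jump (v : Fin M.N → Sp d → ℝ) (e : (Fin M.N × s.Facet d) × (Fin M.N × s.Facet d))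
    (x : Sp d) : ℝ := v e.1.1 x - v e.2.1 x

/-- The average on an interior edge. -/
def avg (v : Fin M.N → Sp d → ℝ) (e : (Fin M.N × s.Facet d) × (Fin M.N × s.Facet d))
    (x : Sp d) : ℝ := (v e.1.1 x + v e.2.1 x) / 2

/-- The edge normal: it points from `T⁻` to `T⁺` on an interior edge `((T⁻, i), (T⁺, j))` if it is
taken at `e = (T⁻, i)`, and out of the domain on a boundary edge. -/
def nrm (e : Fin M.N × s.Facet d) : Sp d := M.ν e.1 e.2

/-- The broken conormal flux `n · A ∇v`, with the elementwise traces of `A` and of `∇v`. -/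
def flux (A : Fin M.N → Sp d → (Sp d →L[ℝ] Sp d)) (n : Sp d) (v : Fin M.N → Sp d → ℝ) :
    Fin M.N → Sp d → ℝ := fun T x => ⟪n, A T x (M.grad v T x)⟫

/-- The weight `σ_e / h_e` with `h_e` the diameter of the edge. -/
def pen (σ : Set (Sp d) → ℝ) (e : Fin M.N × s.Facet d) : ℝ :=
  σ (M.face e.1 e.2) / Metric.diam (M.face e.1 e.2)

/-- The symmetric interior penalty form. -/
def aD (Ω : Set (Sp d)) (A : Fin M.N → Sp d → (Sp d →L[ℝ] Sp d)) (σ : Set (Sp d) → ℝ)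
    (u v : Fin M.N → Sp d → ℝ) : ℝ :=
  (∑ T, ∫ x in M.elem T, ⟪A T x (M.grad u T x), M.grad v T x⟫)
  + (∑ e ∈ M.intEdges,
      (M.pen σ e.1 * M.faceInt e.1 (fun x => M.jump u e x * M.jump v e x)
        - M.faceInt e.1 (fun x => M.avg (M.flux A (M.nrm e.1) u) e x * M.jump v e x)
        - M.faceInt e.1 (fun x => M.avg (M.flux A (M.nrm e.1) v) e x * M.jump u e x)))
  + ∑ e ∈ M.bdEdges Ω,
      (M.pen σ e * M.faceInt e (fun x => u e.1 x * v e.1 x)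
        - M.faceInt e (fun x => M.flux A (M.nrm e) u e.1 x * v e.1 x)
        - M.faceInt e (fun x => M.flux A (M.nrm e) v e.1 x * u e.1 x))

/-- The negative part `x^⊖ = (|x| - x) / 2`. -/
def negPt (x : ℝ) : ℝ := (|x| - x) / 2

/-- The upwind convection form, with stabilisation `b_e = |b · ν_e| / 2`. -/
def aC (Ω : Set (Sp d)) (b : Sp d → Sp d) (u v : Fin M.N → Sp d → ℝ) : ℝ :=
  (∑ T, ∫ x in M.elem T, ⟪b x, M.grad u T x⟫ * v T x)
  + (∑ e ∈ M.intEdges,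
      M.faceInt e.1 (fun x => |⟪b x, M.nrm e.1⟫| / 2 * M.jump u e x * M.jump v e x))
  - (∑ e ∈ M.intEdges,
      M.faceInt e.1 (fun x => ⟪b x, M.nrm e.1⟫ * M.jump u e x * M.avg v e x))
  + ∑ e ∈ M.bdEdges Ω,
      M.faceInt e (fun x => negPt ⟪b x, M.nrm e⟫ * u e.1 x * v e.1 x)

/-- The discontinuous Galerkin form `a_h = a_hᵈ + a_hᶜ`. -/
def a (Ω : Set (Sp d)) (A : Fin M.N → Sp d → (Sp d →L[ℝ] Sp d)) (σ : Set (Sp d) → ℝ)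
    (b : Sp d → Sp d) (u v : Fin M.N → Sp d → ℝ) : ℝ :=
  M.aD Ω A σ u v + M.aC Ω b u v

/-- Square of the diffusion part of the energy norm (`|A^{1/2} ∇v|² = A∇v · ∇v`). -/
def normDSq (Ω : Set (Sp d)) (A : Fin M.N → Sp d → (Sp d →L[ℝ] Sp d)) (σ : Set (Sp d) → ℝ)
    (v : Fin M.N → Sp d → ℝ) : ℝ :=
  (∑ T, ∫ x in M.elem T, ⟪A T x (M.grad v T x), M.grad v T x⟫)
  + (∑ e ∈ M.intEdges, M.pen σ e.1 * M.faceInt e.1 (fun x => M.jump v e x ^ 2))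
  + ∑ e ∈ M.bdEdges Ω, M.pen σ e * M.faceInt e (fun x => v e.1 x ^ 2)

/-- Square of the convection part of the energy norm. -/
def normCSq (Ω : Set (Sp d)) (b : Sp d → Sp d) (v : Fin M.N → Sp d → ℝ) : ℝ :=
  (∑ e ∈ M.intEdges, M.faceInt e.1 (fun x => |⟪b x, M.nrm e.1⟫| / 2 * M.jump v e x ^ 2))
  + ∑ e ∈ M.bdEdges Ω, M.faceInt e (fun x => |⟪b x, M.nrm e⟫| / 2 * v e.1 x ^ 2)

/-- The energy norm. -/
def energyNorm (Ω : Set (Sp d)) (A : Fin M.N → Sp d → (Sp d →L[ℝ] Sp d)) (σ : Set (Sp d) → ℝ)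
    (b : Sp d → Sp d) (v : Fin M.N → Sp d → ℝ) : ℝ :=
  Real.sqrt (M.normDSq Ω A σ v + M.normCSq Ω b v)

/-- `p` is the `L²(Ω)`-projection of `g` onto `P₁(𝒯)`. -/
def IsL2Proj (Ω : Set (Sp d)) (g : Sp d → ℝ) (p : Fin M.N → Sp d → ℝ) : Prop :=
  p ∈ M.P1 ∧ ∀ w ∈ M.P1, ∫ x in Ω, (g x - M.toFun p x) * M.toFun w x = 0

end Mesh

/-! ### Two-scale spaces -/

/-- `Mh` is a refinement of `MH`: every fine element lies in a coarse element (its parent), and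
coarse broken functions, restricted to the fine elements, are fine broken functions (this inclusion
is automatic for simplices). -/
structure Refinement {d : ℕ} {sh sH : Shape} (Mh : Mesh d sh) (MH : Mesh d sH) where
  parent : Fin Mh.N → Fin MH.N
  elem_subset : ∀ T, Mh.elem T ⊆ MH.elem (parent T)
  nested : ∀ w ∈ MH.P1, (fun T => (Mh.elem T).indicator (w (parent T))) ∈ Mh.P1

section TwoScale

variable {d : ℕ} {sh sH : Shape} {Mh : Mesh d sh} {MH : Mesh d sH}

/-- A coarse broken function regarded as a fine broken function. -/
def Refinement.restrict (R : Refinement Mh MH) (w : Fin MH.N → Sp d → ℝ) :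
    Fin Mh.N → Sp d → ℝ := fun T => (Mh.elem T).indicator (w (R.parent T))

/-- The fine scale remainder space `V^f = {v ∈ V_h | Π_H v = 0}`. -/
def fineSpace (Mh : Mesh d sh) (MH : Mesh d sH) (Ω : Set (Sp d)) :
    Set (Fin Mh.N → Sp d → ℝ) :=
  {v | v ∈ Mh.P1 ∧ MH.IsL2Proj Ω (Mh.toFun v) 0}

/-- `φ = 𝔉 v`: `φ ∈ V^f` and `a(φ, w) = a(v, w)` for all `w ∈ V^f`. -/
def IsFineProj (Mh : Mesh d sh) (MH : Mesh d sH) (Ω : Set (Sp d))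
    (a : (Fin Mh.N → Sp d → ℝ) → (Fin Mh.N → Sp d → ℝ) → ℝ) (v φ : Fin Mh.N → Sp d → ℝ) : Prop :=
  φ ∈ fineSpace Mh MH Ω ∧ ∀ w ∈ fineSpace Mh MH Ω, a φ w = a v w

/-- The corrected coarse space `V_H^ms = (1 - 𝔉) V_H`. -/
def msSpace (R : Refinement Mh MH) (Ω : Set (Sp d))
    (a : (Fin Mh.N → Sp d → ℝ) → (Fin Mh.N → Sp d → ℝ) → ℝ) : Set (Fin Mh.N → Sp d → ℝ) :=
  {v | ∃ w ∈ MH.P1, ∃ φ, IsFineProj Mh MH Ω a (R.restrict w) φ ∧ v = R.restrict w - φ}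

/-- `u` is the Galerkin solution in the space `V`: `u ∈ V` and `a(u, v) = ∫_Ω f v` for all
`v ∈ V`. -/
def IsGalerkin (Mh : Mesh d sh) (Ω : Set (Sp d))
    (a : (Fin Mh.N → Sp d → ℝ) → (Fin Mh.N → Sp d → ℝ) → ℝ) (f : Sp d → ℝ)
    (V : Set (Fin Mh.N → Sp d → ℝ)) (u : Fin Mh.N → Sp d → ℝ) : Prop :=
  u ∈ V ∧ ∀ v ∈ V, a u v = ∫ x in Ω, f x * Mh.toFun v x

end TwoScale

/-! ### Coefficients -/

/-- `G` is the weak derivative of the vector field `b` in the open set `Ω`. -/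
def HasWeakFDeriv {d : ℕ} (Ω : Set (Sp d)) (b : Sp d → Sp d) (G : Sp d → (Sp d →L[ℝ] Sp d)) :
    Prop :=
  ∀ φ : Sp d → ℝ, ContDiff ℝ ∞ φ → HasCompactSupport φ → tsupport φ ⊆ Ω → ∀ w : Sp d,
    ∫ x in Ω, fderiv ℝ φ x w • b x = - ∫ x in Ω, φ x • G x w

/-- `b ∈ W^{1,∞}(Ω)^d` with `∇ · b = 0` almost everywhere, where `b` is identified with its
representative that is continuous up to the boundary. -/
structure DivFreeW1inf {d : ℕ} (Ω : Set (Sp d)) (b : Sp d → Sp d) : Prop where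
  continuousOn : ContinuousOn b (closure Ω)
  memLp : MemLp b ∞ (volume.restrict Ω)
  weak : ∃ G : Sp d → (Sp d →L[ℝ] Sp d), MemLp G ∞ (volume.restrict Ω) ∧ HasWeakFDeriv Ω b G ∧
    ∀ᵐ x ∂(volume.restrict Ω), LinearMap.trace ℝ (Sp d) (G x : Sp d →ₗ[ℝ] Sp d) = 0

/-- A symmetric diffusion field with spectral bounds `α ≤ A ≤ β`, given by its restrictions `A T` to
the closed fine elements, which are continuous up to the boundary of the element (the fine mesh
resolves `A`, so that `A` has one-sided traces on the edges). -/
structure Diffusion {d : ℕ} {s : Shape} (M : Mesh d s)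
    (A : Fin M.N → Sp d → (Sp d →L[ℝ] Sp d)) (α β : ℝ) : Prop where
  continuousOn : ∀ T, ContinuousOn (A T) (M.elem T)
  symm : ∀ T, ∀ x ∈ M.elem T, ∀ ξ η, ⟪A T x ξ, η⟫ = ⟪ξ, A T x η⟫
  lower : ∀ T, ∀ x ∈ M.elem T, ∀ ξ, α * ‖ξ‖ ^ 2 ≤ ⟪A T x ξ, ξ⟫
  upper : ∀ T, ∀ x ∈ M.elem T, ∀ ξ, ⟪A T x ξ, ξ⟫ ≤ β * ‖ξ‖ ^ 2

/-- The penalty parameters are large enough: `a_hᵈ` is coercive on `V_h` in the diffusion energy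
norm with constant `c₀`, and `σ_e ≥ c₀ α` on every edge. -/
structure PenaltyLarge {d : ℕ} {s : Shape} (M : Mesh d s) (Ω : Set (Sp d))
    (A : Fin M.N → Sp d → (Sp d →L[ℝ] Sp d)) (α : ℝ) (σ : Set (Sp d) → ℝ) (c₀ : ℝ) : Prop where
  coercive : ∀ v ∈ M.P1, c₀ * M.normDSq Ω A σ v ≤ M.aD Ω A σ v v
  lower : ∀ T i, c₀ * α ≤ σ (M.face T i)

end DGMS

end

/-!
The error `e = u_h - u_ms` is compared with its fine scale part `e_f = 𝔉 e`. Since `e - e_f` is a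
multiscale function, Galerkin orthogonality gives `a(e, e) = a(e, e_f) = a(e_f, e_f)`. Since the
multiscale space is `a`-orthogonal to the fine space, `a(e, e_f) = a(u_h, e_f) = ∫ f e_f`, and
here `f` may be replaced by `f - Π_H f` because `Π_H e_f = 0` (`exists_fineSpace_energy_eq`). It
remains to bound `‖H⁻¹ e_f‖²` by a multiple of `a(e_f, e_f) / α` (`exists_weighted_const`). The
resulting estimate has no convective contribution: the factor `C_1` enters only through `C_1 ≥ 1`.
The same bound shows that `a` is definite on the fine space, so that `𝔉` is well defined
(`existsUnique_isFineProj`).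

Three ingredients enter the weighted bound.

* The form is coercive: `aᶜ(v, v) = |||v|||_c²` (`Mesh.ShapeRegular.aC_self`), by the divergence
  theorem on the elements applied to `v² b`. As `b` is only weakly divergence-free, the theorem is
  obtained on convex polytopes by testing with cutoff functions and computing the limit of the layer
  integrals (`divergence_polytope`). The elements are convex polytopes whose facets are cut out by
  their supporting hyperplanes (`Mesh.ShapeRegular.elem_eq`,
  `Mesh.ShapeRegular.elem_inter_hyperplane`), and each facet is a boundary edge or one side of
  exactly one interior edge (`Mesh.ShapeRegular.sum_facets`); here conformity of the mesh and
  `int (closure Ω) = Ω` are used.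
* A broken Poincaré inequality on the coarse elements `K`. A function `w` of the fine space has mean
  value zero on `K`, and `(w(x) - w(y))² ≤ 2 |w|w|(x) - w|w|(y)|`. Hence the Poincaré inequality in
  `BV` for `w|w|` on the convex set `K` (`integral_sq_le_of_bv`) bounds `∫_K w²` by `diam K` times
  the total variation of `w|w|`, which consists of `2 ∫ |w| |∇w|` and of the jumps
  `∫ (|w⁻| + |w⁺|) |[w]|` (`Refinement.integral_sq_le`). By Young's inequality and the discrete trace
  inequality (`Mesh.exists_trace_const`) the factors `|w|` are absorbed on the left
  (`exists_poincare_const`). No trace inequality on the coarse elements is needed, so that the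
  constant does not depend on the relation between the two meshes.
* The lower bounds on `A` and on the penalty parameters, which compare the broken `H¹` norm with the
  energy norm.
-/


noncomputable section

namespace DGMS

section

variable {d : ℕ}

/-! ### Weakly divergence-free fields -/

/-- The field `b` is weakly divergence-free in `U`: it is orthogonal to the gradients of all test
functions. -/
def WeakDivFreeOn (b : Sp d → Sp d) (U : Set (Sp d)) : Prop :=
  ∀ φ : Sp d → ℝ, ContDiff ℝ ∞ φ → HasCompactSupport φ → tsupport φ ⊆ U →
    ∫ x in U, fderiv ℝ φ x (b x) = 0

/-- Mollification extends the class of test functions from smooth to continuously differentiable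
functions. -/
theorem WeakDivFreeOn.integral_fderiv_eq_zero {b : Sp d → Sp d} {U : Set (Sp d)}
    (hb : WeakDivFreeOn b U) (hU : IsOpen U) (hbi : IntegrableOn b U) {φ : Sp d → ℝ}
    (hφ : ContDiff ℝ 1 φ) (hc : HasCompactSupport φ) (hs : tsupport φ ⊆ U) :
    ∫ x in U, fderiv ℝ φ x (b x) = 0 := by
  have hcont : Continuous (fderiv ℝ φ) := hφ.continuous_fderiv one_ne_zero
  have huc := (hc.fderiv (𝕜 := ℝ)).uniformContinuous_of_continuous hcont
  obtain ⟨δ₀, hδ₀, hδU⟩ := hc.exists_cthickening_subset_open hU hs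
  have key : ∀ ε > 0, |∫ x in U, fderiv ℝ φ x (b x)| ≤ ε * ∫ x in U, ‖b x‖ := by
    intro ε hε
    obtain ⟨δ₁, hδ₁, hδ⟩ := Metric.uniformContinuous_iff.1 huc ε hε
    let η : ContDiffBump (0 : Sp d) :=
      ⟨min δ₀ δ₁ / 2, min δ₀ δ₁, by positivity, by linarith [lt_min hδ₀ hδ₁]⟩
    let ψ := convolution (η.normed volume) φ (ContinuousLinearMap.lsmul ℝ ℝ) volume
    have hli : LocallyIntegrable (η.normed volume) (volume : Measure (Sp d)) :=
      η.continuous_normed.locallyIntegrable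
    have hψ : ContDiff ℝ ∞ ψ :=
      η.hasCompactSupport_normed.contDiff_convolution_left _ η.contDiff_normed
        hφ.continuous.locallyIntegrable
    have hψs : tsupport ψ ⊆ Metric.cthickening δ₀ (tsupport φ) := by
      refine closure_minimal ?_ Metric.isClosed_cthickening
      refine (support_convolution_subset _).trans ?_
      rw [η.support_normed_eq]
      rintro _ ⟨a, ha, y, hy, rfl⟩
      refine Metric.mem_cthickening_of_dist_le _ y _ _ (subset_tsupport _ hy) ?_
      have ha' : ‖a‖ < min δ₀ δ₁ := mem_ball_zero_iff.1 ha
      have : dist (a + y) y = ‖a‖ := by simp [dist_eq_norm]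
      simpa [this] using ha'.le.trans (min_le_left _ _)
    have hψc : HasCompactSupport ψ :=
      η.hasCompactSupport_normed.convolution _ hc
    have h0 := hb ψ hψ hψc (hψs.trans hδU)
    have hψd : ∀ x v, ‖fderiv ℝ ψ x v - fderiv ℝ φ x v‖ ≤ ε * ‖v‖ := by
      intro x v
      rw [(hc.hasFDerivAt_convolution_right (ContinuousLinearMap.lsmul ℝ ℝ) hli hφ x).fderiv,
        convolution_precompR_apply _ hli (hc.fderiv (𝕜 := ℝ)) hcont, ← dist_eq_norm]
      refine ContDiffBump.dist_normed_convolution_le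
        (hcont.clm_apply continuous_const).aestronglyMeasurable fun y hy => ?_
      have hy' : dist y x < δ₁ := lt_of_lt_of_le hy (min_le_right _ _)
      rw [dist_eq_norm, ← _root_.sub_apply]
      refine (ContinuousLinearMap.le_opNorm _ _).trans ?_
      gcongr
      rw [← dist_eq_norm]
      exact (hδ hy').le
    have hint : ∀ χ : Sp d → ℝ, ContDiff ℝ 1 χ → HasCompactSupport χ →
        IntegrableOn (fun x => fderiv ℝ χ x (b x)) U := by
      intro χ h1 h2
      have hχ := h1.continuous_fderiv one_ne_zero
      obtain ⟨C, hC⟩ := (h2.fderiv (𝕜 := ℝ)).exists_bound_of_continuous hχ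
      refine (hbi.norm.const_mul C).mono' ?_ ?_
      · exact (ContinuousLinearMap.apply ℝ ℝ).flip.aestronglyMeasurable_comp₂
          hχ.aestronglyMeasurable hbi.aestronglyMeasurable
      · exact Filter.Eventually.of_forall fun x =>
          ((fderiv ℝ χ x).le_opNorm _).trans (by gcongr; exact hC x)
    have heq : ∫ x in U, fderiv ℝ φ x (b x)
        = - ∫ x in U, (fderiv ℝ ψ x (b x) - fderiv ℝ φ x (b x)) := by
      rw [integral_sub (hint ψ (hψ.of_le (by exact_mod_cast le_top)) hψc) (hint φ hφ hc), h0]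
      simp
    rw [heq, abs_neg, ← integral_const_mul, ← Real.norm_eq_abs]
    refine norm_integral_le_of_norm_le (hbi.norm.const_mul ε) ?_
    exact Filter.Eventually.of_forall fun x => hψd x (b x)
  have hI : 0 ≤ ∫ x in U, ‖b x‖ := integral_nonneg fun _ => norm_nonneg _
  refine abs_eq_zero.1 (le_antisymm (le_of_forall_pos_le_add fun ε hε => ?_) (abs_nonneg _))
  refine (key (ε / (1 + ∫ x in U, ‖b x‖)) (by positivity)).trans ?_
  rw [zero_add, div_mul_eq_mul_div, div_le_iff₀ (by positivity)]
  nlinarith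

/-! ### Slicing by parallel hyperplanes -/

/-- Cartesian coordinates along and orthogonal to a unit vector preserve the volume. -/
theorem measurePreserving_slice {ν : Sp d} (hν : ‖ν‖ = 1) :
    ∃ e : (ℝ × ((ℝ ∙ ν)ᗮ : Submodule ℝ (Sp d))) ≃ᵐ Sp d, MeasurePreserving e ∧
      ∀ t y, e (t, y) = t • ν + y := by
  let f : ℝ ≃ₗᵢ[ℝ] (ℝ ∙ ν : Submodule ℝ (Sp d)) := LinearIsometryEquiv.toSpanUnitSingleton ν hν
  have hf : MeasurePreserving f.toMeasurableEquiv := f.measurePreserving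
  let e₁ : (ℝ × ((ℝ ∙ ν)ᗮ : Submodule ℝ (Sp d))) ≃ᵐ ((ℝ ∙ ν : Submodule ℝ (Sp d)) × (ℝ ∙ ν)ᗮ) :=
    f.toMeasurableEquiv.prodCongr (MeasurableEquiv.refl _)
  have he₁ : MeasurePreserving e₁ := hf.prod (MeasurePreserving.id _)
  have he₂ := ((ℝ ∙ ν : Submodule ℝ (Sp d)).measurePreserving_measurableEquivProd (0 : Sp d)).symm
  rw [InnerProductSpace.euclideanHausdorffMeasure_eq_volume] at he₂
  refine ⟨e₁.trans ((ℝ ∙ ν : Submodule ℝ (Sp d)).measurableEquivProd (0 : Sp d)).symm,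
    he₁.trans he₂, fun t y => ?_⟩
  change ((ℝ ∙ ν : Submodule ℝ (Sp d)).measurableEquivProd (0 : Sp d)).symm (f t, y) = _
  simp [f]

theorem finrank_orthogonal_span {ν : Sp d} (hν : ‖ν‖ = 1) :
    Module.finrank ℝ ((ℝ ∙ ν)ᗮ : Submodule ℝ (Sp d)) = d - 1 := by
  have h := (ℝ ∙ ν : Submodule ℝ (Sp d)).finrank_add_finrank_orthogonal
  rw [finrank_span_singleton (by rintro rfl; simp at hν)] at h
  simp at h
  omega

theorem range_slice {ν : Sp d} (hν : ‖ν‖ = 1) (c : ℝ) :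
    range (fun y : ((ℝ ∙ ν)ᗮ : Submodule ℝ (Sp d)) => c • ν + (y : Sp d)) = {x | ⟪ν, x⟫ = c} := by
  ext x
  constructor
  · rintro ⟨y, rfl⟩
    have := Submodule.mem_orthogonal_singleton_iff_inner_right.1 y.2
    simp [inner_add_right, inner_smul_right, this, hν]
  · intro hx
    refine ⟨⟨x - c • ν, Submodule.mem_orthogonal_singleton_iff_inner_right.2 ?_⟩, by simp⟩
    rw [inner_sub_right, inner_smul_right, hx, real_inner_self_eq_norm_sq, hν]
    simp

theorem isometry_slice (ν : Sp d) (c : ℝ) :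
    Isometry (fun y : ((ℝ ∙ ν)ᗮ : Submodule ℝ (Sp d)) => c • ν + (y : Sp d)) :=
  (IsometryEquiv.addLeft (c • ν)).isometry.comp isometry_subtype_coe

/-- On a hyperplane the surface measure is the Lebesgue measure of its direction. -/
theorem map_slice {ν : Sp d} (hν : ‖ν‖ = 1) (c : ℝ) :
    (volume : Measure ((ℝ ∙ ν)ᗮ : Submodule ℝ (Sp d))).map
        (fun y : ((ℝ ∙ ν)ᗮ : Submodule ℝ (Sp d)) => c • ν + (y : Sp d))
      = μHE[d - 1].restrict {x : Sp d | ⟪ν, x⟫ = c} := by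
  rw [← range_slice hν, ← (isometry_slice ν c).map_euclideanHausdorffMeasure,
    ← InnerProductSpace.euclideanHausdorffMeasure_eq_volume, finrank_orthogonal_span hν]

theorem measurableEmbedding_slice (ν : Sp d) (c : ℝ) :
    MeasurableEmbedding (fun y : ((ℝ ∙ ν)ᗮ : Submodule ℝ (Sp d)) => c • ν + (y : Sp d)) :=
  (isometry_slice ν c).isClosedEmbedding.measurableEmbedding

theorem setIntegral_hyperplane {ν : Sp d} (hν : ‖ν‖ = 1) (c : ℝ) {s : Set (Sp d)}
    (hs : MeasurableSet s) (g : Sp d → ℝ) :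
    ∫ x in s ∩ {x | ⟪ν, x⟫ = c}, g x ∂μHE[d - 1]
      = ∫ y : ((ℝ ∙ ν)ᗮ : Submodule ℝ (Sp d)), s.indicator g (c • ν + (y : Sp d)) := by
  rw [← (measurableEmbedding_slice ν c).integral_map (g := s.indicator g), map_slice hν,
    integral_indicator hs, Measure.restrict_restrict hs]

theorem volume_slice_preimage {ν : Sp d} (hν : ‖ν‖ = 1) (c : ℝ) (s : Set (Sp d)) :
    volume ((fun y : ((ℝ ∙ ν)ᗮ : Submodule ℝ (Sp d)) => c • ν + (y : Sp d)) ⁻¹' s)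
      = μHE[d - 1] (s ∩ {x : Sp d | ⟪ν, x⟫ = c}) := by
  rw [← (measurableEmbedding_slice ν c).map_apply, map_slice hν,
    Measure.restrict_apply' (isClosed_eq (by fun_prop) (by fun_prop)).measurableSet]

/-- Two different hyperplanes meet in a set of surface measure zero; the second one is assumed to
have a different unit normal, so that it coincides with the first one only if both its normal and
its offset are opposite. -/
theorem hyperplane_inter_null {ν ν' : Sp d} (hν : ‖ν‖ = 1) {c c' : ℝ} (h : ν' ≠ ν)
    (h' : ‖ν'‖ = 1) (hc : ν' = -ν → c' ≠ -c) :
    μHE[d - 1] ({x : Sp d | ⟪ν', x⟫ = c'} ∩ {x : Sp d | ⟪ν, x⟫ = c}) = 0 := by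
  by_cases hn : ν' = -ν
  · convert measure_empty (μ := (μHE[d - 1] : Measure (Sp d)))
    ext x
    simp only [mem_inter_iff, mem_ofPred_eq, hn, inner_neg_left, mem_empty_iff_false, iff_false]
    rintro ⟨h1, h2⟩
    exact hc hn (by rw [← h1, h2])
  rw [← volume_slice_preimage hν]
  -- a functional on the hyperplane which is not constant has null level sets
  let ℓ : ((ℝ ∙ ν)ᗮ : Submodule ℝ (Sp d)) →ₗ[ℝ] ℝ :=
    (innerₛₗ ℝ ν').comp ((ℝ ∙ ν)ᗮ : Submodule ℝ (Sp d)).subtype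
  have hℓ : ℓ ≠ 0 := by
    intro h0
    have hmem : ν' ∈ (ℝ ∙ ν : Submodule ℝ (Sp d))ᗮᗮ := by
      rw [Submodule.mem_orthogonal]
      intro u hu
      rw [real_inner_comm]
      exact LinearMap.congr_fun h0 ⟨u, hu⟩
    rw [Submodule.orthogonal_orthogonal, Submodule.mem_span_singleton] at hmem
    obtain ⟨r, rfl⟩ := hmem
    rw [norm_smul, hν, mul_one, Real.norm_eq_abs] at h'
    rcases (abs_eq zero_le_one).1 h' with rfl | rfl
    · exact h (by simp)
    · exact hn (by simp)
  obtain ⟨w, hw⟩ : ∃ w, ℓ w ≠ 0 := by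
    by_contra! hall
    exact hℓ (LinearMap.ext hall)
  let S : AffineSubspace ℝ ((ℝ ∙ ν)ᗮ : Submodule ℝ (Sp d)) :=
    AffineSubspace.mk' (((c' - ⟪ν', c • ν⟫) / ℓ w) • w) (LinearMap.ker ℓ)
  have hS : ∀ y, y ∈ S ↔ ℓ y = c' - ⟪ν', c • ν⟫ := by
    intro y
    rw [AffineSubspace.mem_mk', LinearMap.mem_ker, vsub_eq_sub, map_sub, map_smul, smul_eq_mul,
      div_mul_cancel₀ _ hw, sub_eq_zero]
  have hST : S ≠ ⊤ := by
    intro htop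
    have h1 : (0 : ((ℝ ∙ ν)ᗮ : Submodule ℝ (Sp d))) ∈ S := htop ▸ AffineSubspace.mem_top ..
    have h2 : w ∈ S := htop ▸ AffineSubspace.mem_top ..
    rw [hS] at h1 h2
    exact hw (by rw [h2, ← h1, map_zero])
  refine measure_mono_null (fun y hy => ?_) (Measure.addHaar_affineSubspace volume S hST)
  rw [SetLike.mem_coe, hS]
  have : ⟪ν', c • ν + (y : Sp d)⟫ = c' := hy
  rw [inner_add_right] at this
  change ⟪ν', (y : Sp d)⟫ = _
  linarith

end

section

variable {d : ℕ}

/-! ### The divergence theorem on convex polytopes -/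

/-- A smooth cutoff on the line: zero on `(-∞, 1]` and one on `[2, ∞)`. -/
def cutoff (t : ℝ) : ℝ := Real.smoothTransition (t - 1)

theorem contDiff_cutoff : ContDiff ℝ 1 cutoff :=
  (Real.smoothTransition.contDiff (n := 1)).comp (contDiff_id.sub contDiff_const)

theorem cutoff_of_le {t : ℝ} (h : t ≤ 1) : cutoff t = 0 :=
  Real.smoothTransition.zero_of_nonpos (by linarith)

theorem cutoff_of_ge {t : ℝ} (h : 2 ≤ t) : cutoff t = 1 :=
  Real.smoothTransition.one_of_one_le (by linarith)

theorem cutoff_nonneg (t : ℝ) : 0 ≤ cutoff t := Real.smoothTransition.nonneg _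

theorem cutoff_le_one (t : ℝ) : cutoff t ≤ 1 := Real.smoothTransition.le_one _

theorem continuous_deriv_cutoff : Continuous (deriv cutoff) :=
  contDiff_cutoff.continuous_deriv le_rfl

theorem hasDerivAt_cutoff (t : ℝ) : HasDerivAt cutoff (deriv cutoff t) t :=
  (contDiff_cutoff.differentiable one_ne_zero t).hasDerivAt

theorem deriv_cutoff_of_lt {t : ℝ} (h : t < 1) : deriv cutoff t = 0 := by
  have : cutoff =ᶠ[nhds t] fun _ => 0 := by
    filter_upwards [Iio_mem_nhds h] with s hs using cutoff_of_le (le_of_lt hs)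
  rw [this.deriv_eq]; simp

theorem deriv_cutoff_of_gt {t : ℝ} (h : 2 < t) : deriv cutoff t = 0 := by
  have : cutoff =ᶠ[nhds t] fun _ => 1 := by
    filter_upwards [Ioi_mem_nhds h] with s hs using cutoff_of_ge (le_of_lt hs)
  rw [this.deriv_eq]; simp

theorem integrable_deriv_cutoff : Integrable (deriv cutoff) := by
  refine continuous_deriv_cutoff.integrable_of_hasCompactSupport ?_
  refine HasCompactSupport.intro (isCompact_Icc (a := 1) (b := 2)) fun t ht => ?_
  rcases not_and_or.1 ht with h | h
  · exact deriv_cutoff_of_lt (not_le.1 h)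
  · exact deriv_cutoff_of_gt (not_le.1 h)

theorem integral_deriv_cutoff : ∫ t, deriv cutoff t = 1 := by
  have h := integral_of_hasDerivAt_of_tendsto (f := cutoff) (m := 0) (n := 1) hasDerivAt_cutoff
    integrable_deriv_cutoff ?_ ?_
  · simpa using h
  · refine tendsto_const_nhds.congr' ?_
    filter_upwards [Filter.eventually_le_atBot 1] with t ht using (cutoff_of_le ht).symm
  · refine tendsto_const_nhds.congr' ?_
    filter_upwards [Filter.eventually_ge_atTop 2] with t ht using (cutoff_of_ge ht).symm

theorem prod_cutoff_nonneg {ι : Type*} (s : Finset ι) (f : ι → ℝ) : 0 ≤ ∏ j ∈ s, cutoff (f j) :=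
  Finset.prod_nonneg fun _ _ => cutoff_nonneg _

theorem prod_cutoff_le_one {ι : Type*} (s : Finset ι) (f : ι → ℝ) : ∏ j ∈ s, cutoff (f j) ≤ 1 :=
  Finset.prod_le_one (fun _ _ => cutoff_nonneg _) fun _ _ => cutoff_le_one _

section Polytope

variable {ι : Type*} [Fintype ι] [DecidableEq ι] {ν : ι → Sp d} {c : ι → ℝ} {T : Set (Sp d)}

/-- The layer weight of the facet `i`: the derivative of the `i`-th cutoff factor times the remaining
cutoff factors. The gradient of the product of all cutoff factors is `-δ⁻¹ ∑ i, layer i • ν i`. -/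
def layer (ν : ι → Sp d) (c : ι → ℝ) (δ : ℝ) (i : ι) (x : Sp d) : ℝ :=
  deriv cutoff ((c i - ⟪ν i, x⟫) / δ) * ∏ j ∈ Finset.univ.erase i, cutoff ((c j - ⟪ν j, x⟫) / δ)

theorem continuous_layer (δ : ℝ) (i : ι) : Continuous (layer ν c δ i) := by
  unfold layer
  refine (continuous_deriv_cutoff.comp (by fun_prop)).mul (continuous_finsetProd _ fun j _ => ?_)
  exact contDiff_cutoff.continuous.comp (by fun_prop)

theorem abs_layer_le (δ : ℝ) (i : ι) (x : Sp d) :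
    |layer ν c δ i x| ≤ |deriv cutoff ((c i - ⟪ν i, x⟫) / δ)| := by
  rw [layer, abs_mul, abs_of_nonneg (prod_cutoff_nonneg _ _)]
  exact mul_le_of_le_one_right (abs_nonneg _) (prod_cutoff_le_one _ _)

open Filter Topology in
theorem tendsto_cutoff_one {x : ℝ} {f : ℝ → ℝ} (hx : 0 < x)
    (hf : Tendsto f (𝓝[>] 0) (𝓝 x)) : ∀ᶠ δ in 𝓝[>] (0 : ℝ), cutoff (f δ / δ) = 1 := by
  have h1 : ∀ᶠ δ in 𝓝[>] (0 : ℝ), x / 2 < f δ := hf.eventually (lt_mem_nhds (by linarith))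
  have h2 : ∀ᶠ δ in 𝓝[>] (0 : ℝ), δ < x / 4 :=
    (tendsto_nhdsWithin_of_tendsto_nhds tendsto_id).eventually (gt_mem_nhds (by positivity))
  filter_upwards [h1, h2, self_mem_nhdsWithin] with δ h1 h2 (h3 : 0 < δ)
  refine cutoff_of_ge ?_
  rw [le_div_iff₀ h3]
  linarith

open Filter Topology in
/-- As the layer around the facet `i` gets thin, the layer integrals tend to the surface integral
over this facet. -/
theorem tendsto_layer_integral (hν : ∀ i, ‖ν i‖ = 1) (hT : T = {x | ∀ i, ⟪ν i, x⟫ ≤ c i})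
    (hTc : IsCompact T) (i : ι)
    (hnull : ∀ j ≠ i, μHE[d - 1] ({x | ⟪ν j, x⟫ = c j} ∩ (T ∩ {x : Sp d | ⟪ν i, x⟫ = c i})) = 0)
    {h : Sp d → ℝ} (hh : ContinuousOn h T) :
    Tendsto (fun δ => δ⁻¹ * ∫ x in T, layer ν c δ i x * h x) (𝓝[>] 0)
      (𝓝 (∫ x in T ∩ {x | ⟪ν i, x⟫ = c i}, h x ∂μHE[d - 1])) := by
  obtain ⟨B, hB⟩ := hTc.exists_bound_of_continuousOn hh
  have hTm : MeasurableSet T := hTc.measurableSet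
  set h₀ := T.indicator h with hh₀
  have hB0 : ∀ x, |h₀ x| ≤ |B| := by
    intro x
    by_cases hx : x ∈ T
    · rw [hh₀, indicator_of_mem hx]; exact (hB x hx).trans (le_abs_self _)
    · rw [hh₀, indicator_of_notMem hx]; simp
  have hm₀ : Measurable h₀ := by
    classical
    rw [hh₀, ← piecewise_eq_indicator]
    exact hh.measurable_piecewise continuousOn_const hTm
  obtain ⟨R, hR⟩ := hTc.isBounded.exists_norm_le
  let Y := ((ℝ ∙ ν i)ᗮ : Submodule ℝ (Sp d))
  obtain ⟨e, he, hee⟩ := measurePreserving_slice (hν i)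
  have hin : ∀ (t : ℝ) (y : Y), ⟪ν i, t • ν i + (y : Sp d)⟫ = t := by
    intro t y
    have := Submodule.mem_orthogonal_singleton_iff_inner_right.1 y.2
    simp [inner_add_right, inner_smul_right, this, hν]
  have hyR : ∀ (t : ℝ) (y : Y), t • ν i + (y : Sp d) ∈ T → ‖y‖ ≤ 2 * R := by
    intro t y hy
    have h1 := hR _ hy
    have h2 : |t| ≤ R := by
      rw [← hin t y]
      exact (abs_real_inner_le_norm _ _).trans (by rw [hν, one_mul]; exact h1)
    have h3 : ‖(y : Sp d)‖ ≤ ‖t • ν i + (y : Sp d)‖ + ‖t • ν i‖ := by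
      simpa using norm_sub_le (t • ν i + (y : Sp d)) (t • ν i)
    rw [norm_smul, hν, mul_one, Real.norm_eq_abs] at h3
    have h4 : ‖(y : Sp d)‖ ≤ 2 * R := by linarith
    exact h4
  -- the layer integral in the slicing coordinates, with the normal coordinate stretched by `δ⁻¹`
  let G : ℝ → Y → ℝ := fun δ y => ∫ s : ℝ,
    layer ν c δ i ((c i - δ * s) • ν i + (y : Sp d)) * h₀ ((c i - δ * s) • ν i + (y : Sp d))
  have hG : ∀ δ : ℝ, 0 < δ → δ⁻¹ * ∫ x in T, layer ν c δ i x * h x = ∫ y, G δ y := by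
    intro δ hδ
    have h1 : ∫ x in T, layer ν c δ i x * h x = ∫ x, layer ν c δ i x * h₀ x := by
      rw [← integral_indicator hTm]
      congr 1; ext x
      by_cases hx : x ∈ T <;> simp [hx, hh₀]
    have hint : Integrable (fun x => layer ν c δ i x * h₀ x) := by
      have : (fun x => layer ν c δ i x * h₀ x) = T.indicator (fun x => layer ν c δ i x * h x) := by
        ext x
        by_cases hx : x ∈ T <;> simp [hx, hh₀]
      rw [this, integrable_indicator_iff hTm]
      exact ((continuous_layer δ i).continuousOn.mul hh).integrableOn_compact hTc
    rw [h1, ← he.integral_comp e.measurableEmbedding, Measure.volume_eq_prod, integral_prod_symm _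
      (by rw [← Measure.volume_eq_prod]
          exact (he.integrable_comp_emb e.measurableEmbedding).2 hint), ← integral_const_mul]
    congr 1; ext y
    simp only [hee, G]
    have h2 := Measure.integral_comp_mul_left (fun t => layer ν c δ i ((c i - t) • ν i + (y : Sp d))
      * h₀ ((c i - t) • ν i + (y : Sp d))) δ
    rw [h2, integral_sub_left_eq_self (fun t => layer ν c δ i (t • ν i + (y : Sp d))
      * h₀ (t • ν i + (y : Sp d))), abs_of_pos (inv_pos.2 hδ), smul_eq_mul]
  -- a majorant that does not depend on `δ`
  have hlay : ∀ δ : ℝ, 0 < δ → ∀ (s : ℝ) (y : Y),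
      |layer ν c δ i ((c i - δ * s) • ν i + (y : Sp d))
        * h₀ ((c i - δ * s) • ν i + (y : Sp d))| ≤ |deriv cutoff s| * |B| := by
    intro δ hδ s y
    rw [abs_mul]
    refine mul_le_mul ((abs_layer_le _ _ _).trans_eq ?_) (hB0 _) (abs_nonneg _) (abs_nonneg _)
    rw [hin, sub_sub_cancel, mul_div_cancel_left₀ _ hδ.ne']
  have hpos : ∀ᶠ δ in 𝓝[>] (0 : ℝ), 0 < δ := self_mem_nhdsWithin
  have hmeas : ∀ δ, Measurable (fun p : Y × ℝ =>
      layer ν c δ i ((c i - δ * p.2) • ν i + (p.1 : Sp d))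
        * h₀ ((c i - δ * p.2) • ν i + (p.1 : Sp d))) := by
    intro δ
    have hz : Measurable (fun p : Y × ℝ => (c i - δ * p.2) • ν i + (p.1 : Sp d)) := by fun_prop
    exact ((continuous_layer δ i).measurable.comp hz).mul (hm₀.comp hz)
  rw [inter_comm, inter_comm, setIntegral_hyperplane (hν i) _ hTm]
  refine Tendsto.congr' (f₁ := fun δ => ∫ y, G δ y)
    (by filter_upwards [hpos] with δ hδ using (hG δ hδ).symm) ?_
  refine tendsto_integral_filter_of_dominated_convergence
    ((Metric.closedBall (0 : Y) (2 * R)).indicator fun _ => (∫ s, |deriv cutoff s| * |B|)) ?_ ?_ ?_ ?_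
  · exact Eventually.of_forall fun δ =>
      ((hmeas δ).stronglyMeasurable.integral_prod_right).aestronglyMeasurable
  · filter_upwards [hpos] with δ hδ
    refine Eventually.of_forall fun y => ?_
    by_cases hy : ‖y‖ ≤ 2 * R
    · rw [indicator_of_mem (by simpa using hy)]
      exact norm_integral_le_of_norm_le (integrable_deriv_cutoff.abs.mul_const _)
        (Eventually.of_forall fun s => hlay δ hδ s y)
    · rw [indicator_of_notMem (by simpa using hy)]
      have : ∀ s : ℝ, h₀ ((c i - δ * s) • ν i + (y : Sp d)) = 0 := fun s =>
        indicator_of_notMem (fun hmem => hy (hyR _ _ hmem)) _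
      simp [G, this]
  · exact (integrable_indicator_iff measurableSet_closedBall).2
      (integrableOn_const (isCompact_closedBall _ _).measure_lt_top.ne)
  -- almost every point of the facet lies on no other facet
  have hae : ∀ᵐ y : Y, ∀ j ≠ i, c i • ν i + (y : Sp d) ∈ T →
      ⟪ν j, c i • ν i + (y : Sp d)⟫ ≠ c j := by
    rw [ae_all_iff]
    intro j
    by_cases hj : j = i
    · simp [hj]
    have := hnull j hj
    rw [← inter_assoc, ← volume_slice_preimage (hν i)] at this
    filter_upwards [measure_eq_zero_iff_ae_notMem.1 this] with y hy _ hyT heq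
    exact hy ⟨heq, hyT⟩
  filter_upwards [hae] with y hy
  have hlim : ∫ s, deriv cutoff s * h₀ (c i • ν i + (y : Sp d)) = h₀ (c i • ν i + (y : Sp d)) := by
    rw [integral_mul_const, integral_deriv_cutoff, one_mul]
  change Tendsto (fun δ => G δ y) _ (𝓝 (h₀ (c i • ν i + (y : Sp d))))
  rw [← hlim]
  have hz : ∀ s : ℝ, Tendsto (fun δ : ℝ => (c i - δ * s) • ν i + (y : Sp d)) (𝓝[>] 0)
      (𝓝 (c i • ν i + (y : Sp d))) := by
    intro s
    have : Continuous fun δ : ℝ => (c i - δ * s) • ν i + (y : Sp d) := by fun_prop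
    simpa using (this.tendsto 0).mono_left nhdsWithin_le_nhds
  refine tendsto_integral_filter_of_dominated_convergence (fun s => |deriv cutoff s| * |B|)
    (Eventually.of_forall fun δ => ((hmeas δ).comp (measurable_const.prodMk
      measurable_id)).aestronglyMeasurable)
    (by filter_upwards [hpos] with δ hδ using Eventually.of_forall fun s => hlay δ hδ s y)
    (integrable_deriv_cutoff.abs.mul_const _) (Eventually.of_forall fun s => ?_)
  -- the weight vanishes for `s < 1`, so that only points on the inner side of the hyperplane matter
  by_cases hs : s < 1
  · have : ∀ᶠ δ in 𝓝[>] (0 : ℝ), 0 = layer ν c δ i ((c i - δ * s) • ν i + (y : Sp d))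
        * h₀ ((c i - δ * s) • ν i + (y : Sp d)) := by
      filter_upwards [hpos] with δ hδ
      rw [layer, hin, sub_sub_cancel, mul_div_cancel_left₀ _ hδ.ne', deriv_cutoff_of_lt hs]
      simp
    rw [deriv_cutoff_of_lt hs, zero_mul]
    exact tendsto_const_nhds.congr' this
  have hs0 : 0 < s := by linarith
  by_cases hyT : c i • ν i + (y : Sp d) ∈ T
  · -- a generic point of the facet: the other constraints are inactive
    have hpt : ∀ j, ⟪ν j, c i • ν i + (y : Sp d)⟫ ≤ c j := by rw [hT] at hyT; exact hyT
    have hev : ∀ j ∈ Finset.univ.erase i, ∀ᶠ δ in 𝓝[>] (0 : ℝ),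
        0 < c j - ⟪ν j, (c i - δ * s) • ν i + (y : Sp d)⟫ ∧
        cutoff ((c j - ⟪ν j, (c i - δ * s) • ν i + (y : Sp d)⟫) / δ) = 1 := by
      intro j hj
      have hlt : 0 < c j - ⟪ν j, c i • ν i + (y : Sp d)⟫ :=
        sub_pos.2 (lt_of_le_of_ne (hpt j) (hy j (Finset.ne_of_mem_erase hj) hyT))
      have ht : Tendsto (fun δ => c j - ⟪ν j, (c i - δ * s) • ν i + (y : Sp d)⟫) (𝓝[>] 0)
          (𝓝 (c j - ⟪ν j, c i • ν i + (y : Sp d)⟫)) :=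
        tendsto_const_nhds.sub (tendsto_const_nhds.inner (hz s))
      exact (ht.eventually (lt_mem_nhds hlt)).and (tendsto_cutoff_one hlt ht)
    have hev' := (Filter.eventually_all_finset _).2 hev
    have hmem : ∀ᶠ δ in 𝓝[>] (0 : ℝ), (c i - δ * s) • ν i + (y : Sp d) ∈ T := by
      filter_upwards [hev', hpos] with δ h1 h2
      rw [hT]
      intro j
      by_cases hj : j = i
      · subst hj
        rw [hin]
        nlinarith
      · exact (sub_pos.1 (h1 j (by simp [hj])).1).le
    have hh₀t : Tendsto (fun δ => h₀ ((c i - δ * s) • ν i + (y : Sp d))) (𝓝[>] 0)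
        (𝓝 (h₀ (c i • ν i + (y : Sp d)))) := by
      rw [hh₀, indicator_of_mem hyT]
      refine ((hh _ hyT).tendsto.comp (tendsto_nhdsWithin_iff.2 ⟨hz s, hmem⟩)).congr' ?_
      filter_upwards [hmem] with δ hδ
      rw [indicator_of_mem hδ]; rfl
    refine Tendsto.congr' ?_ (hh₀t.const_mul (deriv cutoff s))
    filter_upwards [hev', hpos] with δ h1 hδ
    rw [layer, hin, sub_sub_cancel, mul_div_cancel_left₀ _ hδ.ne',
      Finset.prod_eq_one fun j hj => (h1 j hj).2, mul_one]
  · have hev : ∀ᶠ δ in 𝓝[>] (0 : ℝ), (c i - δ * s) • ν i + (y : Sp d) ∉ T :=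
      (hz s).eventually (hTc.isClosed.isOpen_compl.mem_nhds hyT)
    rw [hh₀, indicator_of_notMem hyT, mul_zero]
    refine tendsto_const_nhds.congr' ?_
    filter_upwards [hev] with δ hδ
    rw [indicator_of_notMem hδ, mul_zero]

theorem hasFDerivAt_prod_cutoff (δ : ℝ) (x : Sp d) :
    HasFDerivAt (fun x => ∏ j, cutoff ((c j - ⟪ν j, x⟫) / δ))
      (-∑ i, (δ⁻¹ * layer ν c δ i x) • innerSL ℝ (ν i)) x := by
  have h1 : ∀ j, HasFDerivAt (fun x : Sp d => (c j - ⟪ν j, x⟫) / δ) (-(δ⁻¹ • innerSL ℝ (ν j))) x := by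
    intro j
    have h := ((innerSL ℝ (ν j)).hasFDerivAt (x := x)).const_sub (c j)
    simp only [div_eq_mul_inv]
    exact (h.mul_const δ⁻¹).congr_fderiv (smul_neg _ _)
  have h2 : ∀ j, HasFDerivAt (fun x : Sp d => cutoff ((c j - ⟪ν j, x⟫) / δ))
      (deriv cutoff ((c j - ⟪ν j, x⟫) / δ) • (-(δ⁻¹ • innerSL ℝ (ν j)))) x := fun j =>
    (hasDerivAt_cutoff _).comp_hasFDerivAt x (h1 j)
  refine (HasFDerivAt.finsetProd (u := Finset.univ) fun j _ => h2 j).congr_fderiv ?_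
  symm
  rw [← Finset.sum_neg_distrib]
  refine Finset.sum_congr rfl fun i _ => ?_
  simp only [layer, smul_neg, smul_smul]
  congr 2
  ring

open Filter Topology in
/-- **Divergence theorem** on a convex polytope with facet normals `ν i`, for the product of a
continuously differentiable function `g` and a continuous field `b` that is divergence-free in the
weak sense only: test the weak equation with `g` times a cutoff function and let the cutoff tend to
the indicator function of the polytope. -/
theorem divergence_polytope (hν : ∀ i, ‖ν i‖ = 1) (hinj : Function.Injective ν)
    (hT : T = {x | ∀ i, ⟪ν i, x⟫ ≤ c i}) (hTc : IsCompact T) (hne : (interior T).Nonempty)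
    {b : Sp d → Sp d} (hb : ContinuousOn b T) (hdiv : WeakDivFreeOn b (interior T))
    {g : Sp d → ℝ} (hg : ContDiffOn ℝ 1 g T) :
    ∫ x in T, fderivWithin ℝ g T x (b x)
      = ∑ i, ∫ x in T ∩ {x | ⟪ν i, x⟫ = c i}, g x * ⟪b x, ν i⟫ ∂μHE[d - 1] := by
  have hconv : Convex ℝ T := by
    rw [hT, ofPred_forall]
    exact convex_iInter fun i => convex_halfSpace_le (innerSL ℝ (ν i)).isLinear (c i)
  have hTm := hTc.measurableSet
  have hnull : ∀ i, ∀ j ≠ i,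
      μHE[d - 1] ({x | ⟪ν j, x⟫ = c j} ∩ (T ∩ {x : Sp d | ⟪ν i, x⟫ = c i})) = 0 := by
    intro i j hj
    by_cases hop : ν j = -ν i ∧ c j = -c i
    · -- then `T` would lie in a hyperplane
      exfalso
      obtain ⟨x, hx⟩ := hne
      obtain ⟨ε, hε, hball⟩ := Metric.isOpen_iff.1 isOpen_interior x hx
      have hmem : ∀ y ∈ T, ⟪ν i, y⟫ = c i := by
        intro y hy
        rw [hT] at hy
        have h1 := hy i
        have h2 := hy j
        rw [hop.1, hop.2, inner_neg_left] at h2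
        linarith
      have h1 := hmem x (interior_subset hx)
      have h2 := hmem (x + (ε / 2) • ν i) (interior_subset (hball (by
        rw [Metric.mem_ball, dist_eq_norm, add_sub_cancel_left, norm_smul, hν, mul_one,
          Real.norm_of_nonneg (by positivity)]; linarith)))
      rw [inner_add_right, inner_smul_right, real_inner_self_eq_norm_sq, hν, h1] at h2
      linarith
    · refine measure_mono_null ?_ (hyperplane_inter_null (hν i) (fun h => hj (hinj h)) (hν j)
        (c := c i) (c' := c j) fun h h' => hop ⟨h, h'⟩)
      exact fun x hx => ⟨hx.1, hx.2.2⟩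
  have hud : UniqueDiffOn ℝ T := uniqueDiffOn_convex hconv hne
  have hdg : ContinuousOn (fun x => fderivWithin ℝ g T x (b x)) T :=
    (hg.continuousOn_fderivWithin hud le_rfl).clm_apply hb
  have hfr : volume (frontier T) = 0 := hconv.addHaar_frontier volume
  have hintT : (interior T : Set (Sp d)) =ᵐ[volume] T := interior_ae_eq_of_null_frontier hfr
  have hbi : IntegrableOn b (interior T) := (hb.integrableOn_compact hTc).mono_set interior_subset
  let χ : ℝ → Sp d → ℝ := fun δ x => ∏ j, cutoff ((c j - ⟪ν j, x⟫) / δ)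
  have hχc : ∀ δ, ContDiff ℝ 1 (χ δ) := fun δ =>
    contDiff_prod fun j _ => contDiff_cutoff.comp
      ((contDiff_const.sub (contDiff_const.inner ℝ contDiff_id)).div_const δ)
  -- testing with `χ δ * g`
  have htest : ∀ δ > 0, ∫ x in T, χ δ x * fderivWithin ℝ g T x (b x)
      = ∑ i, δ⁻¹ * ∫ x in T, layer ν c δ i x * (g x * ⟪b x, ν i⟫) := by
    intro δ hδ
    -- `χ δ` is supported in the polytope with all facets moved inwards by `δ`
    let K : Set (Sp d) := {x | ∀ i, ⟪ν i, x⟫ ≤ c i - δ}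
    have hKcl : IsClosed K := by
      simp only [K, ofPred_forall]
      exact isClosed_iInter fun i => isClosed_le (by fun_prop) (by fun_prop)
    have hKint : K ⊆ interior T := by
      have hopen : IsOpen {x : Sp d | ∀ i, ⟪ν i, x⟫ < c i} := by
        simp only [ofPred_forall]
        exact isOpen_iInter_of_finite fun i => isOpen_lt (by fun_prop) (by fun_prop)
      have hsub : {x : Sp d | ∀ i, ⟪ν i, x⟫ < c i} ⊆ T :=
        fun x hx => by rw [hT]; exact fun i => (hx i).le
      refine Subset.trans (fun x hx => ?_) (interior_maximal hsub hopen)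
      exact fun i => (hx i).trans_lt (by linarith)
    have hKc : IsCompact K := hTc.of_isClosed_subset hKcl (hKint.trans interior_subset)
    have hχ0 : ∀ x ∉ K, χ δ x = 0 := by
      intro x hx
      simp only [K, mem_ofPred_eq, not_forall, not_le] at hx
      obtain ⟨i, hi⟩ := hx
      refine Finset.prod_eq_zero (Finset.mem_univ i) (cutoff_of_le ?_)
      rw [div_le_one hδ]
      linarith
    have hts : tsupport (fun x => χ δ x * g x) ⊆ K := by
      refine closure_minimal (fun x hx => ?_) hKcl
      by_contra hxK
      exact hx (by simp [hχ0 x hxK])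
    have hcd : ContDiff ℝ 1 (fun x => χ δ x * g x) := by
      rw [contDiff_iff_contDiffAt]
      intro x
      by_cases hx : x ∈ K
      · exact (hχc δ).contDiffAt.mul (hg.contDiffAt (mem_interior_iff_mem_nhds.1 (hKint hx)))
      · have : (fun x => χ δ x * g x) =ᶠ[𝓝 x] fun _ => 0 := by
          filter_upwards [hKcl.isOpen_compl.mem_nhds hx] with y hy
          simp [hχ0 y hy]
        exact contDiffAt_const.congr_of_eventuallyEq this
    have h0 := hdiv.integral_fderiv_eq_zero isOpen_interior hbi hcd
      (hKc.of_isClosed_subset (isClosed_tsupport _) hts) (hts.trans hKint)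
    have hcg : ∀ i, ContinuousOn (fun x => layer ν c δ i x * (g x * ⟪b x, ν i⟫)) T := fun i =>
      (continuous_layer δ i).continuousOn.mul (hg.continuousOn.mul (hb.inner continuousOn_const))
    have hd : ∀ x ∈ interior T, fderiv ℝ (fun x => χ δ x * g x) x (b x)
        = χ δ x * fderivWithin ℝ g T x (b x)
          - ∑ i, δ⁻¹ * (layer ν c δ i x * (g x * ⟪b x, ν i⟫)) := by
      intro x hx
      have hxT := mem_interior_iff_mem_nhds.1 hx
      have hgd : DifferentiableAt ℝ g x :=
        (hg.contDiffAt hxT).differentiableAt one_ne_zero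
      have h1 := (hasFDerivAt_prod_cutoff (ν := ν) (c := c) δ x).mul hgd.hasFDerivAt
      rw [show fderiv ℝ (fun x => χ δ x * g x) x = _ from h1.fderiv, fderivWithin_of_mem_nhds hxT]
      simp only [_root_.add_apply, _root_.smul_apply, _root_.neg_apply, smul_eq_mul, smul_neg,
        _root_.sum_apply, innerSL_apply_apply, Finset.mul_sum, sub_eq_add_neg, χ]
      congr 2
      refine Finset.sum_congr rfl fun i _ => ?_
      rw [real_inner_comm]
      ring
    rw [setIntegral_congr_fun isOpen_interior.measurableSet hd, setIntegral_congr_set hintT,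
      integral_sub] at h0
    · rw [sub_eq_zero.1 h0, integral_finsetSum]
      · exact Finset.sum_congr rfl fun i _ => integral_const_mul _ _
      · exact fun i _ => ((hcg i).integrableOn_compact hTc).const_mul _
    · exact ((hχc δ).continuous.continuousOn.mul hdg).integrableOn_compact hTc
    · exact integrable_finsetSum _ fun i _ => ((hcg i).integrableOn_compact hTc).const_mul _
  have hL : Tendsto (fun δ => ∫ x in T, χ δ x * fderivWithin ℝ g T x (b x)) (𝓝[>] 0)
      (𝓝 (∫ x in T, fderivWithin ℝ g T x (b x))) := by
    refine tendsto_integral_filter_of_dominated_convergence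
      (fun x => |fderivWithin ℝ g T x (b x)|) ?_ ?_ (hdg.integrableOn_compact hTc).abs ?_
    · exact Eventually.of_forall fun δ =>
        (((hχc δ).continuous.continuousOn.mul hdg).integrableOn_compact hTc).aestronglyMeasurable
    · refine Eventually.of_forall fun δ => Eventually.of_forall fun x => ?_
      rw [norm_mul, Real.norm_of_nonneg (prod_cutoff_nonneg _ _)]
      exact mul_le_of_le_one_left (abs_nonneg _) (prod_cutoff_le_one _ _)
    · rw [ae_restrict_iff' hTm]
      have : ∀ᵐ x, x ∉ frontier T := measure_eq_zero_iff_ae_notMem.1 hfr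
      filter_upwards [this] with x hx hxT
      have hxi : x ∈ interior T := by
        by_contra h
        exact hx ⟨subset_closure hxT, h⟩
      refine tendsto_const_nhds.congr' ?_
      have hlt : ∀ i, 0 < c i - ⟪ν i, x⟫ := by
        intro i
        obtain ⟨ε, hε, hball⟩ := Metric.isOpen_iff.1 isOpen_interior x hxi
        have h2 := interior_subset (hball (show x + (ε / 2) • ν i ∈ _ by
          rw [Metric.mem_ball, dist_eq_norm, add_sub_cancel_left, norm_smul, hν, mul_one,
            Real.norm_of_nonneg (by positivity)]; linarith))
        rw [hT] at h2
        have h3 := h2 i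
        rw [inner_add_right, inner_smul_right, real_inner_self_eq_norm_sq, hν] at h3
        linarith
      have hev : ∀ i, ∀ᶠ δ in 𝓝[>] (0 : ℝ), cutoff ((c i - ⟪ν i, x⟫) / δ) = 1 := fun i =>
        tendsto_cutoff_one (hlt i) tendsto_const_nhds
      filter_upwards [eventually_all.2 hev] with δ hδ
      simp [χ, hδ]
  have hR : Tendsto (fun δ => ∑ i, δ⁻¹ * ∫ x in T, layer ν c δ i x * (g x * ⟪b x, ν i⟫)) (𝓝[>] 0)
      (𝓝 (∑ i, ∫ x in T ∩ {x | ⟪ν i, x⟫ = c i}, g x * ⟪b x, ν i⟫ ∂μHE[d - 1])) :=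
    tendsto_finsetSum _ fun i _ => tendsto_layer_integral hν hT hTc i (hnull i)
      (hg.continuousOn.mul (hb.inner continuousOn_const))
  refine tendsto_nhds_unique hL (hR.congr' ?_)
  filter_upwards [self_mem_nhdsWithin] with δ hδ
  exact (htest δ hδ).symm

end Polytope

end

section

variable {d : ℕ}

/-! ### The Poincaré inequality on convex sets -/

theorem lintegral_comp_add_smul_le (G : Sp d → ℝ≥0∞) (hG : Measurable G) (a : Sp d) {s : ℝ}
    (hs : 1 / 2 ≤ s) : ∫⁻ x, G (a + s • x) ≤ 2 ^ d * ∫⁻ x, G x := by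
  have h1 : ∫⁻ x, G (a + s • x) = ∫⁻ x, G (a + x) ∂(volume.map fun x : Sp d => s • x) := by
    rw [lintegral_map (by fun_prop) (by fun_prop)]
  rw [h1, Measure.map_addHaar_smul _ (by linarith), lintegral_smul_measure,
    lintegral_add_left_eq_self, smul_eq_mul]
  gcongr
  rw [finrank_euclideanSpace_fin, abs_of_nonneg (by positivity), ← inv_pow]
  refine (ENNReal.ofReal_le_ofReal (pow_le_pow_left₀ (by positivity)
    (inv_le_of_inv_le₀ two_pos (by linarith)) d)).trans_eq ?_
  rw [ENNReal.ofReal_pow two_pos.le]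
  norm_num

/-- `L¹` Poincaré inequality on a convex set `S`, in the form of a double integral. The
differences are integrated along the segments `y + t (x - y)`; for `t ≥ 1/2` one substitutes for `x`
and for `t ≤ 1/2` for `y`, so that the Jacobian never exceeds `2 ^ d`. -/
theorem lintegral_prod_sub_le {S : Set (Sp d)} (hS : Convex ℝ S) (hSm : MeasurableSet S)
    {D : ℝ≥0∞} (hD : ∀ x ∈ S, ∀ y ∈ S, ‖x - y‖ₑ ≤ D) {u : Sp d → ℝ} (hu : ContDiff ℝ 1 u) :
    ∫⁻ p, ‖u p.1 - u p.2‖ₑ ∂((volume.restrict S).prod (volume.restrict S))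
      ≤ 2 ^ d * D * volume S * ∫⁻ x in S, ‖fderiv ℝ u x‖ₑ := by
  have hu' : Continuous (fderiv ℝ u) := hu.continuous_fderiv one_ne_zero
  set G : Sp d → ℝ≥0∞ := S.indicator fun x => ‖fderiv ℝ u x‖ₑ with hGdef
  have hGm : Measurable G := (hu'.enorm.measurable).indicator hSm
  have hGi : ∫⁻ x, G x = ∫⁻ x in S, ‖fderiv ℝ u x‖ₑ := lintegral_indicator hSm _
  have hseg : ∀ x ∈ S, ∀ y ∈ S,
      ‖u x - u y‖ₑ ≤ D * ∫⁻ t in Icc (0 : ℝ) 1, G ((1 - t) • y + t • x) := by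
    intro x hx y hy
    have hder : ∀ t ∈ uIcc (0 : ℝ) 1, HasDerivAt (fun t : ℝ => u ((1 - t) • y + t • x))
        (fderiv ℝ u ((1 - t) • y + t • x) (x - y)) t := by
      intro t _
      have h1 : HasDerivAt (fun t : ℝ => (1 - t) • y + t • x) (x - y) t := by
        exact HasDerivAt.congr_deriv ((((hasDerivAt_id t).const_sub 1).smul_const y).add
          ((hasDerivAt_id t).smul_const x)) (by simp [sub_eq_neg_add])
      exact ((hu.differentiable one_ne_zero _).hasFDerivAt).comp_hasDerivAt t h1
    have hcont : Continuous fun t : ℝ => fderiv ℝ u ((1 - t) • y + t • x) (x - y) :=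
      (hu'.comp (by fun_prop)).clm_apply continuous_const
    have h := intervalIntegral.integral_eq_sub_of_hasDerivAt hder (hcont.intervalIntegrable 0 1)
    simp only [sub_self, zero_smul, one_smul, zero_add, sub_zero, add_zero] at h
    rw [← h, intervalIntegral.integral_of_le zero_le_one, ← integral_Icc_eq_integral_Ioc]
    refine (enorm_integral_le_lintegral_enorm _).trans ?_
    have hGt : Measurable fun t : ℝ => G ((1 - t) • y + t • x) := hGm.comp (by fun_prop)
    rw [← lintegral_const_mul _ hGt]
    refine setLIntegral_mono' measurableSet_Icc fun t ht => ?_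
    have hmem : (1 - t) • y + t • x ∈ S := hS hy hx (by linarith [ht.2]) ht.1 (by ring)
    rw [hGdef, indicator_of_mem hmem, mul_comm]
    refine (ContinuousLinearMap.le_opENorm _ _).trans ?_
    gcongr
    exact hD x hx y hy
  have hGm3 : Measurable fun q : (Sp d × Sp d) × ℝ => G ((1 - q.2) • q.1.2 + q.2 • q.1.1) :=
    hGm.comp (by fun_prop)
  calc ∫⁻ p, ‖u p.1 - u p.2‖ₑ ∂((volume.restrict S).prod (volume.restrict S))
      ≤ ∫⁻ p, D * (∫⁻ t in Icc (0 : ℝ) 1, G ((1 - t) • p.2 + t • p.1))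
          ∂((volume.restrict S).prod (volume.restrict S)) := by
        rw [Measure.prod_restrict]
        exact setLIntegral_mono' (hSm.prod hSm) fun p hp => hseg _ hp.1 _ hp.2
    _ = D * ∫⁻ t in Icc (0 : ℝ) 1, ∫⁻ p : Sp d × Sp d, G ((1 - t) • p.2 + t • p.1)
          ∂((volume.restrict S).prod (volume.restrict S)) := by
        rw [lintegral_const_mul _ hGm3.lintegral_prod_right', lintegral_lintegral_swap]
        exact hGm3.aemeasurable
    _ ≤ D * ∫⁻ t in Icc (0 : ℝ) 1, 2 ^ d * volume S * ∫⁻ x in S, ‖fderiv ℝ u x‖ₑ := by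
        gcongr with t
        have hm : Measurable fun p : Sp d × Sp d => G ((1 - t) • p.2 + t • p.1) :=
          hGm.comp (by fun_prop)
        have hin : ∀ (s : ℝ), 1 / 2 ≤ s → ∀ a : Sp d,
            ∫⁻ x in S, G (a + s • x) ≤ 2 ^ d * ∫⁻ x, G x := fun s hs a =>
          (setLIntegral_le_lintegral _ _).trans (lintegral_comp_add_smul_le G hGm a hs)
        have hout : ∫⁻ _ in S, 2 ^ d * (∫⁻ x, G x) = 2 ^ d * volume S * ∫⁻ x, G x := by
          rw [setLIntegral_const]; ring
        rw [← hGi, ← hout]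
        rcases le_total (1 / 2) t with ht | ht
        · rw [lintegral_prod_symm _ hm.aemeasurable]
          exact lintegral_mono fun y => hin t ht ((1 - t) • y)
        · rw [lintegral_prod _ hm.aemeasurable]
          refine lintegral_mono fun x => ?_
          simp_rw [add_comm _ (t • x)]
          exact hin (1 - t) (by linarith) _
    _ = 2 ^ d * D * volume S * ∫⁻ x in S, ‖fderiv ℝ u x‖ₑ := by
        rw [setLIntegral_const]
        simp
        ring

/-- The inner parallel set of `K` at distance `r`: the points whose closed `r`-ball lies in `K`. -/
def innerParallel (K : Set (Sp d)) (r : ℝ) : Set (Sp d) :=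
  {x | ∀ h : Sp d, ‖h‖ ≤ r → x + h ∈ K}

theorem convex_innerParallel {K : Set (Sp d)} (hK : Convex ℝ K) (r : ℝ) :
    Convex ℝ (innerParallel K r) := by
  intro x hx y hy a b ha hb hab h hh
  have := hK (hx h hh) (hy h hh) ha hb hab
  rw [smul_add, smul_add, add_add_add_comm, ← add_smul, hab, one_smul] at this
  exact this

theorem isClosed_innerParallel {K : Set (Sp d)} (hK : IsClosed K) (r : ℝ) :
    IsClosed (innerParallel K r) := by
  simp only [innerParallel, ofPred_forall]
  exact isClosed_iInter fun h => isClosed_iInter fun _ => hK.preimage (by fun_prop)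

theorem ball_subset_of_mem_innerParallel {K : Set (Sp d)} {r : ℝ} {x : Sp d}
    (hx : x ∈ innerParallel K r) : Metric.ball x r ⊆ interior K := by
  refine interior_maximal (fun y hy => ?_) Metric.isOpen_ball
  have := hx (y - x) (by rw [← dist_eq_norm]; exact (Metric.mem_ball.1 hy).le)
  simpa using this

/-- Poincaré inequality in `BV`: if the weak gradient of `ψ` in the interior of the convex set `K`
is dominated by the measure `μ`, then the double integral of the differences of `ψ` is bounded by
the mass of `μ`. -/
theorem lintegral_prod_sub_le_of_bv {K : Set (Sp d)} (hK : Convex ℝ K) (hKc : IsCompact K)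
    {D : ℝ≥0∞} (hD : ∀ x ∈ K, ∀ y ∈ K, ‖x - y‖ₑ ≤ D) {ψ : Sp d → ℝ}
    (hψ : IntegrableOn ψ K) {μ : Measure (Sp d)} [IsFiniteMeasure μ]
    (hbv : ∀ φ : Sp d → ℝ, ContDiff ℝ ∞ φ → HasCompactSupport φ → tsupport φ ⊆ interior K →
      ∀ v, |∫ x in K, ψ x * fderiv ℝ φ x v| ≤ ‖v‖ * ∫ x, |φ x| ∂μ) :
    ∫⁻ p, ‖ψ p.1 - ψ p.2‖ₑ ∂((volume.restrict K).prod (volume.restrict K))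
      ≤ 2 ^ d * D * volume K * μ univ := by
  have hKm := hKc.measurableSet
  let η : ℕ → ContDiffBump (0 : Sp d) := fun n =>
    ⟨1 / ((n : ℝ) + 1) / 2, 1 / ((n : ℝ) + 1), by positivity,
      half_lt_self (by positivity)⟩
  let r : ℕ → ℝ := fun n => 2 / ((n : ℝ) + 1)
  have hηr : ∀ n, (η n).rOut < r n := fun n => by
    change 1 / ((n : ℝ) + 1) < 2 / ((n : ℝ) + 1)
    gcongr
    norm_num
  set ψK := K.indicator ψ with hψKdef
  have hψK : Integrable ψK := (integrable_indicator_iff hKm).2 hψ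
  -- mollification, written with the smooth kernel on the right
  let u : ℕ → Sp d → ℝ := fun n =>
    convolution ψK ((η n).normed volume) (ContinuousLinearMap.mul ℝ ℝ) volume
  have hη1 : ∀ n, ContDiff ℝ 1 ((η n).normed (volume : Measure (Sp d))) := fun n =>
    (η n).contDiff_normed
  have hu : ∀ n, ContDiff ℝ 1 (u n) := fun n =>
    (η n).hasCompactSupport_normed.contDiff_convolution_right _ hψK.locallyIntegrable (hη1 n)
  have hηm : ∀ n, Measurable ((η n).normed (volume : Measure (Sp d))) := fun n =>
    (η n).continuous_normed.measurable
  -- the gradient of the mollification is bounded by the mollification of `μ`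
  have hgrad : ∀ n, ∀ x ∈ innerParallel K (r n),
      ‖fderiv ℝ (u n) x‖ₑ ≤ ∫⁻ y, (ENNReal.ofReal ((η n).normed volume (x - y))) ∂μ := by
    intro n x hx
    let φ : Sp d → ℝ := fun y => (η n).normed volume (x - y)
    have hφc : ContDiff ℝ ∞ φ := (η n).contDiff_normed.comp (contDiff_const.sub contDiff_id)
    have hφs : tsupport φ ⊆ Metric.closedBall x (η n).rOut := by
      refine closure_minimal (fun y hy => ?_) Metric.isClosed_closedBall
      have h1 : x - y ∈ Function.support ((η n).normed (volume : Measure (Sp d))) := hy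
      rw [(η n).support_normed_eq, mem_ball_zero_iff] at h1
      rw [Metric.mem_closedBall, dist_comm, dist_eq_norm]
      exact h1.le
    have hφK : tsupport φ ⊆ interior K :=
      (hφs.trans (Metric.closedBall_subset_ball (hηr n))).trans
        (ball_subset_of_mem_innerParallel hx)
    have hφcs : HasCompactSupport φ :=
      (isCompact_closedBall x _).of_isClosed_subset (isClosed_tsupport _) hφs
    have hφ0 : ∀ y, 0 ≤ φ y := fun y => (η n).nonneg_normed _
    have hφi : Integrable φ μ := by
      obtain ⟨C, hC⟩ := hφcs.exists_bound_of_continuous hφc.continuous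
      exact Integrable.of_bound hφc.continuous.aestronglyMeasurable C
        (Filter.Eventually.of_forall hC)
    have hbd : ‖fderiv ℝ (u n) x‖ ≤ ∫ y, φ y ∂μ := by
      refine ContinuousLinearMap.opNorm_le_bound _ (integral_nonneg hφ0) fun v => ?_
      have h1 : fderiv ℝ (u n) x v = -∫ y in K, ψ y * fderiv ℝ φ y v := by
        rw [((η n).hasCompactSupport_normed.hasFDerivAt_convolution_right _
          hψK.locallyIntegrable (hη1 n) x).fderiv, convolution_precompR_apply _
          hψK.locallyIntegrable ((η n).hasCompactSupport_normed.fderiv (𝕜 := ℝ))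
          ((hη1 n).continuous_fderiv one_ne_zero), convolution_mul, ← integral_neg,
          ← integral_indicator hKm]
        congr 1; ext y
        have h2 : HasFDerivAt φ (-(fderiv ℝ ((η n).normed volume) (x - y))) y := by
          exact ((((hη1 n).differentiable one_ne_zero (x - y)).hasFDerivAt).comp y
            ((hasFDerivAt_id y).const_sub x)).congr_fderiv (by ext; simp)
        by_cases hy : y ∈ K
        · simp [hψKdef, hy, h2.fderiv]
        · simp [hψKdef, hy]
      rw [h1, norm_neg, mul_comm]
      refine (hbv φ hφc hφcs hφK v).trans_eq ?_
      simp_rw [abs_of_nonneg (hφ0 _)]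
    rw [← ofReal_integral_eq_lintegral_ofReal hφi (Filter.Eventually.of_forall hφ0),
      ← ofReal_norm]
    exact ENNReal.ofReal_le_ofReal hbd
  have hSm : ∀ n, MeasurableSet (innerParallel K (r n)) := fun n =>
    (isClosed_innerParallel hKc.isClosed _).measurableSet
  have hr0 : ∀ n, 0 ≤ r n := fun n => by positivity
  have hSK : ∀ n, innerParallel K (r n) ⊆ K := fun n x hx => by
    simpa using hx 0 (by simpa using hr0 n)
  have hmain : ∀ n, ∫⁻ p in innerParallel K (r n) ×ˢ innerParallel K (r n),
      ‖u n p.1 - u n p.2‖ₑ ∂(volume.prod volume) ≤ 2 ^ d * D * volume K * μ univ := by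
    intro n
    rw [← Measure.prod_restrict]
    refine (lintegral_prod_sub_le (convex_innerParallel hK _) (hSm n)
      (fun x hx y hy => hD x (hSK n hx) y (hSK n hy)) (hu n)).trans ?_
    gcongr
    · exact hSK n
    · have hm2 : Measurable fun p : Sp d × Sp d =>
          ENNReal.ofReal ((η n).normed volume (p.1 - p.2)) :=
        ENNReal.measurable_ofReal.comp ((hηm n).comp (by fun_prop))
      calc ∫⁻ x in innerParallel K (r n), ‖fderiv ℝ (u n) x‖ₑ
          ≤ ∫⁻ x in innerParallel K (r n),
              ∫⁻ y, (ENNReal.ofReal ((η n).normed volume (x - y))) ∂μ :=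
            setLIntegral_mono' (hSm n) (hgrad n)
        _ ≤ ∫⁻ x, ∫⁻ y, (ENNReal.ofReal ((η n).normed volume (x - y))) ∂μ :=
            setLIntegral_le_lintegral _ _
        _ = ∫⁻ y, (∫⁻ x, ENNReal.ofReal ((η n).normed volume (x - y)) ∂volume) ∂μ :=
            lintegral_lintegral_swap
              (f := fun x y => ENNReal.ofReal ((η n).normed volume (x - y))) hm2.aemeasurable
        _ = ∫⁻ _, 1 ∂μ := by
            refine lintegral_congr fun y => ?_
            rw [lintegral_sub_right_eq_self
              (fun x => ENNReal.ofReal ((η n).normed volume x)) y,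
              ← ofReal_integral_eq_lintegral_ofReal (η n).integrable_normed
                (Filter.Eventually.of_forall fun x => (η n).nonneg_normed x),
              (η n).integral_normed, ENNReal.ofReal_one]
        _ = μ univ := by simp
  -- the mollifications are controlled on the inner parallel sets only, which exhaust the interior;
  -- Fatou's lemma gives the limit
  let Fn : ℕ → Sp d × Sp d → ℝ≥0∞ := fun n =>
    (innerParallel K (r n) ×ˢ innerParallel K (r n)).indicator fun p => ‖u n p.1 - u n p.2‖ₑ
  have hFm : ∀ n, Measurable (Fn n) := fun n => by
    have h1 := (hu n).continuous
    exact Measurable.indicator (Continuous.measurable (by fun_prop)) ((hSm n).prod (hSm n))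
  have hae1 : ∀ᵐ x ∂(volume : Measure (Sp d)),
      Filter.Tendsto (fun n => u n x) Filter.atTop (nhds (ψK x)) := by
    have := ContDiffBump.ae_convolution_tendsto_right_of_locallyIntegrable (φ := η) (K := 2)
      (l := Filter.atTop) (μ := (volume : Measure (Sp d))) (g := ψK)
      tendsto_one_div_add_atTop_nhds_zero_nat
      (Filter.Eventually.of_forall fun n => (mul_div_cancel₀ _ two_ne_zero).ge) hψK.locallyIntegrable
    filter_upwards [this] with x hx
    refine hx.congr fun n => ?_
    rw [convolution_lsmul_swap]
    simp only [u, convolution_mul, smul_eq_mul, mul_comm]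
  have hae2 : ∀ᵐ x ∂(volume.restrict K : Measure (Sp d)), x ∈ interior K := by
    rw [ae_restrict_iff' hKm]
    filter_upwards [measure_eq_zero_iff_ae_notMem.1 (hK.addHaar_frontier volume)] with x hx hxK
    by_contra h
    exact hx ⟨subset_closure hxK, h⟩
  have hae : ∀ᵐ x ∂(volume.restrict K : Measure (Sp d)),
      Filter.Tendsto (fun n => u n x) Filter.atTop (nhds (ψ x)) ∧
        ∀ᶠ n in Filter.atTop, x ∈ innerParallel K (r n) := by
    filter_upwards [ae_restrict_of_ae hae1, hae2] with x hx1 hx2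
    refine ⟨by rwa [hψKdef, indicator_of_mem (interior_subset hx2)] at hx1, ?_⟩
    obtain ⟨ε, hε, hb⟩ := Metric.isOpen_iff.1 isOpen_interior x hx2
    have ht : Filter.Tendsto r Filter.atTop (nhds 0) := by
      have := (tendsto_one_div_add_atTop_nhds_zero_nat (𝕜 := ℝ)).const_mul 2
      simpa [r, div_eq_mul_inv] using this
    filter_upwards [ht.eventually (gt_mem_nhds hε)] with n hn h hh
    exact interior_subset (hb (by simpa [Metric.mem_ball, dist_eq_norm] using hh.trans_lt hn))
  have hlim : ∀ᵐ p ∂((volume.restrict K).prod (volume.restrict K) : Measure (Sp d × Sp d)),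
      Filter.Tendsto (fun n => Fn n p) Filter.atTop (nhds ‖ψ p.1 - ψ p.2‖ₑ) := by
    filter_upwards [Measure.quasiMeasurePreserving_fst.ae hae,
      Measure.quasiMeasurePreserving_snd.ae hae] with p h1 h2
    refine ((h1.1.sub h2.1).enorm).congr' ?_
    filter_upwards [h1.2, h2.2] with n hn1 hn2
    exact (indicator_of_mem (show p ∈ innerParallel K (r n) ×ˢ innerParallel K (r n) from
      ⟨hn1, hn2⟩) (fun p : Sp d × Sp d => ‖u n p.1 - u n p.2‖ₑ)).symm
  calc ∫⁻ p, ‖ψ p.1 - ψ p.2‖ₑ ∂((volume.restrict K).prod (volume.restrict K))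
      = ∫⁻ p, Filter.liminf (fun n => Fn n p) Filter.atTop
          ∂((volume.restrict K).prod (volume.restrict K)) := by
        refine lintegral_congr_ae ?_
        filter_upwards [hlim] with p hp using hp.liminf_eq.symm
    _ ≤ Filter.liminf (fun n => ∫⁻ p, Fn n p ∂((volume.restrict K).prod (volume.restrict K)))
          Filter.atTop := lintegral_liminf_le hFm
    _ ≤ 2 ^ d * D * volume K * μ univ := by
        refine Filter.liminf_le_of_frequently_le' (Filter.Frequently.of_forall fun n => ?_)
        refine le_trans ?_ (hmain n)
        rw [← lintegral_indicator ((hSm n).prod (hSm n)), Measure.prod_restrict]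
        exact setLIntegral_le_lintegral _ _

/-- Squared differences are controlled by differences of the signed squares. -/
theorem sq_sub_le_two_mul_abs_sub (s t : ℝ) : (s - t) ^ 2 ≤ 2 * |s * |s| - t * (|t|)| := by
  rcases le_total 0 s with hs | hs <;> rcases le_total 0 t with ht | ht <;>
    simp only [abs_of_nonneg, abs_of_nonpos, hs, ht]
  · rcases le_total s t with h | h
    · rw [abs_of_nonpos (by nlinarith)]; nlinarith
    · rw [abs_of_nonneg (by nlinarith)]; nlinarith
  · rw [abs_of_nonneg (by nlinarith)]; nlinarith [sq_nonneg (s + t)]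
  · rw [abs_of_nonpos (by nlinarith)]; nlinarith [sq_nonneg (s + t)]
  · rcases le_total s t with h | h
    · rw [abs_of_nonpos (by nlinarith)]; nlinarith
    · rw [abs_of_nonneg (by nlinarith)]; nlinarith

/-- `L²` estimate for a function with mean value zero on a convex set, from the weak gradient of
`w |w|`. It follows from the `BV` Poincaré inequality since `(s - t)² ≤ 2 |s |s| - t |t||`. -/
theorem integral_sq_le_of_bv {K : Set (Sp d)} (hK : Convex ℝ K) (hKc : IsCompact K)
    (hne : (interior K).Nonempty) {w : Sp d → ℝ} (hw : AEStronglyMeasurable w (volume.restrict K))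
    {B : ℝ} (hB : ∀ x ∈ K, |w x| ≤ B) (hmean : ∫ x in K, w x = 0)
    {μ : Measure (Sp d)} [IsFiniteMeasure μ]
    (hbv : ∀ φ : Sp d → ℝ, ContDiff ℝ ∞ φ → HasCompactSupport φ → tsupport φ ⊆ interior K →
      ∀ v, |∫ x in K, (w x * |w x|) * fderiv ℝ φ x v| ≤ ‖v‖ * ∫ x, |φ x| ∂μ) :
    ∫ x in K, w x ^ 2 ≤ 2 ^ d * Metric.diam K * μ.real univ := by
  have hKm := hKc.measurableSet
  have : IsFiniteMeasure (volume.restrict K : Measure (Sp d)) :=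
    ⟨by simpa using hKc.measure_lt_top⟩
  have hb : ∀ᵐ x ∂(volume.restrict K), ‖w x‖ ≤ B := by
    rw [ae_restrict_iff' hKm]; exact Filter.Eventually.of_forall hB
  have hwi : Integrable w (volume.restrict K) := Integrable.of_bound hw B hb
  have hw2 : Integrable (fun x => w x ^ 2) (volume.restrict K) := by
    refine Integrable.of_bound (hw.pow 2) (B ^ 2) ?_
    filter_upwards [hb] with x hx
    rw [norm_pow]
    gcongr
  have hψi : IntegrableOn (fun x => w x * |w x|) K := by
    refine Integrable.of_bound (hw.mul hw.norm) (B * B) ?_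
    filter_upwards [hb] with x hx
    rw [norm_mul, Real.norm_eq_abs (|w x|), abs_abs]
    exact mul_le_mul hx hx (abs_nonneg _) ((norm_nonneg _).trans hx)
  have hD : ∀ x ∈ K, ∀ y ∈ K, ‖x - y‖ₑ ≤ ENNReal.ofReal (Metric.diam K) := by
    intro x hx y hy
    rw [← ofReal_norm, ← dist_eq_norm]
    exact ENNReal.ofReal_le_ofReal (Metric.dist_le_diam_of_mem hKc.isBounded hx hy)
  have h := lintegral_prod_sub_le_of_bv hK hKc hD hψi hbv
  have hV : 0 < volume.real K := by
    rw [measureReal_def]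
    exact ENNReal.toReal_pos ((isOpen_interior.measure_pos volume hne).trans_le
      (measure_mono interior_subset)).ne' hKc.measure_lt_top.ne
  -- the double integral of the squared differences; the mixed term vanishes with the mean value
  have hi1 : Integrable (fun p : Sp d × Sp d => w p.1 ^ 2)
      ((volume.restrict K).prod (volume.restrict K)) := hw2.comp_fst _
  have hi2 : Integrable (fun p : Sp d × Sp d => w p.2 ^ 2)
      ((volume.restrict K).prod (volume.restrict K)) := hw2.comp_snd _
  have hi3 : Integrable (fun p : Sp d × Sp d => w p.1 * w p.2)
      ((volume.restrict K).prod (volume.restrict K)) := hwi.mul_prod hwi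
  have heq : ∫ p, (w p.1 - w p.2) ^ 2 ∂((volume.restrict K).prod (volume.restrict K))
      = 2 * volume.real K * ∫ x in K, w x ^ 2 := by
    have : (fun p : Sp d × Sp d => (w p.1 - w p.2) ^ 2)
        = fun p => w p.1 ^ 2 + w p.2 ^ 2 - 2 * (w p.1 * w p.2) := by ext p; ring
    rw [this, integral_sub (f := fun p : Sp d × Sp d => w p.1 ^ 2 + w p.2 ^ 2) (hi1.add hi2)
      (hi3.const_mul 2), integral_add hi1 hi2,
      integral_const_mul, integral_prod_mul, hmean, integral_fun_fst (fun x => w x ^ 2),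
      integral_fun_snd (fun x => w x ^ 2)]
    simp [measureReal_def]
    ring
  have hψp : Integrable (fun p : Sp d × Sp d => w p.1 * |w p.1| - w p.2 * |w p.2|)
      ((volume.restrict K).prod (volume.restrict K)) :=
    (hψi.comp_fst _).sub (hψi.comp_snd _)
  have hle : ∫ p, (w p.1 - w p.2) ^ 2 ∂((volume.restrict K).prod (volume.restrict K))
      ≤ 2 * (2 ^ d * Metric.diam K * volume.real K * μ.real univ) := by
    calc _ ≤ ∫ p, 2 * (|w p.1 * |w p.1| - w p.2 * (|w p.2|)|)
            ∂((volume.restrict K).prod (volume.restrict K)) := by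
          refine integral_mono_of_nonneg (Filter.Eventually.of_forall fun p => sq_nonneg _)
            (hψp.abs.const_mul 2) (Filter.Eventually.of_forall fun p => ?_)
          exact sq_sub_le_two_mul_abs_sub _ _
      _ ≤ _ := by
          rw [integral_const_mul]
          gcongr
          have h2 : ∀ p : Sp d × Sp d, |w p.1 * |w p.1| - w p.2 * (|w p.2|)|
              = ‖w p.1 * |w p.1| - w p.2 * |w p.2|‖ := fun p => rfl
          simp_rw [h2]
          rw [integral_norm_eq_lintegral_enorm hψp.aestronglyMeasurable]
          refine (ENNReal.toReal_mono
            (ENNReal.mul_ne_top (ENNReal.mul_ne_top (by finiteness) hKc.measure_lt_top.ne)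
              (measure_ne_top μ univ)) h).trans_eq ?_
          simp [measureReal_def, ENNReal.toReal_mul, ENNReal.toReal_ofReal Metric.diam_nonneg]
  rw [heq] at hle
  refine le_of_mul_le_mul_left ?_ hV
  linarith

end

section

variable {d : ℕ}

/-! ### Reference elements -/

/-- The affine functions (barycentric coordinates of the simplex, distances to the facets of the
cube) whose nonnegativity defines the reference element. -/
def Shape.bary (s : Shape) (d : ℕ) : s.Facet d → Sp d → ℝ :=
  match s with
  | .simplex => fun i =>
      match i with
      | none => fun x => 1 - ∑ j, x j
      | some j => fun x => x j
  | .cube => fun i x => if i.2 then 1 - x i.1 else x i.1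

theorem Shape.mem_ref (s : Shape) {x : Sp d} : x ∈ s.ref d ↔ ∀ i, 0 ≤ s.bary d i x := by
  cases s with
  | simplex =>
    constructor
    · rintro ⟨h1, h2⟩ (_ | j)
      · exact sub_nonneg.2 h2
      · exact h1 j
    · exact fun h => ⟨fun j => h (some j), sub_nonneg.1 (h none)⟩
  | cube =>
    constructor
    · rintro h ⟨i, _ | _⟩
      · exact (h i).1
      · exact sub_nonneg.2 (h i).2
    · exact fun h i => ⟨h (i, false), sub_nonneg.1 (h (i, true))⟩

theorem Shape.mem_refFacet (s : Shape) {x : Sp d} {i : s.Facet d} :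
    x ∈ s.refFacet d i ↔ x ∈ s.ref d ∧ s.bary d i x = 0 := by
  cases s with
  | simplex =>
    rcases i with _ | j
    · exact and_congr_right fun _ => by
        change (∑ j, x j = 1) ↔ (1 - ∑ j, x j = 0)
        rw [sub_eq_zero, eq_comm]
    · exact Iff.rfl
  | cube =>
    rcases i with ⟨i, _ | _⟩
    · exact Iff.rfl
    · exact and_congr_right fun _ => by
        change (x i = 1) ↔ (1 - x i = 0)
        rw [sub_eq_zero, eq_comm]

theorem Shape.continuous_bary (s : Shape) (i : s.Facet d) : Continuous (s.bary d i) := by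
  cases s with
  | simplex =>
    rcases i with _ | j
    · change Continuous fun x : Sp d => 1 - ∑ j, x j
      fun_prop
    · change Continuous fun x : Sp d => x j
      fun_prop
  | cube =>
    rcases i with ⟨i, _ | _⟩
    · change Continuous fun x : Sp d => x i
      fun_prop
    · change Continuous fun x : Sp d => 1 - x i
      fun_prop

theorem Shape.bary_combo (s : Shape) (i : s.Facet d) (x y : Sp d) {a b : ℝ} (hab : a + b = 1) :
    s.bary d i (a • x + b • y) = a * s.bary d i x + b * s.bary d i y := by
  cases s with
  | simplex =>
    rcases i with _ | j
    · change 1 - ∑ j, (a • x + b • y) j = a * (1 - ∑ j, x j) + b * (1 - ∑ j, y j)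
      simp only [PiLp.add_apply, PiLp.smul_apply, smul_eq_mul, Finset.sum_add_distrib,
        ← Finset.mul_sum]
      linear_combination (-1 : ℝ) * hab
    · rfl
  | cube =>
    rcases i with ⟨i, _ | _⟩
    · rfl
    · change 1 - (a * x i + b * y i) = a * (1 - x i) + b * (1 - y i)
      linear_combination (-1 : ℝ) * hab

/-- Each facet of the reference element has a point on no other facet. -/
theorem Shape.exists_center (s : Shape) (hd : 1 ≤ d) (i : s.Facet d) :
    ∃ c : Sp d, s.bary d i c = 0 ∧ ∀ j, j ≠ i → 0 < s.bary d j c := by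
  have hd' : (0 : ℝ) < d := by exact_mod_cast hd
  cases s with
  | simplex =>
    rcases i with _ | j
    · refine ⟨WithLp.toLp 2 fun _ => 1 / (d : ℝ), ?_, ?_⟩
      · change 1 - ∑ j : Fin d, 1 / (d : ℝ) = 0
        simp [hd'.ne']
      · rintro (_ | k) hk
        · exact absurd rfl hk
        · change 0 < 1 / (d : ℝ)
          positivity
    · refine ⟨WithLp.toLp 2 fun k => if k = j then 0 else 1 / ((d : ℝ) + 1), ?_, ?_⟩
      · change (if j = j then (0 : ℝ) else _) = 0
        simp
      · rintro (_ | k) hk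
        · change 0 < 1 - ∑ k, if k = j then (0 : ℝ) else 1 / ((d : ℝ) + 1)
          have h1 : ∑ k, (if k = j then (0 : ℝ) else 1 / ((d : ℝ) + 1))
              ≤ ∑ _k : Fin d, 1 / ((d : ℝ) + 1) := by
            refine Finset.sum_le_sum fun k _ => ?_
            split_ifs
            · positivity
            · rfl
          have h2 : ∑ _k : Fin d, 1 / ((d : ℝ) + 1) < 1 := by
            rw [Finset.sum_const, Finset.card_univ, Fintype.card_fin, nsmul_eq_mul, mul_one_div,
              div_lt_one (by positivity)]
            linarith
          linarith
        · change 0 < if k = j then (0 : ℝ) else 1 / ((d : ℝ) + 1)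
          rw [if_neg (fun h => hk (by rw [h]))]
          positivity
  | cube =>
    rcases i with ⟨i, b⟩
    refine ⟨WithLp.toLp 2 fun k => if k = i then (if b then 1 else 0) else 1 / 2, ?_, ?_⟩
    · cases b
      · change (if i = i then (if false then (1 : ℝ) else 0) else 1 / 2) = 0
        simp
      · change 1 - (if i = i then (if true then (1 : ℝ) else 0) else 1 / 2) = 0
        simp
    · rintro ⟨k, b'⟩ hk
      have hne : k = i → b' ≠ b := by
        rintro rfl rfl
        exact hk rfl
      by_cases hki : k = i
      · have := hne hki
        cases b' <;> cases b <;> simp_all [Shape.bary]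
      · cases b'
        · simp [Shape.bary, hki]
        · simp only [Shape.bary, if_true, hki, if_false]
          norm_num

theorem Shape.convex_ref (s : Shape) : Convex ℝ (s.ref d) := by
  intro x hx y hy a b ha hb hab
  rw [s.mem_ref] at *
  intro i
  rw [s.bary_combo i x y hab]
  have := hx i
  have := hy i
  positivity

theorem Shape.isClosed_ref (s : Shape) : IsClosed (s.ref d) := by
  have : s.ref d = ⋂ i, {x | 0 ≤ s.bary d i x} := by
    ext x; simp [s.mem_ref]
  rw [this]
  exact isClosed_iInter fun i => isClosed_le continuous_const (s.continuous_bary i)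

theorem Shape.isClosed_refFacet (s : Shape) (i : s.Facet d) : IsClosed (s.refFacet d i) := by
  have : s.refFacet d i = s.ref d ∩ {x | s.bary d i x = 0} := by
    ext x; simp [s.mem_refFacet]
  rw [this]
  exact s.isClosed_ref.inter (isClosed_eq (s.continuous_bary i) continuous_const)

theorem Shape.refFacet_subset (s : Shape) (i : s.Facet d) : s.refFacet d i ⊆ s.ref d :=
  fun _ hx => (s.mem_refFacet.1 hx).1

theorem Shape.coord_mem_Icc (s : Shape) {x : Sp d} (hx : x ∈ s.ref d) (i : Fin d) :
    x i ∈ Icc (0 : ℝ) 1 := by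
  cases s with
  | simplex =>
    refine ⟨hx.1 i, le_trans ?_ hx.2⟩
    exact Finset.single_le_sum (fun j _ => hx.1 j) (Finset.mem_univ i)
  | cube => exact hx i

theorem Shape.isCompact_ref (s : Shape) : IsCompact (s.ref d) := by
  refine Metric.isCompact_of_isClosed_isBounded s.isClosed_ref ?_
  refine (isBounded_iff_forall_norm_le (E := Sp d)).2 ⟨Real.sqrt d, fun x hx => ?_⟩
  rw [EuclideanSpace.norm_eq]
  refine Real.sqrt_le_sqrt ((Finset.sum_le_sum fun i _ => ?_).trans (by simp : ∑ _i : Fin d,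
    (1 : ℝ) ≤ d))
  have h := s.coord_mem_Icc hx i
  rw [Real.norm_eq_abs, sq_abs]
  nlinarith [h.1, h.2]

theorem Shape.isCompact_refFacet (s : Shape) (i : s.Facet d) : IsCompact (s.refFacet d i) :=
  s.isCompact_ref.of_isClosed_subset (s.isClosed_refFacet i) (s.refFacet_subset i)

theorem Shape.mem_interior_ref (s : Shape) {x : Sp d} (hx : ∀ i, 0 < s.bary d i x) :
    x ∈ interior (s.ref d) := by
  refine mem_interior.2 ⟨{x | ∀ i, 0 < s.bary d i x}, fun y hy => s.mem_ref.2 fun i => (hy i).le,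
    ?_, hx⟩
  rw [ofPred_forall]
  exact isOpen_iInter_of_finite fun i => isOpen_lt continuous_const (s.continuous_bary i)

theorem Shape.exists_refFacet_of_notMem_interior (s : Shape) {x : Sp d} (hx : x ∈ s.ref d)
    (h : x ∉ interior (s.ref d)) : ∃ i, x ∈ s.refFacet d i := by
  by_contra! hall
  refine h (s.mem_interior_ref fun i => lt_of_le_of_ne (s.mem_ref.1 hx i) fun h0 => ?_)
  exact hall i (s.mem_refFacet.2 ⟨hx, h0.symm⟩)

theorem Shape.interior_ref_nonempty (s : Shape) (hd : 1 ≤ d) : (interior (s.ref d)).Nonempty := by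
  -- the midpoint of the centers of two facets
  obtain ⟨i, j, hij⟩ : ∃ i j : s.Facet d, i ≠ j := by
    cases s with
    | simplex => exact ⟨none, some ⟨0, hd⟩, (Option.some_ne_none _).symm⟩
    | cube => exact ⟨(⟨0, hd⟩, false), (⟨0, hd⟩, true),
        fun h => Bool.false_ne_true (congrArg Prod.snd h)⟩
  obtain ⟨c, hc, hc'⟩ := s.exists_center hd i
  obtain ⟨e, he, he'⟩ := s.exists_center hd j
  refine ⟨(1 / 2 : ℝ) • c + (1 / 2 : ℝ) • e, s.mem_interior_ref fun k => ?_⟩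
  rw [s.bary_combo k c e (by norm_num)]
  by_cases hk : k = i
  · subst hk
    have := he' k hij
    rw [hc]
    linarith
  · have h1 := hc' k hk
    by_cases hk' : k = j
    · subst hk'
      rw [he]
      linarith
    · have := he' k hk'
      linarith

theorem Shape.closure_interior_ref (s : Shape) (hd : 1 ≤ d) :
    closure (interior (s.ref d)) = s.ref d := by
  rw [s.convex_ref.closure_interior_eq_closure_of_nonempty_interior (s.interior_ref_nonempty hd),
    s.isClosed_ref.closure_eq]

/-- The points of a facet of the reference element which lie on no other facet are dense in it. -/
theorem Shape.exists_relint_near (s : Shape) (hd : 1 ≤ d) {i : s.Facet d} {x : Sp d}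
    (hx : x ∈ s.refFacet d i) {U : Set (Sp d)} (hU : U ∈ nhds x) :
    ∃ y ∈ U, y ∈ s.refFacet d i ∧ ∀ j, j ≠ i → y ∉ s.refFacet d j := by
  obtain ⟨c, hc, hc'⟩ := s.exists_center hd i
  rw [s.mem_refFacet, s.mem_ref] at hx
  have hcont : Filter.Tendsto (fun t : ℝ => (1 - t) • x + t • c) (nhdsWithin 0 (Ioi 0))
      (nhds x) := by
    have : Continuous fun t : ℝ => (1 - t) • x + t • c := by fun_prop
    simpa using (this.tendsto 0).mono_left nhdsWithin_le_nhds
  have h1 : ∀ᶠ t : ℝ in nhdsWithin 0 (Ioi 0), t < 1 :=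
    nhdsWithin_le_nhds (Iio_mem_nhds one_pos)
  obtain ⟨t, ht, ht1, ht0 : 0 < t⟩ :=
    ((hcont.eventually hU).and (h1.and self_mem_nhdsWithin)).exists
  have hb := fun j => s.bary_combo j x c (sub_add_cancel 1 t)
  have hpos : ∀ j, j ≠ i → 0 < s.bary d j ((1 - t) • x + t • c) := by
    intro j hj
    rw [hb]
    have := hx.1 j
    have := hc' j hj
    have : 0 ≤ 1 - t := by linarith
    positivity
  have hzero : s.bary d i ((1 - t) • x + t • c) = 0 := by
    rw [hb, hx.2, hc]; simp
  refine ⟨_, ht, s.mem_refFacet.2 ⟨s.mem_ref.2 fun j => ?_, hzero⟩, fun j hj hmem => ?_⟩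
  · by_cases hj : j = i
    · rw [hj, hzero]
    · exact (hpos j hj).le
  · exact (hpos j hj).ne' (s.mem_refFacet.1 hmem).2

theorem Shape.exists_relint (s : Shape) (hd : 1 ≤ d) (i : s.Facet d) :
    ∃ y ∈ s.refFacet d i, ∀ j, j ≠ i → y ∉ s.refFacet d j := by
  obtain ⟨c, hc, hc'⟩ := s.exists_center hd i
  refine ⟨c, s.mem_refFacet.2 ⟨s.mem_ref.2 fun j => ?_, hc⟩, fun j hj hmem =>
    (hc' j hj).ne' (s.mem_refFacet.1 hmem).2⟩
  by_cases hj : j = i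
  · rw [hj, hc]
  · exact (hc' j hj).le

/-- In dimension at least two a facet of the reference element has more than one point. -/
theorem Shape.refFacet_nontrivial (s : Shape) (hd : 2 ≤ d) (i : s.Facet d) :
    ∃ x ∈ s.refFacet d i, ∃ y ∈ s.refFacet d i, x ≠ y := by
  by_contra! h
  -- otherwise a facet would meet another facet, in its only point
  obtain ⟨c, hc, hcj⟩ := s.exists_relint (by omega) i
  obtain ⟨j, hj, x, hx, hx'⟩ : ∃ j ≠ i, ∃ x, x ∈ s.refFacet d i ∧ x ∈ s.refFacet d j := by
    cases s with
    | simplex =>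
      rcases i with _ | i
      · refine ⟨some ⟨0, by omega⟩, Option.some_ne_none _, EuclideanSpace.single ⟨1, by omega⟩ 1,
          ⟨⟨fun k => ?_, by simp⟩, by simp⟩, ⟨⟨fun k => ?_, by simp⟩, by simp⟩⟩
        all_goals simp only [PiLp.single_apply]; split_ifs <;> norm_num
      · refine ⟨some (if i = ⟨0, by omega⟩ then ⟨1, by omega⟩ else ⟨0, by omega⟩), ?_, 0,
          ⟨⟨fun k => by simp, by simp⟩, by simp⟩, ⟨⟨fun k => by simp, by simp⟩, by simp⟩⟩
        intro h
        have h := Option.some.inj h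
        split_ifs at h with h1
        · rw [h1] at h; simp at h
        · exact h1 h.symm
    | cube =>
      rcases i with ⟨i, b⟩
      refine ⟨(if i = ⟨0, by omega⟩ then ⟨1, by omega⟩ else ⟨0, by omega⟩, b), ?_,
        WithLp.toLp 2 fun _ => if b then 1 else 0,
        ⟨fun k => ?_, rfl⟩, ⟨fun k => ?_, rfl⟩⟩
      · intro h
        have h := (Prod.mk.inj h).1
        split_ifs at h with h1
        · rw [h1] at h; simp at h
        · exact h1 h.symm
      all_goals cases b <;> simp
  exact hcj j hj (h x hx c hc ▸ hx')

end

section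

variable {d : ℕ}

/-! ### Polynomials on the reference element -/

theorem Shape.IsP1.degreeOf_le {s : Shape} {p : MvPolynomial (Fin d) ℝ} (hp : s.IsP1 p)
    (i : Fin d) : p.degreeOf i ≤ 1 := by
  cases s with
  | simplex => exact (MvPolynomial.degreeOf_le_totalDegree p i).trans hp
  | cube => exact hp i

theorem Shape.isP1_C (s : Shape) (c : ℝ) : s.IsP1 (MvPolynomial.C c : MvPolynomial (Fin d) ℝ) := by
  cases s with
  | simplex =>
    change (MvPolynomial.C c : MvPolynomial (Fin d) ℝ).totalDegree ≤ 1
    simp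
  | cube => exact fun i => by simp

theorem Shape.isP1_sum (s : Shape) {ι : Type*} (t : Finset ι)
    (p : ι → MvPolynomial (Fin d) ℝ) (h : ∀ i ∈ t, s.IsP1 (p i)) : s.IsP1 (∑ i ∈ t, p i) := by
  classical
  induction t using Finset.induction_on with
  | empty => simpa using s.isP1_zero
  | insert a t ha ih =>
    rw [Finset.sum_insert ha]
    exact s.isP1_add (h a (Finset.mem_insert_self _ _))
      (ih fun i hi => h i (Finset.mem_insert_of_mem hi))

/-- A polynomial of degree at most one in a variable is an affine function of this variable. -/
theorem eval_update_eq {p : MvPolynomial (Fin d) ℝ} {k : Fin d} (hp : p.degreeOf k ≤ 1)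
    (x : Fin d → ℝ) (t : ℝ) :
    MvPolynomial.eval (Function.update x k t) p =
      (1 - t) * MvPolynomial.eval (Function.update x k 0) p
        + t * MvPolynomial.eval (Function.update x k 1) p := by
  simp only [MvPolynomial.eval_eq', Finset.mul_sum, ← Finset.sum_add_distrib]
  refine Finset.sum_congr rfl fun m hm => ?_
  have hmk : m k ≤ 1 := (MvPolynomial.degreeOf_le_iff.1 hp) m hm
  have hsplit : ∀ r : ℝ, ∏ i, Function.update x k r i ^ m i
      = r ^ m k * ∏ i ∈ Finset.univ.erase k, x i ^ m i := by
    intro r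
    rw [← Finset.mul_prod_erase _ _ (Finset.mem_univ k), Function.update_self]
    congr 1
    exact Finset.prod_congr rfl fun i hi => by
      rw [Function.update_of_ne (Finset.ne_of_mem_erase hi)]
  rw [hsplit, hsplit, hsplit]
  interval_cases m k
  · simp; ring
  · simp; ring

/-- A polynomial of total degree at most one is an affine function. -/
theorem eval_eq_of_totalDegree_le_one {p : MvPolynomial (Fin d) ℝ} (hp : p.totalDegree ≤ 1)
    (x : Fin d → ℝ) :
    MvPolynomial.eval x p = MvPolynomial.eval 0 p
      + ∑ k, x k * (MvPolynomial.eval (Pi.single k 1) p - MvPolynomial.eval 0 p) := by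
  simp only [MvPolynomial.eval_eq', ← Finset.sum_sub_distrib, Finset.mul_sum]
  rw [Finset.sum_comm, ← Finset.sum_add_distrib]
  refine Finset.sum_congr rfl fun m hm => ?_
  have hm1 : ∑ i, m i ≤ 1 := by
    have := (MvPolynomial.le_totalDegree hm).trans hp
    rwa [Finsupp.sum_fintype _ _ fun _ => rfl] at this
  by_cases h0 : m = 0
  · simp [h0]
  · obtain ⟨j, hj⟩ : ∃ j, m j ≠ 0 := by
      by_contra! h
      exact h0 (Finsupp.ext h)
    have hj1 : m j = 1 := by
      have := Finset.single_le_sum (f := fun i => m i) (fun i _ => Nat.zero_le _)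
        (Finset.mem_univ j)
      omega
    have hother : ∀ i, i ≠ j → m i = 0 := by
      intro i hi
      have := Finset.add_le_sum (f := fun i => m i) (fun i _ => Nat.zero_le _)
        (Finset.mem_univ i) (Finset.mem_univ j) hi
      omega
    have hprod : ∀ y : Fin d → ℝ, ∏ i, y i ^ m i = y j := by
      intro y
      rw [Finset.prod_eq_single j (fun i _ hi => by rw [hother i hi, pow_zero]) (by simp), hj1,
        pow_one]
    simp only [hprod, Pi.zero_apply, mul_zero, sub_zero, zero_add]
    rw [Finset.sum_eq_single j (fun k _ hk => by simp [hk.symm]) (by simp)]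
    simp [mul_comm]

theorem contDiff_eval (p : MvPolynomial (Fin d) ℝ) {n : ℕ∞} :
    ContDiff ℝ n (fun x : Sp d => MvPolynomial.eval (fun j => x j) p) := by
  have := (AnalyticOnNhd.eval_continuousLinearMap (𝕜 := ℝ)
    (EuclideanSpace.equiv (Fin d) ℝ : Sp d →L[ℝ] (Fin d → ℝ)) p).contDiffOn (n := n)
    uniqueDiffOn_univ
  exact contDiffOn_univ.1 this

/-- If an element of the polynomial space vanishes on a facet of the reference element and in a
further point of the reference element, then its gradient has a zero in the reference element. -/
theorem Shape.exists_fderiv_eq_zero (s : Shape) {p : MvPolynomial (Fin d) ℝ} (hp : s.IsP1 p)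
    {i : s.Facet d} (h0 : ∀ x ∈ s.refFacet d i, MvPolynomial.eval (fun j => x j) p = 0)
    {x : Sp d} (hx : x ∈ s.ref d) (hxi : x ∉ s.refFacet d i)
    (hx0 : MvPolynomial.eval (fun j => x j) p = 0) :
    ∃ z ∈ s.ref d, fderiv ℝ (fun x : Sp d => MvPolynomial.eval (fun j => x j) p) z = 0 := by
  cases s with
  | simplex =>
    -- the polynomial is affine and vanishes identically
    have haff := eval_eq_of_totalDegree_le_one hp
    suffices h : ∀ y : Fin d → ℝ, MvPolynomial.eval y p = 0 by
      exact ⟨x, hx, by simp [h]⟩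
    have hxb : Shape.simplex.bary d i x ≠ 0 := fun h => hxi (Shape.simplex.mem_refFacet.2 ⟨hx, h⟩)
    have hsingle : ∀ k : Fin d, EuclideanSpace.single k (1 : ℝ) ∈ Shape.simplex.ref d := by
      refine fun k => ⟨fun j => ?_, ?_⟩
      · simp only [PiLp.single_apply]
        split_ifs <;> norm_num
      · simp
    rcases i with _ | i
    · have hk : ∀ k, MvPolynomial.eval (Pi.single k 1) p = 0 := fun k =>
        h0 (EuclideanSpace.single k 1) ⟨hsingle k, by simp⟩
      have h := haff (fun j => x j)
      simp only [hk, zero_sub, ← Finset.sum_mul, mul_neg, Finset.sum_neg_distrib, hx0] at h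
      have hc : MvPolynomial.eval 0 p = 0 := by
        have : (1 - ∑ j, x j) * MvPolynomial.eval 0 p = 0 := by linarith
        exact (mul_eq_zero.1 this).resolve_left hxb
      intro y
      rw [haff, hc]
      simp [hk]
    · have hc : MvPolynomial.eval 0 p = 0 :=
        h0 0 ⟨⟨fun j => by simp, by simp⟩, by simp⟩
      have hk : ∀ k ≠ i, MvPolynomial.eval (Pi.single k 1) p = 0 := fun k hk =>
        h0 (EuclideanSpace.single k 1) ⟨hsingle k, by simp [hk.symm]⟩
      have h := haff (fun j => x j)
      rw [hx0, hc, Finset.sum_eq_single i (fun k _ hki => by simp [hk k hki]) (by simp), zero_add,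
        sub_zero] at h
      have hi := (mul_eq_zero.1 h.symm).resolve_left hxb
      intro y
      rw [haff, hc]
      simp only [sub_zero, zero_add]
      refine Finset.sum_eq_zero fun k _ => ?_
      by_cases hki : k = i
      · rw [hki, hi, mul_zero]
      · rw [hk k hki, mul_zero]
  | cube =>
    -- take the point of the facet below `x`: the polynomial vanishes on all coordinate lines
    -- through this point
    obtain ⟨i, b⟩ := i
    let β : ℝ := if b then 1 else 0
    have hβ : β ∈ Icc (0 : ℝ) 1 := by cases b <;> simp [β]
    let z : Sp d := WithLp.toLp 2 (Function.update (fun j => x j) i β)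
    have hz : ∀ j, z j = Function.update (fun j => x j) i β j := fun j => rfl
    have hzref : z ∈ Shape.cube.ref d := by
      intro j
      rw [hz]
      by_cases hj : j = i
      · subst hj; rw [Function.update_self]; exact hβ
      · rw [Function.update_of_ne hj]; exact hx j
    have hline : ∀ (k : Fin d) (t : ℝ),
        MvPolynomial.eval (Function.update (fun j => z j) k t) p = 0 := by
      intro k t
      by_cases hk : k = i
      · subst hk
        have hupd : ∀ r, Function.update (fun j => z j) k r
            = Function.update (fun j => x j) k r := by
          intro r; ext j
          by_cases hj : j = k
          · subst hj; simp
          · simp [hz, hj]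
        have haff := eval_update_eq (p := p) (hp k) (fun j => x j)
        have h1 : MvPolynomial.eval (Function.update (fun j => x j) k β) p = 0 :=
          h0 z ⟨hzref, by rw [hz, Function.update_self]⟩
        have h2 : MvPolynomial.eval (Function.update (fun j => x j) k (x k)) p = 0 := by
          rw [Function.update_eq_self]; exact hx0
        have hne : β ≠ x k := fun h => hxi ⟨hx, h.symm⟩
        rw [hupd, haff]
        rw [haff] at h1 h2
        have h3 : MvPolynomial.eval (Function.update (fun j => x j) k 0) p = 0 ∧
            MvPolynomial.eval (Function.update (fun j => x j) k 1) p = 0 := by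
          set u := MvPolynomial.eval (Function.update (fun j => x j) k 0) p
          set v := MvPolynomial.eval (Function.update (fun j => x j) k 1) p
          have hs : β - x k ≠ 0 := sub_ne_zero.2 hne
          have e1 : (β - x k) * (v - u) = 0 := by linear_combination h1 - h2
          have e2 := (mul_eq_zero.1 e1).resolve_left hs
          have e3 : u = 0 := by linear_combination h1 - β * e2
          exact ⟨e3, by linear_combination e2 + e3⟩
        rw [h3.1, h3.2]; ring
      · have hmem : ∀ r ∈ Icc (0 : ℝ) 1,
            MvPolynomial.eval (Function.update (fun j => z j) k r) p = 0 := by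
          intro r hr
          refine h0 (WithLp.toLp 2 (Function.update (fun j => z j) k r)) ⟨fun j => ?_, ?_⟩
          · change Function.update (fun j => z j) k r j ∈ Icc (0 : ℝ) 1
            by_cases hj : j = k
            · subst hj; rw [Function.update_self]; exact hr
            · rw [Function.update_of_ne hj]; exact hzref j
          · change Function.update (fun j => z j) k r i = _
            rw [Function.update_of_ne (Ne.symm hk), hz, Function.update_self]
        rw [eval_update_eq (hp k), hmem 0 (by simp), hmem 1 (by simp)]
        ring
    refine ⟨z, hzref, ?_⟩
    have hdiff : DifferentiableAt ℝ (fun x : Sp d => MvPolynomial.eval (fun j => x j) p) z :=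
      (contDiff_eval p (n := 1)).differentiable one_ne_zero z
    refine ContinuousLinearMap.coe_injective ((EuclideanSpace.basisFun (Fin d) ℝ).toBasis.ext
      fun k => ?_)
    have h1 : HasDerivAt (fun t : ℝ => z + t • EuclideanSpace.single k (1 : ℝ))
        (EuclideanSpace.single k (1 : ℝ)) 0 := by
      exact HasDerivAt.congr_deriv (((hasDerivAt_id (0 : ℝ)).smul_const
        (EuclideanSpace.single k (1 : ℝ))).const_add z) (by simp)
    have h2 := (hdiff.hasFDerivAt.congr_fderiv rfl).comp_hasDerivAt_of_eq 0 h1 (by simp)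
    have h3 : (fun x : Sp d => MvPolynomial.eval (fun j => x j) p) ∘
        (fun t : ℝ => z + t • EuclideanSpace.single k (1 : ℝ)) = fun _ => 0 := by
      ext t
      rw [Function.comp_apply, ← hline k (z k + t)]
      congr 2
      ext j
      by_cases hj : j = k
      · subst hj; simp
      · simp [hj]
    rw [h3] at h2
    simpa using h2.unique (hasDerivAt_const _ _)

theorem exists_norm_le_of_injective {E F : Type*} [NormedAddCommGroup E] [NormedSpace ℝ E]
    [FiniteDimensional ℝ E] [NormedAddCommGroup F] [NormedSpace ℝ F] (L : E →L[ℝ] F)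
    (hL : Function.Injective L) : ∃ K : ℝ, 0 ≤ K ∧ ∀ x, ‖x‖ ≤ K * ‖L x‖ := by
  obtain ⟨K, -, hK⟩ := (L : E →ₗ[ℝ] F).injective_iff_antilipschitz.1 hL
  exact ⟨K, K.2, fun x => by simpa using hK.le_mul_dist x 0⟩

/-- In a finite-dimensional space of continuous functions on a compact space the supremum norm is
bounded by the `L²` norm. -/
theorem exists_sq_le_integral_of_finiteDimensional {X : Type*} [TopologicalSpace X] [CompactSpace X]
    [MeasurableSpace X] [BorelSpace X] (μ : Measure X) [IsFiniteMeasure μ] [μ.IsOpenPosMeasure]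
    (V : Submodule ℝ C(X, ℝ)) [FiniteDimensional ℝ V] :
    ∃ C : ℝ, 0 ≤ C ∧ ∀ f ∈ V, ∀ x, f x ^ 2 ≤ C * ∫ y, f y ^ 2 ∂μ := by
  let L : V →L[ℝ] Lp ℝ 2 μ := (ContinuousMap.toLp (E := ℝ) 2 μ ℝ).comp V.subtypeL
  have hL : Function.Injective L :=
    (ContinuousMap.toLp_injective (E := ℝ) (p := 2) μ (𝕜 := ℝ)).comp Subtype.val_injective
  obtain ⟨K, hK0, hK⟩ := exists_norm_le_of_injective (E := V) (F := Lp ℝ 2 μ) L hL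
  refine ⟨K ^ 2, by positivity, fun f hf x => ?_⟩
  have h1 : ‖f‖ ≤ K * ‖ContinuousMap.toLp (E := ℝ) 2 μ ℝ f‖ := hK ⟨f, hf⟩
  have h2 : ‖ContinuousMap.toLp (E := ℝ) 2 μ ℝ f‖ ^ 2 = ∫ y, f y ^ 2 ∂μ := by
    rw [← real_inner_self_eq_norm_sq, L2.inner_def]
    refine integral_congr_ae ?_
    filter_upwards [ContinuousMap.coeFn_toLp (p := 2) (𝕜 := ℝ) μ f] with y hy
    rw [hy]
    simp [sq]
  rw [← h2, ← mul_pow, ← sq_abs]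
  exact pow_le_pow_left₀ (abs_nonneg _) ((f.norm_coe_le_norm x).trans h1) 2

/-- Norm equivalence on the finite-dimensional polynomial space of the reference element. -/
theorem Shape.exists_sq_le_integral (s : Shape) (hd : 1 ≤ d) : ∃ C : ℝ, 0 ≤ C ∧
    ∀ p : MvPolynomial (Fin d) ℝ, s.IsP1 p → ∀ x ∈ s.ref d,
      MvPolynomial.eval (fun j => x j) p ^ 2
        ≤ C * ∫ y in s.ref d, MvPolynomial.eval (fun j => y j) p ^ 2 := by
  have : CompactSpace (s.ref d) := isCompact_iff_compactSpace.1 s.isCompact_ref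
  have hm := (s.isClosed_ref (d := d)).measurableSet
  let μ := volume.comap ((↑) : s.ref d → Sp d)
  have : IsFiniteMeasure μ := ⟨by
    rw [comap_subtype_coe_apply hm]
    simpa using s.isCompact_ref.measure_lt_top⟩
  have : μ.IsOpenPosMeasure := ⟨by
    intro U hU ⟨x, hx⟩
    obtain ⟨U', hU', rfl⟩ := isOpen_induced_iff.1 hU
    have hxc : (x : Sp d) ∈ closure (interior (s.ref d)) := by
      rw [s.closure_interior_ref hd]; exact x.2
    have hne := mem_closure_iff.1 hxc U' hU' hx
    have hpos := (hU'.inter isOpen_interior).measure_pos volume hne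
    rw [comap_subtype_coe_apply hm]
    refine (hpos.trans_le (measure_mono ?_)).ne'
    exact fun y hy => ⟨⟨y, interior_subset hy.2⟩, hy.1, rfl⟩⟩
  let ev : MvPolynomial.restrictDegree (Fin d) ℝ 1 →ₗ[ℝ] C(s.ref d, ℝ) :=
    { toFun := fun p => ⟨fun x => MvPolynomial.eval (fun j => (x : Sp d) j) p.1,
        ((contDiff_eval p.1 (n := 0)).continuous).comp continuous_subtype_val⟩
      map_add' := fun p q => by ext x; simp
      map_smul' := fun c p => by ext x; simp [MvPolynomial.smul_eval] }
  obtain ⟨C, hC, h⟩ := exists_sq_le_integral_of_finiteDimensional μ (LinearMap.range ev)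
  refine ⟨C, hC, fun p hp x hx => ?_⟩
  have hpW : p ∈ MvPolynomial.restrictDegree (Fin d) ℝ 1 :=
    (MvPolynomial.mem_restrictDegree _ _ _).2 fun m hm i =>
      MvPolynomial.degreeOf_le_iff.1 (hp.degreeOf_le i) m hm
  refine (h (ev ⟨p, hpW⟩) ⟨_, rfl⟩ ⟨x, hx⟩).trans_eq ?_
  rw [← integral_subtype_comap hm]
  rfl

end

section

variable {d : ℕ} {s : Shape}

/-! ### Geometry of a single element -/

namespace Mesh

variable (M : Mesh d s) {ρ : ℝ} (T : Fin M.N)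

theorem contDiff_F {n : ℕ∞} : ContDiff ℝ n (M.F T) := by
  rw [contDiff_euclidean]
  intro i
  obtain ⟨p, -, hp⟩ := M.F_poly T i
  rw [funext hp]
  exact contDiff_eval p

theorem continuous_F : Continuous (M.F T) := (M.contDiff_F (n := 1) T).continuous

theorem isCompact_elem : IsCompact (M.elem T) := s.isCompact_ref.image (M.continuous_F T)

theorem isClosed_elem : IsClosed (M.elem T) := (M.isCompact_elem T).isClosed

theorem measurableSet_elem : MeasurableSet (M.elem T) := (M.isClosed_elem T).measurableSet

theorem isCompact_face (i : s.Facet d) : IsCompact (M.face T i) :=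
  (s.isCompact_refFacet i).image (M.continuous_F T)

theorem measurableSet_face (i : s.Facet d) : MeasurableSet (M.face T i) :=
  (M.isCompact_face T i).isClosed.measurableSet

theorem face_subset_elem (i : s.Facet d) : M.face T i ⊆ M.elem T :=
  image_mono (s.refFacet_subset i)

variable {M T}

theorem diam_elem_pos (hd : 2 ≤ d) : 0 < Metric.diam (M.elem T) := by
  obtain ⟨c, -⟩ := s.interior_ref_nonempty (d := d) (by omega)
  obtain ⟨i⟩ : Nonempty (s.Facet d) := by
    cases s with
    | simplex => exact ⟨none⟩
    | cube => exact ⟨(⟨0, by omega⟩, false)⟩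
  obtain ⟨x, hx, y, hy, hxy⟩ := s.refFacet_nontrivial hd i
  exact Metric.diam_pos ⟨_, mem_image_of_mem _ (s.refFacet_subset i hx), _,
    mem_image_of_mem _ (s.refFacet_subset i hy),
    fun h => hxy (M.F_inj T (s.refFacet_subset i hx) (s.refFacet_subset i hy) h)⟩
    (M.isCompact_elem T).isBounded

theorem diam_face_pos (hd : 2 ≤ d) (i : s.Facet d) : 0 < Metric.diam (M.face T i) := by
  obtain ⟨x, hx, y, hy, hxy⟩ := s.refFacet_nontrivial hd i
  exact Metric.diam_pos ⟨_, mem_image_of_mem _ hx, _, mem_image_of_mem _ hy,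
    fun h => hxy (M.F_inj T (s.refFacet_subset i hx) (s.refFacet_subset i hy) h)⟩
    (M.isCompact_face T i).isBounded

theorem diam_face_le (i : s.Facet d) : Metric.diam (M.face T i) ≤ Metric.diam (M.elem T) :=
  Metric.diam_mono (M.face_subset_elem T i) (M.isCompact_elem T).isBounded

theorem ShapeRegular.pos (hd : 2 ≤ d) (hM : M.ShapeRegular ρ) (T : Fin M.N) : 0 < ρ := by
  obtain ⟨i⟩ : Nonempty (s.Facet d) := by
    cases s with
    | simplex => exact ⟨none⟩
    | cube => exact ⟨(⟨0, by omega⟩, false)⟩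
  obtain ⟨x, hx, y, hy, hxy⟩ := s.refFacet_nontrivial hd i
  have h := (hM T x (s.refFacet_subset i hx) y (s.refFacet_subset i hy)).2
  have h1 : 0 < Metric.diam (M.elem T) * dist x y := mul_pos (diam_elem_pos hd) (dist_pos.2 hxy)
  exact pos_of_mul_pos_left (h1.trans_le h) dist_nonneg

/-- The lower bound of shape regularity, linearized. -/
theorem ShapeRegular.norm_le_fderiv (hd : 2 ≤ d) (hM : M.ShapeRegular ρ) {x : Sp d}
    (hx : x ∈ s.ref d) (v : Sp d) :
    Metric.diam (M.elem T) * ‖v‖ ≤ ρ * ‖fderiv ℝ (M.F T) x v‖ := by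
  have hcont : Continuous fun x => ρ * ‖fderiv ℝ (M.F T) x v‖ :=
    continuous_const.mul
      (((M.contDiff_F (n := 1) T).continuous_fderiv one_ne_zero).clm_apply continuous_const).norm
  rw [← s.closure_interior_ref (by omega)] at hx
  refine closure_minimal (s := interior (s.ref d)) (fun y hy => ?_)
    (isClosed_le continuous_const hcont) hx
  have hder : HasDerivAt (fun t : ℝ => M.F T (y + t • v)) (fderiv ℝ (M.F T) y v) 0 := by
    have h1 : HasDerivAt (fun t : ℝ => y + t • v) v 0 := by
      simpa using ((hasDerivAt_id (0 : ℝ)).smul_const v).const_add y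
    have h2 : HasFDerivAt (M.F T) (fderiv ℝ (M.F T) y) (y + (0 : ℝ) • v) := by
      rw [zero_smul, add_zero]
      exact ((M.contDiff_F (n := 1) T).differentiable one_ne_zero y).hasFDerivAt
    exact h2.comp_hasDerivAt 0 h1
  have hlim := (hasDerivAt_iff_tendsto_slope_zero.1 hder).norm.const_mul ρ
  refine ge_of_tendsto hlim ?_
  have hcv : ContinuousAt (fun t : ℝ => y + t • v) 0 := by fun_prop
  have hev : ∀ᶠ t : ℝ in nhds 0, y + t • v ∈ s.ref d := by
    refine hcv.eventually_mem ?_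
    simpa using mem_interior_iff_mem_nhds.1 hy
  filter_upwards [nhdsWithin_le_nhds hev, self_mem_nhdsWithin] with t ht ht0
  have ht0' : 0 < |t| := abs_pos.2 ht0
  have h := (hM T _ ht _ (interior_subset hy)).2
  rw [zero_add, zero_smul, add_zero, norm_smul, norm_inv, Real.norm_eq_abs]
  rw [dist_eq_norm, dist_eq_norm, add_sub_cancel_left, norm_smul, Real.norm_eq_abs] at h
  rw [← mul_le_mul_iff_of_pos_left ht0']
  calc |t| * (Metric.diam (M.elem T) * ‖v‖) = Metric.diam (M.elem T) * (|t| * ‖v‖) := by ring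
    _ ≤ _ := h
    _ = _ := by field_simp

/-- The element map is a local diffeomorphism at each point of the closed reference element. -/
theorem ShapeRegular.exists_equiv (hd : 2 ≤ d) (hM : M.ShapeRegular ρ) {x : Sp d}
    (hx : x ∈ s.ref d) :
    ∃ e : Sp d ≃L[ℝ] Sp d, HasStrictFDerivAt (M.F T) (e : Sp d →L[ℝ] Sp d) x := by
  have hinj : Function.Injective (fderiv ℝ (M.F T) x : Sp d →ₗ[ℝ] Sp d) := by
    rw [injective_iff_map_eq_zero]
    intro v hv
    have h := hM.norm_le_fderiv (T := T) hd hx v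
    have hv' : fderiv ℝ (M.F T) x v = 0 := hv
    rw [hv', norm_zero, mul_zero] at h
    exact norm_le_zero_iff.1 (nonpos_of_mul_nonpos_right h (diam_elem_pos hd))
  refine ⟨(LinearEquiv.ofInjectiveEndo _ hinj).toContinuousLinearEquiv, ?_⟩
  exact ((M.contDiff_F (n := 1) T).contDiffAt.hasStrictFDerivAt (x := x) one_ne_zero).congr_fderiv
    (ContinuousLinearMap.ext fun v => rfl)

theorem ShapeRegular.map_interior (hd : 2 ≤ d) (hM : M.ShapeRegular ρ) {x : Sp d}
    (hx : x ∈ interior (s.ref d)) : M.F T x ∈ interior (M.elem T) := by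
  obtain ⟨e, he⟩ := hM.exists_equiv (T := T) hd (interior_subset hx)
  rw [mem_interior_iff_mem_nhds, ← he.map_nhds_eq_of_equiv]
  exact Filter.image_mem_map (mem_interior_iff_mem_nhds.1 hx)

theorem ShapeRegular.interior_elem_nonempty (hd : 2 ≤ d) (hM : M.ShapeRegular ρ) :
    (interior (M.elem T)).Nonempty := by
  obtain ⟨x, hx⟩ := s.interior_ref_nonempty (d := d) (by omega)
  exact ⟨_, hM.map_interior hd hx⟩

theorem ShapeRegular.exists_face_of_notMem_interior (hd : 2 ≤ d) (hM : M.ShapeRegular ρ) {y : Sp d}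
    (hy : y ∈ M.elem T) (hy' : y ∉ interior (M.elem T)) : ∃ i, y ∈ M.face T i := by
  obtain ⟨x, hx, rfl⟩ := hy
  obtain ⟨i, hi⟩ := s.exists_refFacet_of_notMem_interior hx
    fun h => hy' (hM.map_interior hd h)
  exact ⟨i, mem_image_of_mem _ hi⟩

variable (M T) in
/-- The offset of the supporting hyperplane of the facet `i`. -/
def offset (i : s.Facet d) : ℝ := sSup ((fun x => ⟪M.ν T i, x⟫) '' M.elem T)

theorem inner_le_offset (i : s.Facet d) {x : Sp d} (hx : x ∈ M.elem T) :
    ⟪M.ν T i, x⟫ ≤ M.offset T i :=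
  le_csSup ((M.isCompact_elem T).image (by fun_prop)).bddAbove (mem_image_of_mem _ hx)

theorem inner_eq_offset (i : s.Facet d) {x : Sp d} (hx : x ∈ M.face T i) :
    ⟪M.ν T i, x⟫ = M.offset T i := by
  refine le_antisymm (inner_le_offset i (M.face_subset_elem T i hx)) ?_
  refine csSup_le ⟨_, mem_image_of_mem _ (M.face_subset_elem T i hx)⟩ ?_
  rintro _ ⟨y, hy, rfl⟩
  have := M.ν_outward T i x hx y hy
  rwa [inner_sub_right, sub_nonpos] at this

theorem inner_lt_of_mem_interior {C : Set (Sp d)} {ν : Sp d} (hν : ‖ν‖ = 1) {c : ℝ}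
    (h : ∀ y ∈ C, ⟪ν, y⟫ ≤ c) {x : Sp d} (hx : x ∈ interior C) : ⟪ν, x⟫ < c := by
  have hcv : ContinuousAt (fun t : ℝ => x + t • ν) 0 := by fun_prop
  have hev : ∀ᶠ t : ℝ in nhds 0, x + t • ν ∈ C :=
    hcv.eventually_mem (by simpa using mem_interior_iff_mem_nhds.1 hx)
  obtain ⟨t, ht, ht0⟩ := ((hev.filter_mono nhdsWithin_le_nhds).and
    (self_mem_nhdsWithin (a := (0 : ℝ)) (s := Ioi 0))).exists
  have := h _ ht
  rw [inner_add_right, inner_smul_right, real_inner_self_eq_norm_sq, hν] at this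
  have ht0' : 0 < t := ht0
  linarith

theorem inner_lt_offset_of_mem_interior (i : s.Facet d) {x : Sp d} (hx : x ∈ interior (M.elem T)) :
    ⟪M.ν T i, x⟫ < M.offset T i :=
  inner_lt_of_mem_interior (M.norm_ν T i) (fun _ hy => inner_le_offset i hy) hx

/-- An element is the intersection of its supporting half spaces: a segment that leaves the element
from an interior point does so through a facet. -/
theorem ShapeRegular.elem_eq (hd : 2 ≤ d) (hM : M.ShapeRegular ρ) (T : Fin M.N) :
    M.elem T = {x | ∀ i, ⟪M.ν T i, x⟫ ≤ M.offset T i} := by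
  refine Subset.antisymm (fun x hx i => inner_le_offset i hx) fun x hx => ?_
  by_contra hxT
  obtain ⟨y, hy⟩ := hM.interior_elem_nonempty (T := T) hd
  have hseg : IsPreconnected (segment ℝ y x) := (convex_segment y x).isPreconnected
  obtain ⟨z, hz, hzT, hzT'⟩ : ∃ z ∈ segment ℝ y x, z ∈ M.elem T ∧ z ∉ interior (M.elem T) := by
    by_contra! hno
    obtain ⟨z, -, hz1, hz2⟩ := hseg _ _ isOpen_interior (M.isClosed_elem T).isOpen_compl
      (fun z hz => or_iff_not_imp_right.2 fun h => hno z hz (not_not.1 h))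
      ⟨y, left_mem_segment ℝ y x, hy⟩ ⟨x, right_mem_segment ℝ y x, hxT⟩
    exact hz2 (interior_subset hz1)
  obtain ⟨i, hi⟩ := hM.exists_face_of_notMem_interior hd hzT hzT'
  have hzi := inner_eq_offset i hi
  obtain ⟨a, b, ha, hb, hab, rfl⟩ := hz
  have hyi := inner_lt_offset_of_mem_interior i hy
  have hxi := hx i
  rw [inner_add_right, inner_smul_right, inner_smul_right] at hzi
  rcases ha.eq_or_lt with rfl | ha
  · obtain rfl : b = 1 := by linarith
    simp only [zero_smul, one_smul, zero_add] at hzT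
    exact hxT hzT
  · have hbi := mul_le_mul_of_nonneg_left hxi hb
    have hai := mul_lt_mul_of_pos_left hyi ha
    have : a * M.offset T i + b * M.offset T i = M.offset T i := by rw [← add_mul, hab, one_mul]
    linarith

theorem ShapeRegular.convex_elem (hd : 2 ≤ d) (hM : M.ShapeRegular ρ) (T : Fin M.N) :
    Convex ℝ (M.elem T) := by
  rw [hM.elem_eq hd]
  intro x hx y hy a b ha hb hab i
  rw [inner_add_right, inner_smul_right, inner_smul_right]
  calc a * ⟪M.ν T i, x⟫ + b * ⟪M.ν T i, y⟫ ≤ a * M.offset T i + b * M.offset T i :=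
        add_le_add (mul_le_mul_of_nonneg_left (hx i) ha) (mul_le_mul_of_nonneg_left (hy i) hb)
    _ = M.offset T i := by rw [← add_mul, hab, one_mul]

/-- A supporting hyperplane meets the element exactly in the facet: otherwise its defining
function, pulled back to the reference element, would have a critical point, while the element map
has invertible derivatives. -/
theorem ShapeRegular.elem_inter_hyperplane (hd : 2 ≤ d) (hM : M.ShapeRegular ρ) (i : s.Facet d) :
    M.elem T ∩ {x | ⟪M.ν T i, x⟫ = M.offset T i} = M.face T i := by
  refine Subset.antisymm ?_ fun x hx => ⟨M.face_subset_elem T i hx, inner_eq_offset i hx⟩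
  rintro _ ⟨⟨x, hx, rfl⟩, hxi⟩
  by_contra hcon
  have hxi' : x ∉ s.refFacet d i := fun h => hcon (mem_image_of_mem _ h)
  choose p hp hpF using M.F_poly T
  let q : MvPolynomial (Fin d) ℝ := MvPolynomial.C (M.offset T i)
    + MvPolynomial.C (-1) * ∑ k, MvPolynomial.C (M.ν T i k) * p k
  have hq : s.IsP1 q := s.isP1_add (s.isP1_C _)
    (s.isP1_C_mul _ (s.isP1_sum _ _ fun k _ => s.isP1_C_mul _ (hp k)))
  have hqe : ∀ x : Sp d, MvPolynomial.eval (fun j => x j) q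
      = M.offset T i - ⟪M.ν T i, M.F T x⟫ := by
    intro x
    simp only [q, map_add, map_mul, MvPolynomial.eval_C, map_sum, ← hpF, PiLp.inner_apply]
    simp [sub_eq_add_neg, mul_comm]
  obtain ⟨z, hz, hz0⟩ := s.exists_fderiv_eq_zero hq (i := i)
    (fun y hy => by rw [hqe, inner_eq_offset i (mem_image_of_mem _ hy), sub_self]) hx hxi'
    (by rw [hqe, show ⟪M.ν T i, M.F T x⟫ = _ from hxi, sub_self])
  obtain ⟨e, he⟩ := hM.exists_equiv (T := T) hd hz
  rw [funext hqe] at hz0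
  have h1 : HasFDerivAt (fun x => M.offset T i - ⟪M.ν T i, M.F T x⟫)
      (-((innerSL ℝ (M.ν T i)).comp (e : Sp d →L[ℝ] Sp d))) z :=
    (((innerSL ℝ (M.ν T i)).hasFDerivAt).comp z he.hasFDerivAt).const_sub _
  rw [h1.fderiv] at hz0
  have h2 := congrArg (fun L : Sp d →L[ℝ] ℝ => L (e.symm (M.ν T i))) hz0
  simp [M.norm_ν] at h2

theorem ShapeRegular.ν_injective (hd : 2 ≤ d) (hM : M.ShapeRegular ρ) (T : Fin M.N) :
    Function.Injective (M.ν T) := by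
  intro i j hij
  by_contra hne
  have hface : M.face T i = M.face T j := by
    rw [← hM.elem_inter_hyperplane hd, ← hM.elem_inter_hyperplane hd, offset, offset, hij]
  obtain ⟨y, hy, hyj⟩ := s.exists_relint (by omega) i
  have : M.F T y ∈ M.face T j := hface ▸ mem_image_of_mem _ hy
  obtain ⟨z, hz, hzy⟩ := this
  have := M.F_inj T (s.refFacet_subset j hz) (s.refFacet_subset i hy) hzy
  exact hyj j (Ne.symm hne) (this ▸ hz)

theorem F_mem_face_iff {x : Sp d} (hx : x ∈ s.ref d) (i : s.Facet d) :
    M.F T x ∈ M.face T i ↔ x ∈ s.refFacet d i := by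
  refine ⟨fun ⟨z, hz, hzy⟩ => ?_, fun h => mem_image_of_mem _ h⟩
  exact M.F_inj T (s.refFacet_subset i hz) hx hzy ▸ hz

/-- Near a relatively interior point of a facet the element is a half space. -/
theorem ShapeRegular.exists_nhds_halfspace (hd : 2 ≤ d) (hM : M.ShapeRegular ρ) {i : s.Facet d}
    {y : Sp d} (hy : y ∈ M.face T i) (hyj : ∀ j, j ≠ i → y ∉ M.face T j) :
    ∀ᶠ z in nhds y, ⟪M.ν T i, z⟫ ≤ M.offset T i → z ∈ M.elem T := by
  have h1 : ∀ᶠ z in nhds y, ∀ j, j ≠ i → ⟪M.ν T j, z⟫ < M.offset T j := by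
    rw [Filter.eventually_all]
    intro j
    by_cases hj : j = i
    · simp [hj]
    have hlt : ⟪M.ν T j, y⟫ < M.offset T j :=
      lt_of_le_of_ne (inner_le_offset j (M.face_subset_elem T i hy)) fun h => hyj j hj
        (hM.elem_inter_hyperplane hd j ▸ ⟨M.face_subset_elem T i hy, h⟩)
    have : ContinuousAt (fun z : Sp d => ⟪M.ν T j, z⟫) y := by fun_prop
    filter_upwards [this.eventually_lt_const hlt] with z hz _ using hz
  filter_upwards [h1] with z hz hzi
  rw [hM.elem_eq hd]
  intro j
  by_cases hj : j = i
  · exact hj ▸ hzi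
  · exact (hz j hj).le

theorem exists_relint_face (hd : 2 ≤ d) (i : s.Facet d) :
    ∃ y ∈ M.face T i, ∀ j, j ≠ i → y ∉ M.face T j := by
  obtain ⟨y, hy, hyj⟩ := s.exists_relint (d := d) (by omega) i
  exact ⟨_, mem_image_of_mem _ hy, fun j hj h =>
    hyj j hj ((F_mem_face_iff (s.refFacet_subset i hy) j).1 h)⟩

theorem ShapeRegular.volume_frontier_elem (hd : 2 ≤ d) (hM : M.ShapeRegular ρ) (T : Fin M.N) :
    volume (frontier (M.elem T)) = 0 := (hM.convex_elem hd T).addHaar_frontier volume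

theorem ShapeRegular.interior_ae_eq (hd : 2 ≤ d) (hM : M.ShapeRegular ρ) (T : Fin M.N) :
    (interior (M.elem T) : Set (Sp d)) =ᵐ[volume] M.elem T :=
  interior_ae_eq_of_null_frontier (hM.volume_frontier_elem hd T)

end Mesh

end

section

variable {d : ℕ} {s : Shape}

/-! ### Polynomials on elements and traces -/

/-- A bounded subset of a hyperplane has surface measure at most that of a ball. -/
theorem hausdorffMeasure_hyperplane_le {ν : Sp d} (hν : ‖ν‖ = 1) {c : ℝ} {S : Set (Sp d)}
    (hS : S ⊆ {x | ⟪ν, x⟫ = c}) (hb : Bornology.IsBounded S) :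
    μHE[d - 1] S ≤ ENNReal.ofReal (Metric.diam S ^ (d - 1))
      * volume (Metric.closedBall (0 : Sp (d - 1)) 1) := by
  rcases S.eq_empty_or_nonempty with rfl | ⟨z, hz⟩
  · simp
  rw [← inter_eq_self_of_subset_left hS, ← volume_slice_preimage hν]
  obtain ⟨y, hy⟩ : z ∈ range (fun y : ((ℝ ∙ ν)ᗮ : Submodule ℝ (Sp d)) => c • ν + (y : Sp d)) :=
    range_slice hν c ▸ hS hz
  have hsub : (fun y : ((ℝ ∙ ν)ᗮ : Submodule ℝ (Sp d)) => c • ν + (y : Sp d)) ⁻¹' S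
      ⊆ Metric.closedBall y (Metric.diam S) := by
    intro y' hy'
    rw [Metric.mem_closedBall, ← (isometry_slice ν c).dist_eq]
    exact Metric.dist_le_diam_of_mem hb hy' ((congrArg (· ∈ S) hy).mpr hz)
  let B := (stdOrthonormalBasis ℝ ((ℝ ∙ ν)ᗮ : Submodule ℝ (Sp d))).reindex
    (finCongr (finrank_orthogonal_span hν))
  have hball : volume (Metric.closedBall y (Metric.diam S))
      = volume (Metric.closedBall (B.repr y) (Metric.diam S)) := by
    rw [← B.measurePreserving_repr.measure_preimage
      Metric.isClosed_closedBall.measurableSet.nullMeasurableSet]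
    congr 1
    ext z
    simp [Metric.mem_closedBall]
  refine (measure_mono hsub).trans ?_
  rw [inter_eq_self_of_subset_left hS, hball, Measure.addHaar_closedBall' _ _ Metric.diam_nonneg,
    finrank_euclideanSpace_fin]

namespace Mesh

variable {M : Mesh d s} {ρ : ℝ} {T : Fin M.N}

theorem measure_face_le (T : Fin M.N) (i : s.Facet d) :
    μHE[d - 1] (M.face T i) ≤ ENNReal.ofReal (Metric.diam (M.face T i) ^ (d - 1))
      * volume (Metric.closedBall (0 : Sp (d - 1)) 1) :=
  hausdorffMeasure_hyperplane_le (M.norm_ν T i) (fun _ hx => inner_eq_offset i hx)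
    (M.isCompact_face T i).isBounded

theorem measure_face_lt_top (T : Fin M.N) (i : s.Facet d) : μHE[d - 1] (M.face T i) < ⊤ :=
  (measure_face_le T i).trans_lt (ENNReal.mul_lt_top ENNReal.ofReal_lt_top
    (isCompact_closedBall _ _).measure_lt_top)

theorem integrableOn_face {E : Type*} [NormedAddCommGroup E] [SecondCountableTopology E]
    {i : s.Facet d} {g : Sp d → E} (hg : ContinuousOn g (M.face T i)) :
    IntegrableOn g (M.face T i) μHE[d - 1] := by
  obtain ⟨C, hC⟩ := (M.isCompact_face T i).exists_bound_of_continuousOn hg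
  borelize E
  have : IsFiniteMeasure ((μHE[d - 1] : Measure (Sp d)).restrict (M.face T i)) :=
    ⟨by simpa using measure_face_lt_top T i⟩
  exact Integrable.of_bound (hg.aestronglyMeasurable (M.measurableSet_face T i)) C
    ((ae_restrict_iff' (M.measurableSet_face T i)).2 (ae_of_all _ hC))

theorem integrableOn_elem {E : Type*} [NormedAddCommGroup E]
    {g : Sp d → E} (hg : ContinuousOn g (M.elem T)) : IntegrableOn g (M.elem T) :=
  hg.integrableOn_compact (M.isCompact_elem T)

/-- The inverse of an element map is locally the restriction of a smooth map. -/
theorem ShapeRegular.contDiffOn_of_mem_P1 (hd : 2 ≤ d) (hM : M.ShapeRegular ρ)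
    {v : Fin M.N → Sp d → ℝ} (hv : v ∈ M.P1) (T : Fin M.N) :
    ContDiffOn ℝ 1 (v T) (M.elem T) := by
  obtain ⟨⟨p, -, hp⟩, -⟩ := hv T
  rintro _ ⟨x, hx, rfl⟩
  obtain ⟨e, he⟩ := hM.exists_equiv (T := T) hd hx
  have hF : ContDiffAt ℝ 1 (M.F T) x := (M.contDiff_F (n := 1) T).contDiffAt
  let g := hF.localInverse he.hasFDerivAt one_ne_zero
  have hg : ContDiffAt ℝ 1 g (M.F T x) := hF.to_localInverse he.hasFDerivAt one_ne_zero
  have hgF : ∀ᶠ z in nhds x, g (M.F T z) = z := (hF.hasStrictFDerivAt' he.hasFDerivAt one_ne_zero).eventually_left_inverse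
  have hcomp : ContDiffAt ℝ 1 (fun y => MvPolynomial.eval (fun j => g y j) p) (M.F T x) :=
    (contDiff_eval p (n := 1)).contDiffAt.comp (M.F T x) hg
  refine hcomp.contDiffWithinAt.congr_of_eventuallyEq_of_mem ?_ (mem_image_of_mem _ hx)
  obtain ⟨r, hr, hball⟩ := Metric.eventually_nhds_iff_ball.1 hgF
  have hρ := hM.pos hd T
  have hD := diam_elem_pos (M := M) (T := T) hd
  have hnear : Metric.ball (M.F T x) (Metric.diam (M.elem T) * r / ρ) ∈ nhds (M.F T x) :=
    Metric.ball_mem_nhds _ (by positivity)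
  filter_upwards [nhdsWithin_le_nhds hnear, self_mem_nhdsWithin] with y hy hyT
  obtain ⟨z, hz, rfl⟩ := hyT
  have h1 := (hM T z hz x hx).2
  have h2 : dist (M.F T z) (M.F T x) * ρ < Metric.diam (M.elem T) * r := (lt_div_iff₀ hρ).1 hy
  have h3 : dist z x < r := by
    rw [← mul_lt_mul_iff_of_pos_left hD]
    linarith
  rw [hp z hz, hball z h3]

theorem ShapeRegular.uniqueDiffOn_elem (hd : 2 ≤ d) (hM : M.ShapeRegular ρ) (T : Fin M.N) :
    UniqueDiffOn ℝ (M.elem T) :=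
  uniqueDiffOn_convex (hM.convex_elem hd T) (hM.interior_elem_nonempty hd)

theorem ShapeRegular.continuousOn_of_mem_P1 (hd : 2 ≤ d) (hM : M.ShapeRegular ρ)
    {v : Fin M.N → Sp d → ℝ} (hv : v ∈ M.P1) (T : Fin M.N) : ContinuousOn (v T) (M.elem T) :=
  (hM.contDiffOn_of_mem_P1 hd hv T).continuousOn

theorem ShapeRegular.continuousOn_face (hd : 2 ≤ d) (hM : M.ShapeRegular ρ)
    {v : Fin M.N → Sp d → ℝ} (hv : v ∈ M.P1) (T : Fin M.N) (i : s.Facet d) :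
    ContinuousOn (v T) (M.face T i) :=
  (hM.continuousOn_of_mem_P1 hd hv T).mono (M.face_subset_elem T i)

theorem inner_grad (v : Fin M.N → Sp d → ℝ) (T : Fin M.N) (x ξ : Sp d) :
    ⟪ξ, M.grad v T x⟫ = fderivWithin ℝ (v T) (M.elem T) x ξ := by
  rw [real_inner_comm, grad, inner_gradientWithin_left]

theorem ShapeRegular.continuousOn_grad (hd : 2 ≤ d) (hM : M.ShapeRegular ρ)
    {v : Fin M.N → Sp d → ℝ} (hv : v ∈ M.P1) (T : Fin M.N) :
    ContinuousOn (M.grad v T) (M.elem T) :=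
  (InnerProductSpace.toDual ℝ (Sp d)).symm.continuous.comp_continuousOn
    ((hM.contDiffOn_of_mem_P1 hd hv T).continuousOn_fderivWithin (hM.uniqueDiffOn_elem hd T) le_rfl)

theorem ShapeRegular.grad_add (hd : 2 ≤ d) (hM : M.ShapeRegular ρ)
    {u v : Fin M.N → Sp d → ℝ} (hu : u ∈ M.P1) (hv : v ∈ M.P1) {x : Sp d} (hx : x ∈ M.elem T) :
    M.grad (u + v) T x = M.grad u T x + M.grad v T x := by
  have h := fderivWithin_add (hM.uniqueDiffOn_elem hd T x hx)
    ((hM.contDiffOn_of_mem_P1 hd hu T).differentiableOn one_ne_zero x hx)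
    ((hM.contDiffOn_of_mem_P1 hd hv T).differentiableOn one_ne_zero x hx)
  refine ext_inner_left ℝ fun ξ => ?_
  rw [inner_add_right, inner_grad, inner_grad, inner_grad, Pi.add_apply, h, _root_.add_apply]

theorem ShapeRegular.grad_smul (hd : 2 ≤ d) (hM : M.ShapeRegular ρ) (c : ℝ)
    (v : Fin M.N → Sp d → ℝ) {x : Sp d} (hx : x ∈ M.elem T) :
    M.grad (c • v) T x = c • M.grad v T x := by
  refine ext_inner_left ℝ fun ξ => ?_
  rw [inner_smul_right, inner_grad, inner_grad, Pi.smul_apply,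
    fderivWithin_const_smul_field _ (hM.uniqueDiffOn_elem hd T x hx)]
  rfl

/-- One half of the change of variables formula, for the bi-Lipschitz element map. -/
theorem ShapeRegular.integral_ref_le (hd : 2 ≤ d) (hM : M.ShapeRegular ρ) (T : Fin M.N)
    {g : Sp d → ℝ} (hg : ContinuousOn g (M.elem T)) (hg0 : ∀ x, 0 ≤ g x) :
    ∫ x in s.ref d, g (M.F T x) ≤ (ρ / Metric.diam (M.elem T)) ^ d * ∫ x in M.elem T, g x := by
  have hρ := hM.pos hd T
  have hD := diam_elem_pos (M := M) (T := T) hd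
  set c : NNReal := ⟨ρ / Metric.diam (M.elem T), by positivity⟩ with hc
  have hle : (volume.restrict (s.ref d)).map (M.F T)
      ≤ ((c ^ d : NNReal) : ENNReal) • volume.restrict (M.elem T) := by
    refine Measure.le_iff.2 fun S hS => ?_
    rw [Measure.map_apply (M.continuous_F T).measurable hS,
      Measure.restrict_apply ((M.continuous_F T).measurable hS), Measure.smul_apply,
      Measure.restrict_apply hS]
    have hL : LipschitzOnWith c (Function.invFunOn (M.F T) (s.ref d)) (S ∩ M.elem T) := by
      refine LipschitzOnWith.of_dist_le_mul ?_
      rintro y ⟨-, hy⟩ z ⟨-, hz⟩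
      have h := (hM T _ (Function.invFunOn_mem hy) _ (Function.invFunOn_mem hz)).2
      rw [Function.invFunOn_eq hy, Function.invFunOn_eq hz] at h
      change _ ≤ ρ / Metric.diam (M.elem T) * _
      rw [div_mul_eq_mul_div, le_div_iff₀ hD]
      linarith
    have h := hL.hausdorffMeasure_image_le (d := d) (by positivity)
    have himg : M.F T ⁻¹' S ∩ s.ref d
        = Function.invFunOn (M.F T) (s.ref d) '' (S ∩ M.elem T) := by
      ext x
      constructor
      · rintro ⟨hx, hxr⟩
        exact ⟨M.F T x, ⟨hx, mem_image_of_mem _ hxr⟩, (M.F_inj T).leftInvOn_invFunOn hxr⟩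
      · rintro ⟨y, ⟨hy, hyT⟩, rfl⟩
        refine ⟨?_, Function.invFunOn_mem hyT⟩
        rw [mem_preimage, Function.invFunOn_eq hyT]
        exact hy
    rw [himg, ← EuclideanSpace.euclideanHausdorffMeasure_eq_volume,
      Measure.euclideanHausdorffMeasure_def, Measure.smul_apply, Measure.smul_apply]
    rw [ENNReal.rpow_natCast] at h
    simp only [ENNReal.smul_def, smul_eq_mul, ENNReal.coe_pow]
    calc _ ≤ _ * ((c : ENNReal) ^ d * Measure.hausdorffMeasure d (S ∩ M.elem T)) := by gcongr
      _ = _ := by ring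
  have hgi : IntegrableOn g (M.elem T) := integrableOn_elem hg
  have hgi' : Integrable g (((c ^ d : NNReal) : ENNReal) • volume.restrict (M.elem T)) :=
    hgi.smul_measure ENNReal.coe_ne_top
  rw [← integral_map (M.continuous_F T).aemeasurable
    (hgi'.aestronglyMeasurable.mono_measure hle)]
  refine (integral_mono_measure hle (ae_of_all _ hg0) hgi').trans_eq ?_
  rw [integral_smul_measure, ENNReal.coe_toReal, NNReal.coe_pow, smul_eq_mul]
  rfl

/-- The discrete trace inequality `h_e ‖v‖²_e ≤ C ‖v‖²_T`. -/
theorem exists_trace_const (s : Shape) (hd : 2 ≤ d) (ρ : ℝ) : ∃ C : ℝ, 0 ≤ C ∧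
    ∀ M : Mesh d s, M.ShapeRegular ρ → ∀ v ∈ M.P1, ∀ (T : Fin M.N) (i : s.Facet d),
      Metric.diam (M.face T i) * ∫ x in M.face T i, v T x ^ 2 ∂μHE[d - 1]
        ≤ C * ∫ x in M.elem T, v T x ^ 2 := by
  obtain ⟨C, hC, hCp⟩ := s.exists_sq_le_integral (d := d) (by omega)
  set B := (volume (Metric.closedBall (0 : Sp (d - 1)) 1)).toReal with hB
  refine ⟨B * C * |ρ| ^ d, by positivity, fun M hM v hv T i => ?_⟩
  have hρ := hM.pos hd T
  have hD := diam_elem_pos (M := M) (T := T) hd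
  have hDf := diam_face_pos (M := M) (T := T) hd i
  set D := Metric.diam (M.elem T)
  set I := ∫ x in M.elem T, v T x ^ 2 with hI
  have hI0 : 0 ≤ I := integral_nonneg fun x => sq_nonneg _
  have hsup : ∀ x ∈ M.elem T, v T x ^ 2 ≤ C * ((ρ / D) ^ d * I) := by
    obtain ⟨⟨p, hp1, hp⟩, -⟩ := hv T
    rintro _ ⟨x, hx, rfl⟩
    rw [hp x hx]
    refine (hCp p hp1 x hx).trans (mul_le_mul_of_nonneg_left ?_ hC)
    refine le_trans (le_of_eq ?_) (hM.integral_ref_le hd T (g := fun x => v T x ^ 2)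
      ((hM.continuousOn_of_mem_P1 hd hv T).pow 2) fun x => sq_nonneg _)
    refine setIntegral_congr_fun s.isClosed_ref.measurableSet fun y hy => ?_
    simp only [hp y hy]
  have hmeas : (μHE[d - 1] : Measure (Sp d)).real (M.face T i) ≤ D ^ (d - 1) * B := by
    have h := ENNReal.toReal_mono (ENNReal.mul_lt_top ENNReal.ofReal_lt_top
      (isCompact_closedBall _ _).measure_lt_top).ne (measure_face_le T i)
    rw [ENNReal.toReal_mul, ENNReal.toReal_ofReal (by positivity)] at h
    exact h.trans (mul_le_mul_of_nonneg_right (pow_le_pow_left₀ hDf.le (diam_face_le i) _)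
      ENNReal.toReal_nonneg)
  have hint : ∫ x in M.face T i, v T x ^ 2 ∂μHE[d - 1]
      ≤ C * ((ρ / D) ^ d * I) * (D ^ (d - 1) * B) := by
    have h1 := setIntegral_mono_on (integrableOn_face ((hM.continuousOn_face hd hv T i).pow 2))
      (integrableOn_const (measure_face_lt_top T i).ne) (M.measurableSet_face T i)
      (fun x hx => hsup x (M.face_subset_elem T i hx))
    refine h1.trans ?_
    rw [setIntegral_const, smul_eq_mul, mul_comm]
    exact mul_le_mul_of_nonneg_left hmeas (by positivity)
  calc _ ≤ D * (C * ((ρ / D) ^ d * I) * (D ^ (d - 1) * B)) :=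
        mul_le_mul (diam_face_le i) hint (integral_nonneg fun x => sq_nonneg _) hD.le
    _ = B * C * |ρ| ^ d * I := by
        rw [abs_of_pos hρ, div_pow]
        obtain ⟨k, rfl⟩ : ∃ k, d = k + 1 := ⟨d - 1, by omega⟩
        simp only [Nat.add_sub_cancel]
        field_simp
        ring

end Mesh

end

section

variable {d : ℕ} {s : Shape}

/-! ### Matching of facets in a conforming mesh -/

namespace Mesh

variable {M : Mesh d s} {ρ : ℝ} {Ω : Set (Sp d)}

theorem exists_inter_subset_face {T T' : Fin M.N} (h : T ≠ T') :
    ∃ i, M.elem T ∩ M.elem T' ⊆ M.face T i := by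
  obtain ⟨I, J, ⟨i, hi⟩, -, hI, -⟩ := M.conforming T T' h
  exact ⟨i, hI.trans_subset (image_mono (biInter_subset_of_mem hi))⟩

theorem notMem_interior_of_mem_face {T : Fin M.N} {i : s.Facet d} {x : Sp d}
    (hx : x ∈ M.face T i) : x ∉ interior (M.elem T) := fun h =>
  (inner_lt_offset_of_mem_interior i h).ne (inner_eq_offset i hx)

theorem disjoint_interior_elem {T T' : Fin M.N} (h : T ≠ T') :
    Disjoint (interior (M.elem T)) (M.elem T') := by
  obtain ⟨i, hi⟩ := exists_inter_subset_face h
  exact Set.disjoint_left.2 fun x hx hx' =>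
    notMem_interior_of_mem_face (hi ⟨interior_subset hx, hx'⟩) hx

theorem face_injective (hd : 2 ≤ d) (T : Fin M.N) : Function.Injective (M.face T) := by
  intro i j hij
  by_contra hne
  obtain ⟨y, hy, hyj⟩ := exists_relint_face (M := M) (T := T) hd i
  exact hyj j (Ne.symm hne) (hij ▸ hy)

theorem exists_relint_face_near (hd : 2 ≤ d) {T : Fin M.N} {i : s.Facet d} {x : Sp d}
    (hx : x ∈ M.face T i) {U : Set (Sp d)} (hU : U ∈ nhds x) :
    ∃ y ∈ U, y ∈ M.face T i ∧ ∀ j, j ≠ i → y ∉ M.face T j := by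
  obtain ⟨x, hx, rfl⟩ := hx
  obtain ⟨y, hyU, hy, hyj⟩ := s.exists_relint_near (by omega) hx
    ((M.continuous_F T).continuousAt.preimage_mem_nhds hU)
  exact ⟨_, hyU, mem_image_of_mem _ hy, fun j hj h =>
    hyj j hj ((F_mem_face_iff (s.refFacet_subset i hy) j).1 h)⟩

/-- If a facet of one element lies in a facet of another element, the outward normals are opposite:
the facet is relatively open in its hyperplane, and elements on the same side would overlap. -/
theorem ShapeRegular.ν_eq_neg (hd : 2 ≤ d) (hM : M.ShapeRegular ρ) {T T' : Fin M.N} (hne : T ≠ T')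
    {i j : s.Facet d} (h : M.face T i ⊆ M.face T' j) : M.ν T' j = -M.ν T i := by
  obtain ⟨y, hy, hyj⟩ := exists_relint_face (M := M) (T := T) hd i
  have hball := hM.exists_nhds_halfspace hd hy hyj
  have hray : ∀ w : Sp d, ∀ᶠ t : ℝ in nhdsWithin 0 (Ioi 0),
      ⟪M.ν T i, y + t • w⟫ ≤ M.offset T i → y + t • w ∈ M.elem T := by
    intro w
    have hc : ContinuousAt (fun t : ℝ => y + t • w) 0 := by fun_prop
    refine (hc.eventually (p := fun z => ⟪M.ν T i, z⟫ ≤ M.offset T i → z ∈ M.elem T)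
      ?_).filter_mono nhdsWithin_le_nhds
    simpa using hball
  have hyo := inner_eq_offset i hy
  set l := ⟪M.ν T i, M.ν T' j⟫ with hl
  have hself : ⟪M.ν T i, M.ν T i⟫ = 1 := by rw [real_inner_self_eq_norm_sq, M.norm_ν]; norm_num
  have hself' : ⟪M.ν T' j, M.ν T' j⟫ = 1 := by rw [real_inner_self_eq_norm_sq, M.norm_ν]; norm_num
  -- the tangential part of the second normal vanishes
  set w := M.ν T' j - l • M.ν T i with hw
  have hwν : ⟪M.ν T i, w⟫ = 0 := by
    rw [hw, inner_sub_right, inner_smul_right, hself, ← hl]; ring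
  have hwν' : ⟪M.ν T' j, w⟫ = 1 - l ^ 2 := by
    rw [hw, inner_sub_right, inner_smul_right, hself', real_inner_comm, ← hl]; ring
  have hl2 : l ^ 2 = 1 := by
    obtain ⟨t, ht, ht0⟩ := ((hray w).and self_mem_nhdsWithin).exists
    have ht0' : (0 : ℝ) < t := ht0
    have hin : ⟪M.ν T i, y + t • w⟫ = M.offset T i := by
      rw [inner_add_right, inner_smul_right, hwν, hyo]; ring
    have hmem : y + t • w ∈ M.face T i :=
      hM.elem_inter_hyperplane hd i ▸ ⟨ht hin.le, hin⟩
    have h1 := inner_eq_offset j (h hmem)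
    rw [inner_add_right, inner_smul_right, inner_eq_offset j (h hy), hwν'] at h1
    have : t * (1 - l ^ 2) = 0 := by linarith
    rcases mul_eq_zero.1 this with h0 | h0 <;> linarith
  have hw0 : w = 0 := by
    have : ⟪w, w⟫ = 0 := by
      nth_rewrite 1 [hw]
      rw [inner_sub_left, inner_smul_left, hwν, hwν', hl2]; simp
    exact inner_self_eq_zero.1 this
  have hνν : M.ν T' j = l • M.ν T i := sub_eq_zero.1 hw0
  rcases mul_self_eq_one_iff.1 ((sq l).symm.trans hl2) with h1 | h1
  · -- with equal normals, `T'` would have interior points in `T` near `y`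
    exfalso
    rw [h1, one_smul] at hνν
    obtain ⟨q, hq⟩ := hM.interior_elem_nonempty (T := T') hd
    have hqlt := inner_lt_offset_of_mem_interior j hq
    rw [← inner_eq_offset j (h hy), hνν, hyo] at hqlt
    obtain ⟨t, ⟨ht, ht0⟩, ht1⟩ := (((hray (q - y)).and self_mem_nhdsWithin).and
      ((eventually_lt_nhds (one_pos (α := ℝ))).filter_mono nhdsWithin_le_nhds)).exists
    have ht0' : (0 : ℝ) < t := ht0
    have hint : y + t • (q - y) ∈ interior (M.elem T') :=
      (hM.convex_elem hd T').add_smul_sub_mem_interior (M.face_subset_elem T' j (h hy)) hq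
        ⟨ht0', ht1.le⟩
    refine Set.disjoint_left.1 (disjoint_interior_elem hne.symm) hint (ht ?_)
    rw [inner_add_right, inner_smul_right, inner_sub_right, hyo]
    nlinarith
  · rw [hνν, h1, neg_one_smul]

/-- A facet which is not contained in the boundary of the domain is a facet of a second element. -/
theorem ShapeRegular.exists_partner (hd : 2 ≤ d) (hM : M.ShapeRegular ρ) (hΩ : IsOpen Ω)
    (hm : M.IsMeshOf Ω) {T : Fin M.N} {i : s.Facet d} (h : ¬ M.face T i ⊆ frontier Ω) :
    ∃ T' j, T' ≠ T ∧ M.face T i = M.face T' j := by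
  obtain ⟨y₀, hy₀, hy₀Ω⟩ := not_subset.1 h
  have hcl : ∀ T, M.elem T ⊆ closure Ω := fun T => hm ▸ subset_iUnion _ T
  have hy₀' : y₀ ∈ Ω := by
    by_contra hn
    exact hy₀Ω ⟨hcl T (M.face_subset_elem T i hy₀), by rwa [hΩ.interior_eq]⟩
  obtain ⟨y, hyΩ, hy, hyj⟩ := exists_relint_face_near hd hy₀ (hΩ.mem_nhds hy₀')
  -- points slightly outside of `T` belong to other elements
  obtain ⟨T', hT', hyT'⟩ : ∃ T', T' ≠ T ∧ y ∈ M.elem T' := by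
    have hclosed : IsClosed (⋃ T' ∈ {T' | T' ≠ T}, M.elem T') :=
      (Set.toFinite _).isClosed_biUnion fun T' _ => M.isClosed_elem T'
    have hmem : y ∈ ⋃ T' ∈ {T' | T' ≠ T}, M.elem T' := by
      have hc : ContinuousAt (fun t : ℝ => y + t • M.ν T i) 0 := by fun_prop
      have hc0 : Filter.Tendsto (fun t : ℝ => y + t • M.ν T i) (nhdsWithin 0 (Ioi 0)) (nhds y) := by
        have := hc.tendsto.mono_left (nhdsWithin_le_nhds (s := Ioi (0 : ℝ)))
        simpa using this
      refine hclosed.mem_of_tendsto hc0 ?_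
      filter_upwards [hc0.eventually_mem (hΩ.mem_nhds hyΩ), self_mem_nhdsWithin] with t ht ht0
      have ht0' : (0 : ℝ) < t := ht0
      have h1 := subset_closure ht
      rw [← hm] at h1
      obtain ⟨T', hT'⟩ := mem_iUnion.1 h1
      refine mem_biUnion (x := T') ?_ hT'
      rintro rfl
      have := inner_le_offset i hT'
      rw [inner_add_right, inner_smul_right, real_inner_self_eq_norm_sq, M.norm_ν,
        inner_eq_offset i hy] at this
      linarith
    simpa using hmem
  -- the common face contains a point on no other facet of `T`, so that it is the whole facet
  obtain ⟨I, J, ⟨i₀, hi₀⟩, ⟨j, hj⟩, hI, hJ⟩ := M.conforming T T' hT'.symm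
  have hsub : ∀ k ∈ I, k = i := by
    intro k hk
    by_contra hki
    have : y ∈ M.F T '' ⋂ i ∈ I, s.refFacet d i := hI ▸ ⟨M.face_subset_elem T i hy, hyT'⟩
    exact hyj k hki (image_mono (biInter_subset_of_mem hk) this)
  have hIi : I = {i} := Set.eq_singleton_iff_unique_mem.2 ⟨hsub i₀ hi₀ ▸ hi₀, hsub⟩
  have hTi : M.elem T ∩ M.elem T' = M.face T i := by
    rw [elem, elem, hI, hIi, biInter_singleton, face]
  have hle : ∀ k ∈ J, M.face T i ⊆ M.face T' k := by
    intro k hk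
    rw [← hTi, elem, elem, hJ]
    exact image_mono (biInter_subset_of_mem hk)
  have hJj : J = {j} := Set.eq_singleton_iff_unique_mem.2 ⟨hj, fun k hk => by
    refine hM.ν_injective hd T' ?_
    rw [hM.ν_eq_neg hd hT'.symm (hle k hk), hM.ν_eq_neg hd hT'.symm (hle j hj)]⟩
  refine ⟨T', j, hT', ?_⟩
  rw [← hTi, elem, elem, hJ, hJj, biInter_singleton, face]

theorem ShapeRegular.partner_unique (hd : 2 ≤ d) (hM : M.ShapeRegular ρ) {T T' T'' : Fin M.N}
    {i j k : s.Facet d} (h' : T' ≠ T) (h'' : T'' ≠ T) (hj : M.face T i = M.face T' j)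
    (hk : M.face T i = M.face T'' k) : (T', j) = (T'', k) := by
  have hT : T' = T'' := by
    by_contra hne
    have h1 := hM.ν_eq_neg hd h'.symm hj.subset
    have h2 := hM.ν_eq_neg hd h''.symm hk.subset
    have h3 := hM.ν_eq_neg hd hne (hj.symm.trans hk).subset
    rw [h1, h2, neg_neg, neg_eq_iff_add_eq_zero, ← two_smul ℝ, smul_eq_zero] at h3
    have h4 := M.norm_ν T i
    rcases h3 with h3 | h3
    · norm_num at h3
    · rw [h3, norm_zero] at h4
      exact zero_ne_one h4
  subst hT
  rw [face_injective hd T' (hj.symm.trans hk)]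

/-- A facet shared by two elements is not contained in the boundary: the two elements fill a
neighbourhood of a common relatively interior point. -/
theorem ShapeRegular.not_subset_frontier (hd : 2 ≤ d) (hM : M.ShapeRegular ρ) (hΩ : IsOpen Ω)
    (hreg : interior (closure Ω) = Ω) (hm : M.IsMeshOf Ω) {T T' : Fin M.N} {i j : s.Facet d}
    (hne : T ≠ T') (h : M.face T i = M.face T' j) : ¬ M.face T i ⊆ frontier Ω := by
  intro hfr
  obtain ⟨y₀, hy₀, hy₀j⟩ := exists_relint_face (M := M) (T := T') hd j
  have hU : ∀ᶠ z in nhds y₀, ∀ k, k ≠ j → z ∉ M.face T' k := by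
    rw [Filter.eventually_all]
    intro k
    by_cases hk : k = j
    · simp [hk]
    · filter_upwards [(M.isCompact_face T' k).isClosed.isOpen_compl.mem_nhds (hy₀j k hk)] with z hz _
        using hz
  rw [← h] at hy₀
  obtain ⟨y, hyU, hy, hyi⟩ := exists_relint_face_near hd hy₀ hU
  have hy' : y ∈ M.face T' j := h ▸ hy
  have h1 := hM.exists_nhds_halfspace hd hy hyi
  have h2 := hM.exists_nhds_halfspace hd hy' hyU
  have hν := hM.ν_eq_neg hd hne h.subset
  have ho : M.offset T' j = -M.offset T i := by
    rw [← inner_eq_offset j hy', ← inner_eq_offset i hy, hν, inner_neg_left]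
  have hnh : closure Ω ∈ nhds y := by
    filter_upwards [h1, h2] with z hz1 hz2
    rw [← hm]
    rcases le_total ⟪M.ν T i, z⟫ (M.offset T i) with hle | hle
    · exact mem_iUnion.2 ⟨T, hz1 hle⟩
    · refine mem_iUnion.2 ⟨T', hz2 ?_⟩
      rw [hν, ho, inner_neg_left]
      exact neg_le_neg hle
  have hyΩ : y ∈ Ω := hreg ▸ mem_interior_iff_mem_nhds.2 hnh
  exact (hfr hy).2 (by rwa [hΩ.interior_eq])

theorem mem_intEdges {e : (Fin M.N × s.Facet d) × (Fin M.N × s.Facet d)} :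
    e ∈ M.intEdges ↔ e.1.1 < e.2.1 ∧ M.face e.1.1 e.1.2 = M.face e.2.1 e.2.2 := by
  simp [intEdges]

theorem mem_bdEdges {e : Fin M.N × s.Facet d} :
    e ∈ M.bdEdges Ω ↔ M.face e.1 e.2 ⊆ frontier Ω := by
  simp [bdEdges]

/-- Each facet of each element is either a boundary edge, or one of the two sides of exactly one
interior edge. -/
theorem ShapeRegular.sum_facets (hd : 2 ≤ d) (hM : M.ShapeRegular ρ) (hΩ : IsOpen Ω)
    (hreg : interior (closure Ω) = Ω) (hm : M.IsMeshOf Ω) (Q : Fin M.N × s.Facet d → ℝ) :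
    ∑ T, ∑ i, Q (T, i) = ∑ e ∈ M.intEdges, (Q e.1 + Q e.2) + ∑ e ∈ M.bdEdges Ω, Q e := by
  classical
  have hinj1 : Set.InjOn Prod.fst
      (M.intEdges : Set ((Fin M.N × s.Facet d) × (Fin M.N × s.Facet d))) := by
    rintro ⟨e, ⟨T', j⟩⟩ he ⟨e', ⟨T'', k⟩⟩ he' (rfl : e = e')
    have h1 := mem_intEdges.1 he
    have h2 := mem_intEdges.1 he'
    exact Prod.ext rfl (hM.partner_unique hd h1.1.ne' h2.1.ne' h1.2 h2.2)
  have hinj2 : Set.InjOn Prod.snd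
      (M.intEdges : Set ((Fin M.N × s.Facet d) × (Fin M.N × s.Facet d))) := by
    rintro ⟨⟨T', j⟩, e⟩ he ⟨⟨T'', k⟩, e'⟩ he' (rfl : e = e')
    have h1 := mem_intEdges.1 he
    have h2 := mem_intEdges.1 he'
    exact Prod.ext (hM.partner_unique hd h1.1.ne h2.1.ne h1.2.symm h2.2.symm) rfl
  have hsplit : (Finset.univ : Finset (Fin M.N × s.Facet d))
      = (M.intEdges.image Prod.fst ∪ M.intEdges.image Prod.snd) ∪ M.bdEdges Ω := by
    refine (Finset.eq_univ_iff_forall.2 fun ⟨T, i⟩ => ?_).symm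
    rw [Finset.mem_union, Finset.mem_union, Finset.mem_image, Finset.mem_image, mem_bdEdges]
    by_cases hb : M.face T i ⊆ frontier Ω
    · exact Or.inr hb
    · obtain ⟨T', j, hne, heq⟩ := hM.exists_partner hd hΩ hm hb
      refine Or.inl ?_
      rcases lt_or_gt_of_ne hne with hlt | hlt
      · exact Or.inr ⟨((T', j), (T, i)), mem_intEdges.2 ⟨hlt, heq.symm⟩, rfl⟩
      · exact Or.inl ⟨((T, i), (T', j)), mem_intEdges.2 ⟨hlt, heq⟩, rfl⟩
  have hdis1 : Disjoint (M.intEdges.image Prod.fst) (M.intEdges.image Prod.snd) := by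
    rw [Finset.disjoint_left]
    rintro ⟨T, i⟩ h1 h2
    obtain ⟨⟨a, b⟩, he, rfl : a = _⟩ := Finset.mem_image.1 h1
    obtain ⟨⟨a', b'⟩, he', rfl : b' = _⟩ := Finset.mem_image.1 h2
    have h3 := mem_intEdges.1 he
    have h4 := mem_intEdges.1 he'
    have := hM.partner_unique hd h3.1.ne' h4.1.ne h3.2 h4.2.symm
    have h5 := congrArg Prod.fst this
    exact absurd (h4.1.trans h3.1) (by simp only at h5 ⊢; rw [h5]; exact lt_irrefl _)
  have hdis2 : Disjoint (M.intEdges.image Prod.fst ∪ M.intEdges.image Prod.snd) (M.bdEdges Ω) := by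
    rw [Finset.disjoint_left]
    intro e h1 h2
    rw [mem_bdEdges] at h2
    rcases Finset.mem_union.1 h1 with h1 | h1
    · obtain ⟨e', he, rfl⟩ := Finset.mem_image.1 h1
      have h3 := mem_intEdges.1 he
      exact hM.not_subset_frontier hd hΩ hreg hm h3.1.ne h3.2 h2
    · obtain ⟨e', he, rfl⟩ := Finset.mem_image.1 h1
      have h3 := mem_intEdges.1 he
      exact hM.not_subset_frontier hd hΩ hreg hm h3.1.ne' h3.2.symm h2
  rw [← Fintype.sum_prod_type', hsplit, Finset.sum_union hdis2, Finset.sum_union hdis1,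
    Finset.sum_image hinj1, Finset.sum_image hinj2, Finset.sum_add_distrib]

/-! ### Decomposition of the domain -/

theorem interior_elem_subset (hreg : interior (closure Ω) = Ω) (hm : M.IsMeshOf Ω) (T : Fin M.N) :
    interior (M.elem T) ⊆ Ω :=
  hreg ▸ interior_mono (hm ▸ subset_iUnion _ T)

theorem ShapeRegular.inter_null (hd : 2 ≤ d) (hM : M.ShapeRegular ρ) {T T' : Fin M.N}
    (h : T ≠ T') : volume (M.elem T ∩ M.elem T') = 0 := by
  refine measure_mono_null (fun x hx => ?_) (hM.volume_frontier_elem hd T)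
  refine ⟨subset_closure hx.1, fun hx' => ?_⟩
  exact Set.disjoint_left.1 (disjoint_interior_elem h) hx' hx.2

theorem ShapeRegular.closure_ae_eq (hd : 2 ≤ d) (hM : M.ShapeRegular ρ) (hΩ : IsOpen Ω)
    (hreg : interior (closure Ω) = Ω) (hm : M.IsMeshOf Ω) :
    (closure Ω : Set (Sp d)) =ᵐ[volume] Ω := by
  refine closure_ae_eq_of_null_frontier (measure_mono_null (t := ⋃ T, frontier (M.elem T)) ?_
    (measure_iUnion_null fun T => hM.volume_frontier_elem hd T))
  rintro x ⟨hx, hx'⟩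
  rw [← hm] at hx
  obtain ⟨T, hT⟩ := mem_iUnion.1 hx
  rw [hΩ.interior_eq] at hx'
  exact mem_iUnion.2 ⟨T, subset_closure hT, fun h => hx' (interior_elem_subset hreg hm T h)⟩

theorem ShapeRegular.restrict_eq_sum (hd : 2 ≤ d) (hM : M.ShapeRegular ρ) (hΩ : IsOpen Ω)
    (hreg : interior (closure Ω) = Ω) (hm : M.IsMeshOf Ω) :
    (volume : Measure (Sp d)).restrict Ω = ∑ T, volume.restrict (M.elem T) := by
  rw [← Measure.restrict_congr_set (hM.closure_ae_eq hd hΩ hreg hm), ← hm,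
    Measure.restrict_iUnion_ae (fun T T' h => hM.inter_null hd h)
    (fun T => (M.measurableSet_elem T).nullMeasurableSet), Measure.sum_fintype]

theorem ShapeRegular.setIntegral_eq_sum (hd : 2 ≤ d) (hM : M.ShapeRegular ρ) (hΩ : IsOpen Ω)
    (hreg : interior (closure Ω) = Ω) (hm : M.IsMeshOf Ω) {g : Sp d → ℝ}
    (hg : ∀ T, IntegrableOn g (M.elem T)) :
    ∫ x in Ω, g x = ∑ T, ∫ x in M.elem T, g x := by
  rw [hM.restrict_eq_sum hd hΩ hreg hm, integral_finsetSum_measure fun T _ => hg T]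

theorem ShapeRegular.integrableOn_iff (hd : 2 ≤ d) (hM : M.ShapeRegular ρ) (hΩ : IsOpen Ω)
    (hreg : interior (closure Ω) = Ω) (hm : M.IsMeshOf Ω) {g : Sp d → ℝ} :
    IntegrableOn g Ω ↔ ∀ T, IntegrableOn g (M.elem T) := by
  rw [IntegrableOn, hM.restrict_eq_sum hd hΩ hreg hm, integrable_finsetSum_measure]
  simp [IntegrableOn]

theorem toFun_eq (v : Fin M.N → Sp d → ℝ) {T : Fin M.N} {x : Sp d} (hx : x ∈ interior (M.elem T)) :
    M.toFun v x = v T x := by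
  rw [toFun, Finset.sum_eq_single T, indicator_of_mem hx]
  · intro T' _ hne
    exact indicator_of_notMem (fun h => Set.disjoint_left.1 (disjoint_interior_elem hne) h
      (interior_subset hx)) _
  · simp

theorem meshFun_eq {T : Fin M.N} {x : Sp d} (hx : x ∈ interior (M.elem T)) :
    M.meshFun x = Metric.diam (M.elem T) :=
  toFun_eq (fun T _ => Metric.diam (M.elem T)) hx

theorem ShapeRegular.ae_interior (hd : 2 ≤ d) (hM : M.ShapeRegular ρ) (T : Fin M.N) :
    ∀ᵐ x ∂(volume.restrict (M.elem T)), x ∈ interior (M.elem T) := by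
  rw [← Measure.restrict_congr_set (hM.interior_ae_eq hd T)]
  exact ae_restrict_mem isOpen_interior.measurableSet

end Mesh

section Refinement

variable {sh sH : Shape} {Mh : Mesh d sh} {MH : Mesh d sH} {ρ : ℝ} {Ω : Set (Sp d)}

theorem Refinement.disjoint_interior (R : Refinement Mh MH) {T : Fin Mh.N} {K : Fin MH.N}
    (h : R.parent T ≠ K) : Disjoint (Mh.elem T) (interior (MH.elem K)) :=
  (Mesh.disjoint_interior_elem h.symm).symm.mono_left (R.elem_subset T)

/-- A coarse element is tiled by its fine elements. -/
theorem Refinement.setIntegral_elem (R : Refinement Mh MH) (hd : 2 ≤ d)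
    (hMh : Mh.ShapeRegular ρ) (hMH : MH.ShapeRegular ρ) (hΩ : IsOpen Ω)
    (hreg : interior (closure Ω) = Ω) (hmh : Mh.IsMeshOf Ω) (hmH : MH.IsMeshOf Ω) (K : Fin MH.N)
    {g : Sp d → ℝ} (hg : ∀ T, R.parent T = K → IntegrableOn g (Mh.elem T)) :
    ∫ x in MH.elem K, g x = ∑ T, if R.parent T = K then ∫ x in Mh.elem T, g x else 0 := by
  have hae : ∀ T, R.parent T = K → (interior (MH.elem K)).indicator g
      =ᵐ[volume.restrict (Mh.elem T)] g := by
    rintro T rfl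
    filter_upwards [hMh.ae_interior hd T] with x hx
    exact indicator_of_mem (interior_mono (R.elem_subset T) hx) _
  have hae' : ∀ T, R.parent T ≠ K → (interior (MH.elem K)).indicator g
      =ᵐ[volume.restrict (Mh.elem T)] 0 := by
    intro T hT
    filter_upwards [ae_restrict_mem (Mh.measurableSet_elem T)] with x hx
    exact indicator_of_notMem (Set.disjoint_left.1 (R.disjoint_interior hT) hx) _
  have h1 : ∫ x in MH.elem K, g x = ∫ x in Ω, (interior (MH.elem K)).indicator g x := by
    rw [setIntegral_indicator isOpen_interior.measurableSet,
      inter_eq_self_of_subset_right (Mesh.interior_elem_subset hreg hmH K),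
      setIntegral_congr_set (hMH.interior_ae_eq hd K)]
  rw [h1, hMh.setIntegral_eq_sum hd hΩ hreg hmh]
  · refine Finset.sum_congr rfl fun T _ => ?_
    split_ifs with hT
    · exact integral_congr_ae (hae T hT)
    · rw [integral_congr_ae (hae' T hT)]; simp
  · intro T
    by_cases hT : R.parent T = K
    · exact (integrable_congr (hae T hT)).2 (hg T hT)
    · exact (integrable_congr (hae' T hT)).2 (integrable_zero _ _ _)

end Refinement

end

section

variable {d : ℕ} {s : Shape}

/-! ### Divergence-free fields on meshes -/

theorem weakDivFreeOn_const {U : Set (Sp d)} (v : Sp d) : WeakDivFreeOn (fun _ => v) U := by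
  intro φ hφ hc hs
  have h0 : ∀ x, x ∉ U → fderiv ℝ φ x v = 0 := fun x hx => by
    rw [fderiv_of_notMem_tsupport (𝕜 := ℝ) fun h => hx (hs h)]; rfl
  rw [setIntegral_eq_integral_of_forall_compl_eq_zero h0]
  have hi : Integrable (fun x => fderiv ℝ φ x v) :=
    (((hφ.continuous_fderiv (by simp)).clm_apply continuous_const)).integrable_of_hasCompactSupport
      (hc.fderiv_apply (𝕜 := ℝ) v)
  have := integral_mul_fderiv_eq_neg_fderiv_mul_of_integrable (μ := (volume : Measure (Sp d)))
    (f := fun _ => (1 : ℝ)) (g := φ) (v := v) (by simp) (by simpa using hi)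
    (by simpa using hφ.continuous.integrable_of_hasCompactSupport hc)
    (fun x _ => differentiableAt_const _) (fun x _ => hφ.differentiable (by simp) x)
  simpa using this

theorem WeakDivFreeOn.mono {b : Sp d → Sp d} {U V : Set (Sp d)} (h : WeakDivFreeOn b V)
    (hUV : U ⊆ V) : WeakDivFreeOn b U := by
  intro φ hφ hc hs
  have h0 : ∀ x, x ∉ U → fderiv ℝ φ x (b x) = 0 := fun x hx => by
    rw [fderiv_of_notMem_tsupport (𝕜 := ℝ) fun h => hx (hs h)]; rfl
  rw [setIntegral_eq_integral_of_forall_compl_eq_zero h0, ← h φ hφ hc (hs.trans hUV),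
    setIntegral_eq_integral_of_forall_compl_eq_zero fun x hx => h0 x fun h => hx (hUV h)]

theorem DivFreeW1inf.weakDivFreeOn {Ω : Set (Sp d)} {b : Sp d → Sp d} (h : DivFreeW1inf Ω b)
    (hΩ : volume Ω < ⊤) : WeakDivFreeOn b Ω := by
  intro φ hφ hc hs
  obtain ⟨G, hG, hw, htr⟩ := h.weak
  have : IsFiniteMeasure (volume.restrict Ω : Measure (Sp d)) := ⟨by simpa using hΩ⟩
  have hbi : Integrable b (volume.restrict Ω) := h.memLp.integrable (by simp)
  have hGi : Integrable G (volume.restrict Ω) := hG.integrable (by simp)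
  let B := EuclideanSpace.basisFun (Fin d) ℝ
  have hφb : ∃ C, ∀ x, ‖φ x‖ ≤ C := hc.exists_bound_of_continuous hφ.continuous
  have hcd : Continuous (fderiv ℝ φ) := hφ.continuous_fderiv (by simp)
  have hφ'b : ∃ C, ∀ x, ‖fderiv ℝ φ x‖ ≤ C := (hc.fderiv (𝕜 := ℝ)).exists_bound_of_continuous hcd
  obtain ⟨C, hC⟩ := hφb
  obtain ⟨C', hC'⟩ := hφ'b
  have i1 : ∀ i, Integrable (fun x => fderiv ℝ φ x (B i) • b x) (volume.restrict Ω) := fun i =>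
    hbi.bdd_smul C' (hcd.clm_apply continuous_const).aestronglyMeasurable
      (ae_of_all _ fun x => ((fderiv ℝ φ x).le_opNorm (B i)).trans (by simpa [B] using hC' x))
  have i2 : ∀ i, Integrable (fun x => φ x • G x (B i)) (volume.restrict Ω) := fun i =>
    (hGi.apply_continuousLinearMap (B i)).bdd_smul C hφ.continuous.aestronglyMeasurable
      (ae_of_all _ hC)
  have key : ∀ i, ∫ x in Ω, ⟪B i, fderiv ℝ φ x (B i) • b x⟫
      = - ∫ x in Ω, ⟪B i, φ x • G x (B i)⟫ := by
    intro i
    rw [integral_inner (i1 i), integral_inner (i2 i), hw φ hφ hc hs (B i), inner_neg_right]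
  have e1 : ∀ x, fderiv ℝ φ x (b x) = ∑ i, ⟪B i, fderiv ℝ φ x (B i) • b x⟫ := by
    intro x
    conv_lhs => rw [← B.sum_repr' (b x), map_sum]
    simp [inner_smul_right, mul_comm]
  have e2 : ∀ᵐ x ∂(volume.restrict Ω), ∑ i, ⟪B i, φ x • G x (B i)⟫ = 0 := by
    filter_upwards [htr] with x hx
    rw [LinearMap.trace_eq_sum_inner _ B] at hx
    simp only [inner_smul_right, ← Finset.mul_sum]
    rw [mul_eq_zero]
    exact Or.inr hx
  simp_rw [e1]
  rw [integral_finsetSum _ fun i _ => (i1 i).const_inner _]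
  simp_rw [key]
  rw [Finset.sum_neg_distrib, ← integral_finsetSum _ fun i _ => (i2 i).const_inner _,
    integral_congr_ae e2]
  simp

namespace Mesh

variable {M : Mesh d s} {ρ : ℝ} {Ω : Set (Sp d)}

/-- The divergence theorem on an element. -/
theorem ShapeRegular.divergence_elem (hd : 2 ≤ d) (hM : M.ShapeRegular ρ) (T : Fin M.N)
    {b : Sp d → Sp d} (hb : ContinuousOn b (M.elem T))
    (hdiv : WeakDivFreeOn b (interior (M.elem T))) {g : Sp d → ℝ}
    (hg : ContDiffOn ℝ 1 g (M.elem T)) :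
    ∫ x in M.elem T, fderivWithin ℝ g (M.elem T) x (b x)
      = ∑ i, ∫ x in M.face T i, g x * ⟪b x, M.ν T i⟫ ∂μHE[d - 1] := by
  classical
  rw [divergence_polytope (M.norm_ν T) (hM.ν_injective hd T) (hM.elem_eq hd T)
    (M.isCompact_elem T) (hM.interior_elem_nonempty hd) hb hdiv hg]
  simp only [hM.elem_inter_hyperplane hd]

theorem isCompact_closure (hm : M.IsMeshOf Ω) : IsCompact (closure Ω) :=
  hm ▸ isCompact_iUnion fun T => M.isCompact_elem T

theorem volume_lt_top (hm : M.IsMeshOf Ω) : volume Ω < ⊤ :=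
  (measure_mono subset_closure).trans_lt (isCompact_closure hm).measure_lt_top

theorem elem_subset_closure (hm : M.IsMeshOf Ω) (T : Fin M.N) : M.elem T ⊆ closure Ω :=
  hm ▸ subset_iUnion _ T

/-- The divergence theorem on all elements, with the facets collected into edges. -/
theorem ShapeRegular.divergence_mesh (hd : 2 ≤ d) (hM : M.ShapeRegular ρ) (hΩ : IsOpen Ω)
    (hreg : interior (closure Ω) = Ω) (hm : M.IsMeshOf Ω)
    {b : Sp d → Sp d} (hb : ContinuousOn b (closure Ω)) (hdiv : WeakDivFreeOn b Ω)
    {g : Fin M.N → Sp d → ℝ} (hg : ∀ T, ContDiffOn ℝ 1 (g T) (M.elem T)) :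
    ∑ T, ∫ x in M.elem T, fderivWithin ℝ (g T) (M.elem T) x (b x)
      = ∑ e ∈ M.intEdges, M.faceInt e.1 (fun x => M.jump g e x * ⟪b x, M.nrm e.1⟫)
        + ∑ e ∈ M.bdEdges Ω, M.faceInt e (fun x => g e.1 x * ⟪b x, M.nrm e⟫) := by
  have h1 : ∀ T, ∫ x in M.elem T, fderivWithin ℝ (g T) (M.elem T) x (b x)
      = ∑ i, M.faceInt (T, i) (fun x => g T x * ⟪b x, M.ν T i⟫) := fun T =>
    hM.divergence_elem hd T (hb.mono (elem_subset_closure hm T))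
      (hdiv.mono (interior_elem_subset hreg hm T)) (hg T)
  simp_rw [h1]
  rw [hM.sum_facets hd hΩ hreg hm fun e => M.faceInt e (fun x => g e.1 x * ⟪b x, M.ν e.1 e.2⟫)]
  congr 1
  refine Finset.sum_congr rfl fun e he => ?_
  have he' := mem_intEdges.1 he
  have hν := hM.ν_eq_neg hd he'.1.ne he'.2.subset
  have hc : ∀ T i, IntegrableOn (fun x => g T x * ⟪b x, M.ν T i⟫) (M.face T i) μHE[d - 1] := by
    intro T i
    refine integrableOn_face (((hg T).continuousOn.mono (M.face_subset_elem T i)).mul ?_)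
    exact (hb.mono ((M.face_subset_elem T i).trans (elem_subset_closure hm T))).inner
      continuousOn_const
  have h2 := hc e.2.1 e.2.2
  rw [← he'.2] at h2
  simp only [faceInt]
  rw [← he'.2, ← integral_add (hc _ _) h2]
  refine integral_congr_ae (ae_of_all _ fun x => ?_)
  simp only [jump, nrm, hν, inner_neg_right]
  ring

end Mesh

end

section

variable {d : ℕ} {s : Shape}

/-! ### The discontinuous Galerkin forms are bilinear -/

/-- `L` is linear on the subspace `V`. -/
def LinOn {E : Type*} [AddCommGroup E] [Module ℝ E] (V : Submodule ℝ E) (L : E → ℝ) : Prop :=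
  ∀ u ∈ V, ∀ v ∈ V, ∀ c : ℝ, L (u + c • v) = L u + c * L v

namespace LinOn

variable {E : Type*} [AddCommGroup E] [Module ℝ E] {V : Submodule ℝ E} {L L' : E → ℝ}

theorem add (h : LinOn V L) (h' : LinOn V L') : LinOn V fun u => L u + L' u := by
  intro u hu v hv c
  simp only [h u hu v hv c, h' u hu v hv c]
  ring

theorem sub (h : LinOn V L) (h' : LinOn V L') : LinOn V fun u => L u - L' u := by
  intro u hu v hv c
  simp only [h u hu v hv c, h' u hu v hv c]
  ring

theorem const_mul (a : ℝ) (h : LinOn V L) : LinOn V fun u => a * L u := by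
  intro u hu v hv c
  simp only [h u hu v hv c]
  ring

theorem mul_const (a : ℝ) (h : LinOn V L) : LinOn V fun u => L u * a := by
  intro u hu v hv c
  simp only [h u hu v hv c]
  ring

theorem div_const (a : ℝ) (h : LinOn V L) : LinOn V fun u => L u / a := by
  simpa only [div_eq_mul_inv] using h.mul_const a⁻¹

theorem sum {ι : Type*} {t : Finset ι} {L : ι → E → ℝ} (h : ∀ i ∈ t, LinOn V (L i)) :
    LinOn V fun u => ∑ i ∈ t, L i u := by
  intro u hu v hv c
  simp only [Finset.mul_sum, ← Finset.sum_add_distrib]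
  exact Finset.sum_congr rfl fun i hi => h i hi u hu v hv c

theorem map_add (h : LinOn V L) {u v : E} (hu : u ∈ V) (hv : v ∈ V) : L (u + v) = L u + L v := by
  simpa using h u hu v hv 1

theorem map_sub (h : LinOn V L) {u v : E} (hu : u ∈ V) (hv : v ∈ V) : L (u - v) = L u - L v := by
  have := h u hu v hv (-1)
  rw [neg_one_smul, ← sub_eq_add_neg] at this
  rw [this]
  ring

theorem map_zero (h : LinOn V L) : L 0 = 0 := by
  simpa using h.map_add V.zero_mem V.zero_mem

theorem map_smul (h : LinOn V L) (c : ℝ) {v : E} (hv : v ∈ V) : L (c • v) = c * L v := by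
  simpa [h.map_zero] using h 0 V.zero_mem v hv c

theorem setIntegral {X : Type*} [MeasurableSpace X] {μ : Measure X} {S : Set X}
    (hS : MeasurableSet S) {Φ : E → X → ℝ} (h : ∀ x ∈ S, LinOn V fun u => Φ u x)
    (hi : ∀ u ∈ V, IntegrableOn (Φ u) S μ) : LinOn V fun u => ∫ x in S, Φ u x ∂μ := by
  intro u hu v hv c
  rw [← integral_const_mul, ← integral_add (hi u hu) ((hi v hv).const_mul c)]
  exact setIntegral_congr_fun hS fun x hx => h x hx u hu v hv c

end LinOn

namespace Mesh

variable {M : Mesh d s} {ρ : ℝ} {Ω : Set (Sp d)}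

/-- A broken function that is continuous on each closed element. -/
def PwCont (M : Mesh d s) (w : Fin M.N → Sp d → ℝ) : Prop := ∀ T, ContinuousOn (w T) (M.elem T)

theorem PwCont.face {w : Fin M.N → Sp d → ℝ} (hw : M.PwCont w) (T : Fin M.N) (i : s.Facet d) :
    ContinuousOn (w T) (M.face T i) := (hw T).mono (M.face_subset_elem T i)

theorem PwCont.face_snd {w : Fin M.N → Sp d → ℝ} (hw : M.PwCont w)
    {e : (Fin M.N × s.Facet d) × (Fin M.N × s.Facet d)} (he : e ∈ M.intEdges) :
    ContinuousOn (w e.2.1) (M.face e.1.1 e.1.2) := by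
  rw [(mem_intEdges.1 he).2]
  exact hw.face _ _

theorem PwCont.jump {w : Fin M.N → Sp d → ℝ} (hw : M.PwCont w)
    {e : (Fin M.N × s.Facet d) × (Fin M.N × s.Facet d)} (he : e ∈ M.intEdges) :
    ContinuousOn (M.jump w e) (M.face e.1.1 e.1.2) :=
  (hw.face _ _).sub (hw.face_snd he)

theorem PwCont.avg {w : Fin M.N → Sp d → ℝ} (hw : M.PwCont w)
    {e : (Fin M.N × s.Facet d) × (Fin M.N × s.Facet d)} (he : e ∈ M.intEdges) :
    ContinuousOn (M.avg w e) (M.face e.1.1 e.1.2) :=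
  ((hw.face _ _).add (hw.face_snd he)).div_const 2

theorem ShapeRegular.pwCont (hd : 2 ≤ d) (hM : M.ShapeRegular ρ) {v : Fin M.N → Sp d → ℝ}
    (hv : v ∈ M.P1) : M.PwCont v := fun T => hM.continuousOn_of_mem_P1 hd hv T

theorem ShapeRegular.pwCont_flux (hd : 2 ≤ d) (hM : M.ShapeRegular ρ)
    {A : Fin M.N → Sp d → (Sp d →L[ℝ] Sp d)} (hA : ∀ T, ContinuousOn (A T) (M.elem T))
    (n : Sp d) {v : Fin M.N → Sp d → ℝ} (hv : v ∈ M.P1) : M.PwCont (M.flux A n v) := fun T =>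
  continuousOn_const.inner ((hA T).clm_apply (hM.continuousOn_grad hd hv T))

theorem linOn_eval (T : Fin M.N) (x : Sp d) : LinOn M.P1 fun u => u T x :=
  fun _ _ _ _ _ => rfl

theorem linOn_jump (e : (Fin M.N × s.Facet d) × (Fin M.N × s.Facet d)) (x : Sp d) :
    LinOn M.P1 fun u => M.jump u e x := (linOn_eval _ x).sub (linOn_eval _ x)

theorem linOn_avg (e : (Fin M.N × s.Facet d) × (Fin M.N × s.Facet d)) (x : Sp d) :
    LinOn M.P1 fun u => M.avg u e x := ((linOn_eval _ x).add (linOn_eval _ x)).div_const 2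

theorem ShapeRegular.linOn_inner_grad (hd : 2 ≤ d) (hM : M.ShapeRegular ρ) {T : Fin M.N} {x : Sp d}
    (hx : x ∈ M.elem T) (ξ : Sp d) : LinOn M.P1 fun u => ⟪ξ, M.grad u T x⟫ := by
  intro u hu v hv c
  simp only [hM.grad_add hd hu (M.P1.smul_mem c hv) hx, hM.grad_smul hd c v hx, inner_add_right,
    inner_smul_right]

theorem ShapeRegular.linOn_inner_map_grad (hd : 2 ≤ d) (hM : M.ShapeRegular ρ) {T : Fin M.N}
    {x : Sp d} (hx : x ∈ M.elem T) (ξ : Sp d) (B : Sp d →L[ℝ] Sp d) :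
    LinOn M.P1 fun u => ⟪ξ, B (M.grad u T x)⟫ := by
  intro u hu v hv c
  simp only [hM.grad_add hd hu (M.P1.smul_mem c hv) hx, hM.grad_smul hd c v hx, inner_add_right,
    inner_smul_right, map_add, map_smul]

theorem ShapeRegular.linOn_avg_flux (hd : 2 ≤ d) (hM : M.ShapeRegular ρ)
    {A : Fin M.N → Sp d → (Sp d →L[ℝ] Sp d)} (n : Sp d)
    {e : (Fin M.N × s.Facet d) × (Fin M.N × s.Facet d)} (he : e ∈ M.intEdges) {x : Sp d}
    (hx : x ∈ M.face e.1.1 e.1.2) : LinOn M.P1 fun u => M.avg (M.flux A n u) e x := by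
  have hx2 : x ∈ M.face e.2.1 e.2.2 := (mem_intEdges.1 he).2 ▸ hx
  exact ((hM.linOn_inner_map_grad hd (M.face_subset_elem _ _ hx) n _).add
    (hM.linOn_inner_map_grad hd (M.face_subset_elem _ _ hx2) n _)).div_const 2

theorem linOn_faceInt {e : Fin M.N × s.Facet d} {Φ : (Fin M.N → Sp d → ℝ) → Sp d → ℝ}
    (h : ∀ x ∈ M.face e.1 e.2, LinOn M.P1 fun u => Φ u x)
    (hc : ∀ u ∈ M.P1, ContinuousOn (Φ u) (M.face e.1 e.2)) :
    LinOn M.P1 fun u => M.faceInt e (Φ u) :=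
  LinOn.setIntegral (M.measurableSet_face _ _) h fun u hu => integrableOn_face (hc u hu)

theorem linOn_elemInt {T : Fin M.N} {Φ : (Fin M.N → Sp d → ℝ) → Sp d → ℝ}
    (h : ∀ x ∈ M.elem T, LinOn M.P1 fun u => Φ u x)
    (hc : ∀ u ∈ M.P1, ContinuousOn (Φ u) (M.elem T)) :
    LinOn M.P1 fun u => ∫ x in M.elem T, Φ u x :=
  LinOn.setIntegral (M.measurableSet_elem _) h fun u hu => integrableOn_elem (hc u hu)

theorem aD_symm {A : Fin M.N → Sp d → (Sp d →L[ℝ] Sp d)}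
    (hA : ∀ T, ∀ x ∈ M.elem T, ∀ ξ η, ⟪A T x ξ, η⟫ = ⟪ξ, A T x η⟫) (σ : Set (Sp d) → ℝ)
    (u v : Fin M.N → Sp d → ℝ) : M.aD Ω A σ u v = M.aD Ω A σ v u := by
  have h1 : ∀ T, ∫ x in M.elem T, ⟪A T x (M.grad u T x), M.grad v T x⟫
      = ∫ x in M.elem T, ⟪A T x (M.grad v T x), M.grad u T x⟫ := fun T =>
    setIntegral_congr_fun (M.measurableSet_elem T) fun x hx =>
      (hA T x hx _ _).trans (real_inner_comm _ _)
  simp only [aD, h1, mul_comm (M.jump u _ _), mul_comm (u _ _) (v _ _)]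
  congr 1
  · congr 1
    exact Finset.sum_congr rfl fun e _ => by ring
  · exact Finset.sum_congr rfl fun e _ => by ring

theorem ShapeRegular.linOn_aD (hd : 2 ≤ d) (hM : M.ShapeRegular ρ)
    {A : Fin M.N → Sp d → (Sp d →L[ℝ] Sp d)} (hA : ∀ T, ContinuousOn (A T) (M.elem T))
    (σ : Set (Sp d) → ℝ) {u : Fin M.N → Sp d → ℝ} (hu : u ∈ M.P1) :
    LinOn M.P1 fun v => M.aD Ω A σ u v := by
  have hu' := hM.pwCont hd hu
  refine ((LinOn.sum fun T _ => ?_).add (LinOn.sum fun e he => ?_)).add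
    (LinOn.sum fun e _ => ?_)
  · exact linOn_elemInt (fun x hx => hM.linOn_inner_grad hd hx _) fun v hv =>
      ((hA T).clm_apply (hM.continuousOn_grad hd hu T)).inner (hM.continuousOn_grad hd hv T)
  · refine ((linOn_faceInt (fun x _ => (linOn_jump e x).const_mul _) fun v hv =>
      (hu'.jump he).mul ((hM.pwCont hd hv).jump he)).const_mul _).sub
      (linOn_faceInt (fun x _ => (linOn_jump e x).const_mul _) fun v hv =>
        ((hM.pwCont_flux hd hA _ hu).avg he).mul ((hM.pwCont hd hv).jump he)) |>.sub
      (linOn_faceInt (fun x hx => (hM.linOn_avg_flux hd _ he hx).mul_const _) fun v hv =>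
        ((hM.pwCont_flux hd hA _ hv).avg he).mul (hu'.jump he))
  · refine ((linOn_faceInt (fun x _ => (linOn_eval e.1 x).const_mul _) fun v hv =>
      (hu'.face _ _).mul ((hM.pwCont hd hv).face _ _)).const_mul _).sub
      (linOn_faceInt (fun x _ => (linOn_eval e.1 x).const_mul _) fun v hv =>
        ((hM.pwCont_flux hd hA _ hu).face _ _).mul ((hM.pwCont hd hv).face _ _)) |>.sub
      (linOn_faceInt (fun x hx => (hM.linOn_inner_map_grad hd
        (M.face_subset_elem _ _ hx) _ _).mul_const _) fun v hv =>
        ((hM.pwCont_flux hd hA _ hv).face _ _).mul (hu'.face _ _))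

theorem continuousOn_inner_const {b : Sp d → Sp d} (hm : M.IsMeshOf Ω)
    (hb : ContinuousOn b (closure Ω)) (T : Fin M.N) (i : s.Facet d) (n : Sp d) :
    ContinuousOn (fun x => ⟪b x, n⟫) (M.face T i) :=
  (hb.mono ((M.face_subset_elem T i).trans (elem_subset_closure hm T))).inner continuousOn_const

theorem continuous_negPt : Continuous negPt := by unfold negPt; fun_prop

theorem ShapeRegular.linOn_aC_right (hd : 2 ≤ d) (hM : M.ShapeRegular ρ) (hm : M.IsMeshOf Ω)
    {b : Sp d → Sp d} (hb : ContinuousOn b (closure Ω)) {u : Fin M.N → Sp d → ℝ}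
    (hu : u ∈ M.P1) : LinOn M.P1 fun v => M.aC Ω b u v := by
  have hu' := hM.pwCont hd hu
  have hbn := continuousOn_inner_const hm hb
  refine (((LinOn.sum fun T _ => ?_).add (LinOn.sum fun e he => ?_)).sub
    (LinOn.sum fun e he => ?_)).add (LinOn.sum fun e _ => ?_)
  · exact linOn_elemInt (fun x _ => (linOn_eval T x).const_mul _) fun v hv =>
      ((hb.mono (elem_subset_closure hm T)).inner (hM.continuousOn_grad hd hu T)).mul
        (hM.pwCont hd hv T)
  · exact linOn_faceInt (fun x _ => (linOn_jump e x).const_mul _) fun v hv =>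
      (((hbn _ _ _).abs.div_const 2).mul (hu'.jump he)).mul ((hM.pwCont hd hv).jump he)
  · exact linOn_faceInt (fun x _ => (linOn_avg e x).const_mul _) fun v hv =>
      ((hbn _ _ _).mul (hu'.jump he)).mul ((hM.pwCont hd hv).avg he)
  · exact linOn_faceInt (fun x _ => (linOn_eval e.1 x).const_mul _) fun v hv =>
      ((continuous_negPt.comp_continuousOn (hbn _ _ _)).mul (hu'.face _ _)).mul
        ((hM.pwCont hd hv).face _ _)

theorem ShapeRegular.linOn_aC_left (hd : 2 ≤ d) (hM : M.ShapeRegular ρ) (hm : M.IsMeshOf Ω)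
    {b : Sp d → Sp d} (hb : ContinuousOn b (closure Ω)) {v : Fin M.N → Sp d → ℝ}
    (hv : v ∈ M.P1) : LinOn M.P1 fun u => M.aC Ω b u v := by
  have hv' := hM.pwCont hd hv
  have hbn := continuousOn_inner_const hm hb
  refine (((LinOn.sum fun T _ => ?_).add (LinOn.sum fun e he => ?_)).sub
    (LinOn.sum fun e he => ?_)).add (LinOn.sum fun e _ => ?_)
  · exact linOn_elemInt (fun x hx => (hM.linOn_inner_grad hd hx _).mul_const _) fun u hu =>
      ((hb.mono (elem_subset_closure hm T)).inner (hM.continuousOn_grad hd hu T)).mul (hv' T)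
  · exact linOn_faceInt (fun x _ => ((linOn_jump e x).const_mul _).mul_const _) fun u hu =>
      (((hbn _ _ _).abs.div_const 2).mul ((hM.pwCont hd hu).jump he)).mul (hv'.jump he)
  · exact linOn_faceInt (fun x _ => ((linOn_jump e x).const_mul _).mul_const _) fun u hu =>
      ((hbn _ _ _).mul ((hM.pwCont hd hu).jump he)).mul (hv'.avg he)
  · exact linOn_faceInt (fun x _ => ((linOn_eval e.1 x).const_mul _).mul_const _) fun u hu =>
      ((continuous_negPt.comp_continuousOn (hbn _ _ _)).mul ((hM.pwCont hd hu).face _ _)).mul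
        (hv'.face _ _)

theorem ShapeRegular.linOn_a_right (hd : 2 ≤ d) (hM : M.ShapeRegular ρ) (hm : M.IsMeshOf Ω)
    {A : Fin M.N → Sp d → (Sp d →L[ℝ] Sp d)} {α β : ℝ} (hA : Diffusion M A α β)
    {b : Sp d → Sp d} (hb : ContinuousOn b (closure Ω)) (σ : Set (Sp d) → ℝ)
    {u : Fin M.N → Sp d → ℝ} (hu : u ∈ M.P1) : LinOn M.P1 fun v => M.a Ω A σ b u v :=
  (hM.linOn_aD hd hA.continuousOn σ hu).add (hM.linOn_aC_right hd hm hb hu)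

theorem ShapeRegular.linOn_a_left (hd : 2 ≤ d) (hM : M.ShapeRegular ρ) (hm : M.IsMeshOf Ω)
    {A : Fin M.N → Sp d → (Sp d →L[ℝ] Sp d)} {α β : ℝ} (hA : Diffusion M A α β)
    {b : Sp d → Sp d} (hb : ContinuousOn b (closure Ω)) (σ : Set (Sp d) → ℝ)
    {v : Fin M.N → Sp d → ℝ} (hv : v ∈ M.P1) : LinOn M.P1 fun u => M.a Ω A σ b u v := by
  simp only [a, aD_symm hA.symm σ _ v]
  exact (hM.linOn_aD hd hA.continuousOn σ hv).add (hM.linOn_aC_left hd hm hb hv)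

/-- For divergence-free `b` the convection form is coercive with constant one: the volume term and
the central flux cancel by the divergence theorem. -/
theorem ShapeRegular.aC_self (hd : 2 ≤ d) (hM : M.ShapeRegular ρ) (hΩ : IsOpen Ω)
    (hreg : interior (closure Ω) = Ω) (hm : M.IsMeshOf Ω) {b : Sp d → Sp d}
    (hb : DivFreeW1inf Ω b) {v : Fin M.N → Sp d → ℝ} (hv : v ∈ M.P1) :
    M.aC Ω b v v = M.normCSq Ω b v := by
  have hv' := hM.pwCont hd hv
  have hbn := continuousOn_inner_const hm hb.continuousOn
  have hdiv := hM.divergence_mesh hd hΩ hreg hm hb.continuousOn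
    (hb.weakDivFreeOn (volume_lt_top hm)) (g := fun T x => v T x ^ 2)
    fun T => (hM.contDiffOn_of_mem_P1 hd hv T).pow 2
  have h1 : ∀ T, ∫ x in M.elem T, fderivWithin ℝ (fun x => v T x ^ 2) (M.elem T) x (b x)
      = 2 * ∫ x in M.elem T, ⟪b x, M.grad v T x⟫ * v T x := by
    intro T
    rw [← integral_const_mul]
    refine setIntegral_congr_fun (M.measurableSet_elem T) fun x hx => ?_
    have := (((hM.contDiffOn_of_mem_P1 hd hv T).differentiableOn one_ne_zero x
      hx).hasFDerivWithinAt.pow 2).fderivWithin (hM.uniqueDiffOn_elem hd T x hx)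
    simp only [inner_grad]
    rw [this]
    simp
    ring
  have h2 : ∀ e ∈ M.intEdges, M.faceInt e.1 (fun x => ⟪b x, M.nrm e.1⟫ * M.jump v e x * M.avg v e x)
      = 1 / 2 * M.faceInt e.1
        (fun x => M.jump (fun T x => v T x ^ 2) e x * ⟪b x, M.nrm e.1⟫) := by
    intro e _
    rw [faceInt, faceInt, ← integral_const_mul]
    refine integral_congr_ae (ae_of_all _ fun x => ?_)
    simp only [jump, avg]
    ring
  have h3 : ∀ e ∈ M.intEdges, M.faceInt e.1 (fun x => |⟪b x, M.nrm e.1⟫| / 2 * M.jump v e x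
      * M.jump v e x) = M.faceInt e.1 (fun x => |⟪b x, M.nrm e.1⟫| / 2 * M.jump v e x ^ 2) := by
    intro e _
    congr 1
    ext x
    ring
  have h4 : ∀ e ∈ M.bdEdges Ω, M.faceInt e (fun x => negPt ⟪b x, M.nrm e⟫ * v e.1 x * v e.1 x)
      = M.faceInt e (fun x => |⟪b x, M.nrm e⟫| / 2 * v e.1 x ^ 2)
        - 1 / 2 * M.faceInt e (fun x => v e.1 x ^ 2 * ⟪b x, M.nrm e⟫) := by
    intro e _
    have i1 : IntegrableOn (fun x => |⟪b x, M.nrm e⟫| / 2 * v e.1 x ^ 2) (M.face e.1 e.2)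
        μHE[d - 1] :=
      integrableOn_face (((hbn _ _ _).abs.div_const 2).mul ((hv'.face _ _).pow 2))
    have i2 : IntegrableOn (fun x => v e.1 x ^ 2 * ⟪b x, M.nrm e⟫) (M.face e.1 e.2) μHE[d - 1] :=
      integrableOn_face (((hv'.face _ _).pow 2).mul (hbn _ _ _))
    simp only [faceInt]
    rw [← integral_const_mul, ← integral_sub i1 (i2.const_mul _)]
    refine integral_congr_ae (ae_of_all _ fun x => ?_)
    simp only [negPt]
    ring
  simp_rw [h1] at hdiv
  rw [← Finset.mul_sum] at hdiv
  rw [aC, normCSq, Finset.sum_congr rfl h2, Finset.sum_congr rfl h3, Finset.sum_congr rfl h4,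
    Finset.sum_sub_distrib, ← Finset.mul_sum, ← Finset.mul_sum]
  linarith

end Mesh

end

section

variable {d : ℕ}

/-! ### The signed square -/

theorem hasDerivAt_mul_abs (t : ℝ) : HasDerivAt (fun t : ℝ => t * |t|) (2 * |t|) t := by
  rcases lt_trichotomy t 0 with ht | rfl | ht
  · have h : (fun t : ℝ => -t ^ 2) =ᶠ[nhds t] fun t => t * |t| := by
      filter_upwards [eventually_lt_nhds ht] with r hr
      rw [abs_of_neg hr]; ring
    refine HasDerivAt.congr_of_eventuallyEq (f := fun t : ℝ => -t ^ 2) ?_ h.symm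
    exact ((hasDerivAt_pow 2 t).neg).congr_deriv (by rw [abs_of_neg ht]; simp)
  · rw [hasDerivAt_iff_tendsto_slope_zero]
    have : Filter.Tendsto (fun t : ℝ => |t|) (nhdsWithin 0 {0}ᶜ) (nhds (2 * |(0 : ℝ)|)) := by
      have := (continuous_abs.tendsto (0 : ℝ)).mono_left (nhdsWithin_le_nhds (s := {0}ᶜ))
      simpa using this
    refine this.congr' ?_
    filter_upwards [self_mem_nhdsWithin] with r hr
    have hr' : r ≠ 0 := hr
    simp [hr']
  · have h : (fun t : ℝ => t ^ 2) =ᶠ[nhds t] fun t => t * |t| := by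
      filter_upwards [eventually_gt_nhds ht] with r hr
      rw [abs_of_pos hr]; ring
    refine HasDerivAt.congr_of_eventuallyEq (f := fun t : ℝ => t ^ 2) ?_ h.symm
    exact (hasDerivAt_pow 2 t).congr_deriv (by rw [abs_of_pos ht]; simp)

theorem contDiff_mul_abs : ContDiff ℝ 1 (fun t : ℝ => t * |t|) := by
  rw [contDiff_one_iff_deriv]
  refine ⟨fun t => (hasDerivAt_mul_abs t).differentiableAt, ?_⟩
  rw [funext fun t => (hasDerivAt_mul_abs t).deriv]
  fun_prop

theorem abs_mul_abs_sub_le (a b : ℝ) : |a * (|a|) - b * (|b|)| ≤ (|a| + |b|) * |a - b| := by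
  rcases le_total 0 a with ha | ha <;> rcases le_total 0 b with hb | hb
  · rw [abs_of_nonneg ha, abs_of_nonneg hb, ← abs_of_nonneg (add_nonneg ha hb), ← abs_mul]
    exact le_of_eq (by congr 1; ring)
  · rw [abs_of_nonneg ha, abs_of_nonpos hb, abs_of_nonneg (by nlinarith : 0 ≤ a * a - b * -b),
      abs_of_nonneg (by linarith : 0 ≤ a - b)]
    nlinarith [mul_nonneg ha (neg_nonneg.2 hb)]
  · rw [abs_of_nonpos ha, abs_of_nonneg hb, abs_of_nonpos (by nlinarith : a * -a - b * b ≤ 0),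
      abs_of_nonpos (by linarith : a - b ≤ 0)]
    nlinarith [mul_nonneg hb (neg_nonneg.2 ha)]
  · rw [abs_of_nonpos ha, abs_of_nonpos hb,
      ← abs_of_nonneg (by linarith : 0 ≤ -a + -b), ← abs_mul]
    exact le_of_eq (by congr 1; ring)

/-! ### Measures with densities -/

theorem exists_measure_density {X : Type*} [TopologicalSpace X] [MeasurableSpace X] [BorelSpace X]
    {ν : Measure X} {g : X → ℝ} (hg : Integrable g ν) (hg0 : 0 ≤ᵐ[ν] g) :
    ∃ μ : Measure X, IsFiniteMeasure μ ∧ ∀ φ : X → ℝ, ∫ x, φ x ∂μ = ∫ x, φ x * g x ∂ν := by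
  refine ⟨ν.withDensity fun x => ENNReal.ofReal (g x),
    isFiniteMeasure_withDensity_ofReal hg.hasFiniteIntegral, fun φ => ?_⟩
  rw [integral_withDensity_eq_integral_toReal_smul₀ hg.aestronglyMeasurable.aemeasurable.ennreal_ofReal
    (ae_of_all _ fun _ => ENNReal.ofReal_lt_top)]
  refine integral_congr_ae ?_
  filter_upwards [hg0] with x hx
  rw [ENNReal.toReal_ofReal hx, smul_eq_mul, mul_comm]

/-- A finite sum of measures with densities, which may live on sets of different dimensions, as a
single finite measure. -/
theorem exists_measure_sum_density {X ι : Type*} [TopologicalSpace X] [MeasurableSpace X]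
    [BorelSpace X] (t : Finset ι) {ν : ι → Measure X} {g : ι → X → ℝ}
    (hg : ∀ i ∈ t, Integrable (g i) (ν i)) (hg0 : ∀ i ∈ t, 0 ≤ᵐ[ν i] g i) :
    ∃ μ : Measure X, IsFiniteMeasure μ ∧ ∀ φ : X → ℝ, Continuous φ → (∃ C, ∀ x, ‖φ x‖ ≤ C) →
      ∫ x, φ x ∂μ = ∑ i ∈ t, ∫ x, φ x * g i x ∂ν i := by
  classical
  induction t using Finset.induction_on with
  | empty => exact ⟨0, inferInstance, fun φ _ _ => by simp⟩
  | insert i t hi ih =>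
    obtain ⟨μ, hμ, h⟩ := ih (fun j hj => hg j (Finset.mem_insert_of_mem hj))
      (fun j hj => hg0 j (Finset.mem_insert_of_mem hj))
    obtain ⟨μ', hμ', h'⟩ := exists_measure_density (hg i (Finset.mem_insert_self i t))
      (hg0 i (Finset.mem_insert_self i t))
    refine ⟨μ' + μ, inferInstance, fun φ hφ ⟨C, hC⟩ => ?_⟩
    rw [integral_add_measure (Integrable.of_bound hφ.aestronglyMeasurable C (ae_of_all _ hC))
      (Integrable.of_bound hφ.aestronglyMeasurable C (ae_of_all _ hC)), h' φ, h φ hφ ⟨C, hC⟩,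
      Finset.sum_insert hi]

end

section

variable {d : ℕ} {sh sH : Shape} {Mh : Mesh d sh} {MH : Mesh d sH} {ρ : ℝ} {Ω : Set (Sp d)}

/-! ### The broken Poincaré inequality on the fine scale space -/

namespace Mesh

variable {s : Shape} {M : Mesh d s}

theorem ShapeRegular.aestronglyMeasurable_toFun (hd : 2 ≤ d) (hM : M.ShapeRegular ρ)
    {v : Fin M.N → Sp d → ℝ} (hv : v ∈ M.P1) : AEStronglyMeasurable (M.toFun v) volume := by
  unfold toFun
  refine Finset.aestronglyMeasurable_fun_sum _ fun T _ => ?_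
  rw [aestronglyMeasurable_indicator_iff isOpen_interior.measurableSet]
  exact ((hM.pwCont hd hv T).mono interior_subset).aestronglyMeasurable
    isOpen_interior.measurableSet

theorem ShapeRegular.exists_bound_toFun (hd : 2 ≤ d) (hM : M.ShapeRegular ρ)
    {v : Fin M.N → Sp d → ℝ} (hv : v ∈ M.P1) : ∃ B, ∀ x, |M.toFun v x| ≤ B := by
  choose B hB using fun T => (M.isCompact_elem T).exists_bound_of_continuousOn (hM.pwCont hd hv T)
  refine ⟨∑ T, |B T|, fun x => (Finset.abs_sum_le_sum_abs _ _).trans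
    (Finset.sum_le_sum fun T _ => ?_)⟩
  by_cases hx : x ∈ interior (M.elem T)
  · rw [indicator_of_mem hx]
    exact (hB T x (interior_subset hx)).trans (le_abs_self _)
  · rw [indicator_of_notMem hx, abs_zero]
    exact abs_nonneg _

theorem toFun_zero : M.toFun 0 = 0 := by
  ext x
  simp [toFun]

theorem indicator_mem_P1 (K : Fin M.N) :
    (fun T => if T = K then (M.elem T).indicator 1 else 0) ∈ M.P1 := by
  intro T
  by_cases h : T = K
  · refine ⟨⟨MvPolynomial.C 1, s.isP1_C 1, fun x hx => ?_⟩, fun x hx => ?_⟩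
    · simp only [if_pos h]
      have hmem : M.F T x ∈ M.elem T := mem_image_of_mem _ hx
      rw [indicator_of_mem hmem]
      simp
    · simp only [if_pos h]
      rw [indicator_of_notMem hx]
  · exact ⟨⟨0, s.isP1_zero, fun x hx => by simp [if_neg h]⟩, fun x hx => by simp [if_neg h]⟩

theorem ShapeRegular.toFun_ae_eq (hd : 2 ≤ d) (hM : M.ShapeRegular ρ) (v : Fin M.N → Sp d → ℝ)
    (T : Fin M.N) : M.toFun v =ᵐ[volume.restrict (M.elem T)] v T := by
  filter_upwards [hM.ae_interior hd T] with x hx using toFun_eq v hx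

end Mesh

/-- Functions in the kernel of the coarse `L²`-projection have mean value zero on the coarse
elements. -/
theorem integral_elem_eq_zero_of_mem_fineSpace (hd : 2 ≤ d) (hMH : MH.ShapeRegular ρ)
    (hreg : interior (closure Ω) = Ω) (hmH : MH.IsMeshOf Ω)
    {v : Fin Mh.N → Sp d → ℝ} (hv : v ∈ fineSpace Mh MH Ω) (K : Fin MH.N) :
    ∫ x in MH.elem K, Mh.toFun v x = 0 := by
  have h := hv.2.2 _ (MH.indicator_mem_P1 K)
  have h1 : ∀ x, MH.toFun (fun T => if T = K then (MH.elem T).indicator 1 else 0) x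
      = (interior (MH.elem K)).indicator 1 x := by
    intro x
    rw [Mesh.toFun, Finset.sum_eq_single K]
    · by_cases hx : x ∈ interior (MH.elem K)
      · simp only [if_true]
        rw [indicator_of_mem hx, indicator_of_mem hx, indicator_of_mem (interior_subset hx)]
      · rw [indicator_of_notMem hx, indicator_of_notMem hx]
    · intro T _ hT
      simp [if_neg hT]
    · simp
  rw [← setIntegral_congr_set (hMH.interior_ae_eq hd K),
    ← inter_eq_self_of_subset_right (Mesh.interior_elem_subset hreg hmH K),
    ← setIntegral_indicator isOpen_interior.measurableSet, ← h]
  refine integral_congr_ae (ae_of_all _ fun x => ?_)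
  simp only [h1, Mesh.toFun_zero, Pi.zero_apply, sub_zero]
  by_cases hx : x ∈ interior (MH.elem K)
  · rw [indicator_of_mem hx, indicator_of_mem hx]; simp
  · rw [indicator_of_notMem hx, indicator_of_notMem hx]; simp

/-- Local estimate: on a coarse element `K` the signed square `w|w|` has bounded variation, with
variation coming from the broken gradient and from the jumps inside `K`. -/
theorem Refinement.integral_sq_le (R : Refinement Mh MH) (hd : 2 ≤ d)
    (hMh : Mh.ShapeRegular ρ) (hMH : MH.ShapeRegular ρ) (hΩ : IsOpen Ω)
    (hreg : interior (closure Ω) = Ω) (hmh : Mh.IsMeshOf Ω) (hmH : MH.IsMeshOf Ω)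
    {v : Fin Mh.N → Sp d → ℝ} (hv : v ∈ fineSpace Mh MH Ω) (K : Fin MH.N) :
    ∫ x in MH.elem K, Mh.toFun v x ^ 2 ≤ 2 ^ d * Metric.diam (MH.elem K) *
      ((∑ T with R.parent T = K, ∫ x in Mh.elem T, 2 * |v T x| * ‖Mh.grad v T x‖)
        + ∑ e ∈ Mh.intEdges with R.parent e.1.1 = K ∧ R.parent e.2.1 = K,
          Mh.faceInt e.1 (fun x => (|v e.1.1 x| + |v e.2.1 x|) * |Mh.jump v e x|)) := by
  classical
  have hv1 := hv.1
  have hvc := hMh.pwCont hd hv1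
  have hgc := hMh.continuousOn_grad hd hv1
  -- the variation measure is the sum of a volume part and of a part on the interior edges
  obtain ⟨μ₁, hμ₁, h₁⟩ := exists_measure_sum_density
    (Finset.univ.filter fun T => R.parent T = K)
    (ν := fun T => (volume : Measure (Sp d)).restrict (Mh.elem T))
    (g := fun T x => 2 * |v T x| * ‖Mh.grad v T x‖)
    (fun T _ => Mesh.integrableOn_elem (((hvc T).abs.const_mul 2).mul (hgc T).norm))
    (fun T _ => ae_of_all _ fun x => by positivity)
  obtain ⟨μ₂, hμ₂, h₂⟩ := exists_measure_sum_density
    (Mh.intEdges.filter fun e => R.parent e.1.1 = K ∧ R.parent e.2.1 = K)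
    (ν := fun e => (μHE[d - 1] : Measure (Sp d)).restrict (Mh.face e.1.1 e.1.2))
    (g := fun e x => (|v e.1.1 x| + |v e.2.1 x|) * |Mh.jump v e x|)
    (fun e he => Mesh.integrableOn_face (((hvc.face _ _).abs.add
      (hvc.face_snd (Finset.mem_filter.1 he).1).abs).mul
      (hvc.jump (Finset.mem_filter.1 he).1).abs))
    (fun e _ => ae_of_all _ fun x => by positivity)
  obtain ⟨B, hB⟩ := hMh.exists_bound_toFun hd hv1
  have hsum : ∀ φ : Sp d → ℝ, Continuous φ → (∃ C, ∀ x, ‖φ x‖ ≤ C) → ∫ x, φ x ∂(μ₁ + μ₂)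
      = (∑ T with R.parent T = K, ∫ x in Mh.elem T, φ x * (2 * |v T x| * ‖Mh.grad v T x‖))
        + ∑ e ∈ Mh.intEdges with R.parent e.1.1 = K ∧ R.parent e.2.1 = K,
          Mh.faceInt e.1 (fun x => φ x * ((|v e.1.1 x| + |v e.2.1 x|) * |Mh.jump v e x|)) := by
    rintro φ hφ ⟨C, hC⟩
    rw [integral_add_measure (Integrable.of_bound hφ.aestronglyMeasurable C (ae_of_all _ hC))
      (Integrable.of_bound hφ.aestronglyMeasurable C (ae_of_all _ hC)), h₁ φ hφ ⟨C, hC⟩,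
      h₂ φ hφ ⟨C, hC⟩]
    rfl
  have hmass : (μ₁ + μ₂).real univ
      = (∑ T with R.parent T = K, ∫ x in Mh.elem T, 2 * |v T x| * ‖Mh.grad v T x‖)
        + ∑ e ∈ Mh.intEdges with R.parent e.1.1 = K ∧ R.parent e.2.1 = K,
          Mh.faceInt e.1 (fun x => (|v e.1.1 x| + |v e.2.1 x|) * |Mh.jump v e x|) := by
    have := hsum (fun _ => 1) continuous_const ⟨1, by simp⟩
    simpa using this
  rw [← hmass]
  refine integral_sq_le_of_bv (hMH.convex_elem hd K) (MH.isCompact_elem K)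
    (hMH.interior_elem_nonempty hd) (hMh.aestronglyMeasurable_toFun hd hv1).restrict
    (fun x _ => hB x) (integral_elem_eq_zero_of_mem_fineSpace hd hMH hreg hmH hv K)
    fun φ hφ hc hs w => ?_
  have hφ0 : ∀ x, x ∉ interior (MH.elem K) → φ x = 0 := fun x hx =>
    image_eq_zero_of_notMem_tsupport fun h => hx (hs h)
  have hdφ0 : ∀ x, x ∉ interior (MH.elem K) → fderiv ℝ φ x w = 0 := fun x hx => by
    rw [fderiv_of_notMem_tsupport (𝕜 := ℝ) fun h => hx (hs h)]; rfl
  have hcd : Continuous fun x => fderiv ℝ φ x w :=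
    (hφ.continuous_fderiv (by simp)).clm_apply continuous_const
  have hout : ∀ T, R.parent T ≠ K → ∀ x ∈ Mh.elem T, φ x = 0 ∧ fderiv ℝ φ x w = 0 :=
    fun T hT x hx => ⟨hφ0 x (Set.disjoint_left.1 (R.disjoint_interior hT) hx),
      hdφ0 x (Set.disjoint_left.1 (R.disjoint_interior hT) hx)⟩
  -- integration by parts on the fine elements
  set ψ : Fin Mh.N → Sp d → ℝ := fun T x => v T x * |v T x| with hψ
  have hψd : ∀ T, ContDiffOn ℝ 1 (ψ T) (Mh.elem T) := fun T =>
    contDiff_mul_abs.comp_contDiffOn (hMh.contDiffOn_of_mem_P1 hd hv1 T)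
  have hψc : Mh.PwCont ψ := fun T => (hψd T).continuousOn
  have hφ1 : ContDiff ℝ 1 φ := hφ.of_le (by simp)
  have hdiv := hMh.divergence_mesh hd hΩ hreg hmh (b := fun _ => w) continuousOn_const
    (weakDivFreeOn_const w) (g := fun T x => ψ T x * φ x)
    fun T => (hψd T).mul hφ1.contDiffOn
  have hder : ∀ T, ∫ x in Mh.elem T, fderivWithin ℝ (fun x => ψ T x * φ x) (Mh.elem T) x w
      = (∫ x in Mh.elem T, ψ T x * fderiv ℝ φ x w)
        + ∫ x in Mh.elem T, φ x * (2 * |v T x| * ⟪w, Mh.grad v T x⟫) := by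
    intro T
    have i1 : IntegrableOn (fun x => ψ T x * fderiv ℝ φ x w) (Mh.elem T) :=
      Mesh.integrableOn_elem ((hψc T).mul hcd.continuousOn)
    have i2 : IntegrableOn (fun x => φ x * (2 * |v T x| * ⟪w, Mh.grad v T x⟫)) (Mh.elem T) :=
      Mesh.integrableOn_elem (hφ.continuous.continuousOn.mul
        (((hvc T).abs.const_mul 2).mul (continuousOn_const.inner (hgc T))))
    rw [← integral_add i1 i2]
    refine setIntegral_congr_fun (Mh.measurableSet_elem T) fun x hx => ?_
    have hvx := ((hMh.contDiffOn_of_mem_P1 hd hv1 T).differentiableOn one_ne_zero x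
      hx).hasFDerivWithinAt
    have hψx := (hasDerivAt_mul_abs (v T x)).comp_hasFDerivWithinAt x hvx
    have hφx := ((hφ1.differentiable one_ne_zero) x).hasFDerivAt.hasFDerivWithinAt
      (s := Mh.elem T)
    have := (hψx.mul hφx).fderivWithin (hMh.uniqueDiffOn_elem hd T x hx)
    simp only [Mesh.inner_grad]
    refine (congrArg (fun L : Sp d →L[ℝ] ℝ => L w) this).trans ?_
    simp [hψ]
  have hlhs : ∫ x in MH.elem K, (Mh.toFun v x * |Mh.toFun v x|) * fderiv ℝ φ x w
      = ∑ T, ∫ x in Mh.elem T, ψ T x * fderiv ℝ φ x w := by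
    have hae : ∀ T, (fun x => (Mh.toFun v x * |Mh.toFun v x|) * fderiv ℝ φ x w)
        =ᵐ[volume.restrict (Mh.elem T)] fun x => ψ T x * fderiv ℝ φ x w := fun T => by
      filter_upwards [hMh.toFun_ae_eq hd v T] with x hx
      rw [hx]
    rw [R.setIntegral_elem hd hMh hMH hΩ hreg hmh hmH K fun T _ => (integrable_congr (hae T)).2
      (Mesh.integrableOn_elem ((hψc T).mul hcd.continuousOn))]
    refine Finset.sum_congr rfl fun T _ => ?_
    split_ifs with hT
    · exact integral_congr_ae (hae T)
    · refine (setIntegral_eq_zero_of_forall_eq_zero fun x hx => ?_).symm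
      rw [(hout T hT x hx).2, mul_zero]
  -- there are no boundary terms, since `φ` vanishes outside of the interior of `K`
  have hbd : ∑ e ∈ Mh.bdEdges Ω, Mh.faceInt e (fun x => ψ e.1 x * φ x * ⟪w, Mh.nrm e⟫) = 0 := by
    refine Finset.sum_eq_zero fun e he => setIntegral_eq_zero_of_forall_eq_zero fun x hx => ?_
    rw [hφ0 x fun h => ?_]
    · ring
    · have := (Mesh.mem_bdEdges.1 he hx).2
      rw [hΩ.interior_eq] at this
      exact this (Mesh.interior_elem_subset hreg hmH K h)
  simp only [hder, Finset.sum_add_distrib] at hdiv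
  rw [hbd, add_zero] at hdiv
  have heq : ∫ x in MH.elem K, (Mh.toFun v x * |Mh.toFun v x|) * fderiv ℝ φ x w
      = ∑ e ∈ Mh.intEdges, Mh.faceInt e.1
          (fun x => Mh.jump (fun T x => ψ T x * φ x) e x * ⟪w, Mh.nrm e.1⟫)
        - ∑ T, ∫ x in Mh.elem T, φ x * (2 * |v T x| * ⟪w, Mh.grad v T x⟫) := by
    rw [hlhs]; linarith
  obtain ⟨C, hC⟩ := hc.exists_bound_of_continuous hφ.continuous
  rw [heq, hsum (fun x => |φ x|) hφ.continuous.abs ⟨C, fun x => by simpa using hC x⟩, mul_add]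
  refine (abs_sub _ _).trans ?_
  rw [add_comm]
  refine add_le_add ?_ ?_
  · rw [Finset.mul_sum]
    refine (Finset.abs_sum_le_sum_abs _ _).trans ?_
    rw [Finset.sum_filter]
    refine Finset.sum_le_sum fun T _ => ?_
    split_ifs with hT
    · rw [← integral_const_mul]
      refine (abs_integral_le_integral_abs).trans (setIntegral_mono_on ?_ ?_
        (Mh.measurableSet_elem T) fun x hx => ?_)
      · exact Mesh.integrableOn_elem (hφ.continuous.continuousOn.mul
          (((hvc T).abs.const_mul 2).mul (continuousOn_const.inner (hgc T)))).abs
      · exact Mesh.integrableOn_elem ((hφ.continuous.continuousOn.abs.mul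
          (((hvc T).abs.const_mul 2).mul (hgc T).norm)).const_mul _)
      · have h1 := abs_real_inner_le_norm w (Mh.grad v T x)
        rw [abs_mul, abs_mul, abs_mul, abs_two, abs_abs]
        calc _ ≤ |φ x| * (2 * |v T x| * (‖w‖ * ‖Mh.grad v T x‖)) := by gcongr
          _ = _ := by ring
    · rw [setIntegral_eq_zero_of_forall_eq_zero fun x hx => ?_, abs_zero]
      rw [(hout T hT x hx).1, zero_mul]
  · rw [Finset.mul_sum]
    refine (Finset.abs_sum_le_sum_abs _ _).trans ?_
    rw [Finset.sum_filter]
    refine Finset.sum_le_sum fun e he => ?_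
    split_ifs with hT
    · simp only [Mesh.faceInt]
      rw [← integral_const_mul]
      refine (abs_integral_le_integral_abs).trans (setIntegral_mono_on ?_ ?_
        (Mh.measurableSet_face _ _) fun x hx => ?_)
      · exact Mesh.integrableOn_face ((Mesh.PwCont.jump (w := fun T x => ψ T x * φ x)
          (fun T => (hψc T).mul hφ.continuous.continuousOn) he).mul continuousOn_const).abs
      · exact Mesh.integrableOn_face ((hφ.continuous.continuousOn.abs.mul (((hvc.face _ _).abs.add
          (hvc.face_snd he).abs).mul (hvc.jump he).abs)).const_mul _)
      · have h1 := abs_real_inner_le_norm w (Mh.nrm e.1)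
        rw [Mesh.nrm, Mh.norm_ν, mul_one] at h1
        have h2 := abs_mul_abs_sub_le (v e.1.1 x) (v e.2.1 x)
        have h3 : Mh.jump (fun T x => ψ T x * φ x) e x
            = (v e.1.1 x * |v e.1.1 x| - v e.2.1 x * |v e.2.1 x|) * φ x := by
          simp only [Mesh.jump, hψ]; ring
        rw [h3, abs_mul, abs_mul]
        calc _ ≤ ((|v e.1.1 x| + |v e.2.1 x|) * |Mh.jump v e x|) * |φ x| * ‖w‖ :=
              mul_le_mul (mul_le_mul_of_nonneg_right h2 (abs_nonneg _)) h1 (abs_nonneg _)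
                (by positivity)
          _ = _ := by ring
    · -- an edge with a side outside of `K` does not meet the interior of `K`
      rw [Mesh.faceInt, setIntegral_eq_zero_of_forall_eq_zero fun x hx => ?_, abs_zero]
      have hφx : φ x = 0 := by
        by_cases h1 : R.parent e.1.1 = K
        · have h2 : R.parent e.2.1 ≠ K := fun h => hT ⟨h1, h⟩
          rw [(Mesh.mem_intEdges.1 he).2] at hx
          exact (hout _ h2 x (Mh.face_subset_elem _ _ hx)).1
        · exact (hout _ h1 x (Mh.face_subset_elem _ _ hx)).1
      simp [Mesh.jump, hφx]

end

section

variable {d : ℕ} {sh sH : Shape}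

theorem mul_le_weighted_sq {t : ℝ} (ht : 0 < t) (p q : ℝ) : p * q ≤ t * p ^ 2 + q ^ 2 / (4 * t) := by
  have h : t * p ^ 2 + q ^ 2 / (4 * t) - p * q = (2 * t * p - q) ^ 2 / (4 * t) := by
    field_simp
    ring
  have : 0 ≤ (2 * t * p - q) ^ 2 / (4 * t) := by positivity
  linarith

/-- The broken Poincaré inequality on the fine scale space: the traces produced by the jumps of
`w|w|` are absorbed by means of the discrete trace inequality. -/
theorem exists_poincare_const (sh sH : Shape) (hd : 2 ≤ d) (ρ : ℝ) : ∃ C : ℝ, 0 ≤ C ∧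
    ∀ (Ω : Set (Sp d)) (MH : Mesh d sH) (Mh : Mesh d sh) (R : Refinement Mh MH), IsOpen Ω →
      interior (closure Ω) = Ω → MH.IsMeshOf Ω → Mh.IsMeshOf Ω → MH.ShapeRegular ρ →
      Mh.ShapeRegular ρ → ∀ v ∈ fineSpace Mh MH Ω,
      ∑ T, (Metric.diam (MH.elem (R.parent T)) ^ 2)⁻¹ * ∫ x in Mh.elem T, v T x ^ 2
        ≤ C * ((∑ T, ∫ x in Mh.elem T, ‖Mh.grad v T x‖ ^ 2)
          + ∑ e ∈ Mh.intEdges, (Metric.diam (Mh.face e.1.1 e.1.2))⁻¹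
            * Mh.faceInt e.1 (fun x => Mh.jump v e x ^ 2)) := by
  classical
  obtain ⟨Ct, hCt, htr⟩ := Mesh.exists_trace_const sh hd ρ
  set n : ℝ := (Fintype.card (sh.Facet d) : ℝ) with hn
  have hn0 : 0 ≤ n := Nat.cast_nonneg _
  -- the weight in Young's inequality for the jumps, chosen such that the traces on all facets of an
  -- element add up to at most a quarter of the left-hand side
  set η : ℝ := (8 * (n * Ct + 1))⁻¹ with hη
  have hη0 : 0 < η := by positivity
  have hηn : 2 * η * (n * Ct) ≤ 1 / 4 := by
    rw [hη]
    have : 0 < n * Ct + 1 := by positivity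
    rw [mul_comm 2, mul_assoc, inv_mul_le_iff₀ (by positivity)]
    linarith
  refine ⟨2 * max (4 ^ (d + 1)) (4 ^ d / (4 * η)), by positivity, ?_⟩
  intro Ω MH Mh R hΩ hreg hmH hmh hMH hMh v hv
  have hv1 := hv.1
  have hvc := hMh.pwCont hd hv1
  have hgc := hMh.continuousOn_grad hd hv1
  set D : Fin MH.N → ℝ := fun K => Metric.diam (MH.elem K) with hD
  have hD0 : ∀ K, 0 < D K := fun K => Mesh.diam_elem_pos hd
  set h : Fin Mh.N × sh.Facet d → ℝ := fun e => Metric.diam (Mh.face e.1 e.2) with hh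
  have hh0 : ∀ e, 0 < h e := fun e => Mesh.diam_face_pos hd e.2
  set I : Fin Mh.N → ℝ := fun T => ∫ x in Mh.elem T, v T x ^ 2 with hI
  set G : Fin Mh.N → ℝ := fun T => ∫ x in Mh.elem T, ‖Mh.grad v T x‖ ^ 2 with hG
  set J : (Fin Mh.N × sh.Facet d) × (Fin Mh.N × sh.Facet d) → ℝ :=
    fun e => Mh.faceInt e.1 (fun x => Mh.jump v e x ^ 2) with hJ
  have hI0 : ∀ T, 0 ≤ I T := fun T => integral_nonneg fun x => sq_nonneg _
  have hG0 : ∀ T, 0 ≤ G T := fun T => integral_nonneg fun x => sq_nonneg _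
  have hJ0 : ∀ e, 0 ≤ J e := fun e => integral_nonneg fun x => sq_nonneg _
  set X := ∑ T, (D (R.parent T) ^ 2)⁻¹ * I T with hX
  set Q : Fin Mh.N × sh.Facet d → ℝ := fun e => 2 * η * (D (R.parent e.1) ^ 2)⁻¹
    * (h e * Mh.faceInt e (fun x => v e.1 x ^ 2)) with hQ
  have hQ0 : ∀ e, 0 ≤ Q e := fun e => by
    have : 0 ≤ Mh.faceInt e (fun x => v e.1 x ^ 2) := integral_nonneg fun x => sq_nonneg _
    have := hh0 e
    positivity
  -- the weighted sum of the coarse integrals is `X`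
  have hcoarse : ∑ K, (D K ^ 2)⁻¹ * ∫ x in MH.elem K, Mh.toFun v x ^ 2 = X := by
    have hae : ∀ T, (fun x => Mh.toFun v x ^ 2) =ᵐ[volume.restrict (Mh.elem T)]
        fun x => v T x ^ 2 := fun T => by
      filter_upwards [hMh.toFun_ae_eq hd v T] with x hx
      rw [hx]
    have h1 : ∀ K, ∫ x in MH.elem K, Mh.toFun v x ^ 2
        = ∑ T, if R.parent T = K then I T else 0 := fun K => by
      rw [R.setIntegral_elem hd hMh hMH hΩ hreg hmh hmH K fun T _ =>
        (integrable_congr (hae T)).2 (Mesh.integrableOn_elem ((hvc T).pow 2))]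
      exact Finset.sum_congr rfl fun T _ => by rw [integral_congr_ae (hae T)]
    simp_rw [h1, Finset.mul_sum, mul_ite, mul_zero]
    rw [Finset.sum_comm]
    simp only [Finset.sum_ite_eq, Finset.mem_univ, if_true, hX]
  -- volume terms: Young's inequality
  have hvol : ∀ T, (D (R.parent T) ^ 2)⁻¹ * (2 ^ d * D (R.parent T)
      * ∫ x in Mh.elem T, 2 * |v T x| * ‖Mh.grad v T x‖)
      ≤ 1 / 4 * ((D (R.parent T) ^ 2)⁻¹ * I T) + 4 ^ (d + 1) * G T := by
    intro T
    have hDT := hD0 (R.parent T)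
    have i1 : IntegrableOn (fun x => v T x ^ 2) (Mh.elem T) :=
      Mesh.integrableOn_elem ((hvc T).pow 2)
    have i2 : IntegrableOn (fun x => ‖Mh.grad v T x‖ ^ 2) (Mh.elem T) :=
      Mesh.integrableOn_elem ((hgc T).norm.pow 2)
    have i3 : IntegrableOn (fun x => 2 * |v T x| * ‖Mh.grad v T x‖) (Mh.elem T) :=
      Mesh.integrableOn_elem (((hvc T).abs.const_mul 2).mul (hgc T).norm)
    rw [hI, hG]
    simp only
    rw [← mul_assoc, ← mul_assoc (1 / 4 : ℝ), ← integral_const_mul, ← integral_const_mul,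
      ← integral_const_mul, ← integral_add (i1.const_mul _) (i2.const_mul _)]
    refine integral_mono (i3.const_mul _) ((i1.const_mul _).add (i2.const_mul _)) fun x => ?_
    have := mul_le_weighted_sq (t := 1 / 4) (by norm_num) ((D (R.parent T))⁻¹ * |v T x|)
      (2 ^ (d + 1) * ‖Mh.grad v T x‖)
    simp only
    rw [← sq_abs (v T x)]
    calc _ = (D (R.parent T))⁻¹ * |v T x| * (2 ^ (d + 1) * ‖Mh.grad v T x‖) := by
          field_simp; ring
      _ ≤ _ := this
      _ = _ := by
        rw [show (4 : ℝ) = 2 ^ 2 by norm_num, ← pow_mul, mul_comm 2 (d + 1), pow_mul]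
        field_simp
  -- jump terms: Young's inequality, with the traces collected in `Q`
  have hedge : ∀ e ∈ Mh.intEdges, R.parent e.1.1 = R.parent e.2.1 →
      (D (R.parent e.1.1) ^ 2)⁻¹ * (2 ^ d * D (R.parent e.1.1)
        * Mh.faceInt e.1 (fun x => (|v e.1.1 x| + |v e.2.1 x|) * |Mh.jump v e x|))
      ≤ Q e.1 + Q e.2 + 4 ^ d / (4 * η) * ((h e.1)⁻¹ * J e) := by
    intro e he hpar
    have hDT := hD0 (R.parent e.1.1)
    have hhe := hh0 e.1
    have hface := (Mesh.mem_intEdges.1 he).2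
    have hQ2 : Q e.2 = 2 * η * (D (R.parent e.1.1) ^ 2)⁻¹
        * (h e.1 * Mh.faceInt e.1 (fun x => v e.2.1 x ^ 2)) := by
      simp only [hQ, hh, Mesh.faceInt, ← hface, hpar]
    have i1 : IntegrableOn (fun x => v e.1.1 x ^ 2) (Mh.face e.1.1 e.1.2) μHE[d - 1] :=
      Mesh.integrableOn_face ((hvc.face _ _).pow 2)
    have i2 : IntegrableOn (fun x => v e.2.1 x ^ 2) (Mh.face e.1.1 e.1.2) μHE[d - 1] :=
      Mesh.integrableOn_face ((hvc.face_snd he).pow 2)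
    have i3 : IntegrableOn (fun x => Mh.jump v e x ^ 2) (Mh.face e.1.1 e.1.2) μHE[d - 1] :=
      Mesh.integrableOn_face ((hvc.jump he).pow 2)
    have i4 : IntegrableOn (fun x => (|v e.1.1 x| + |v e.2.1 x|) * |Mh.jump v e x|)
        (Mh.face e.1.1 e.1.2) μHE[d - 1] :=
      Mesh.integrableOn_face (((hvc.face _ _).abs.add (hvc.face_snd he).abs).mul
        (hvc.jump he).abs)
    have i12 : IntegrableOn (fun x => 2 * η * (D (R.parent e.1.1) ^ 2)⁻¹ * h e.1 * v e.1.1 x ^ 2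
        + 2 * η * (D (R.parent e.1.1) ^ 2)⁻¹ * h e.1 * v e.2.1 x ^ 2) (Mh.face e.1.1 e.1.2)
        μHE[d - 1] := (i1.const_mul _).add (i2.const_mul _)
    rw [hQ2]
    simp only [hQ, hJ, Mesh.faceInt, ← mul_assoc]
    rw [← integral_const_mul, ← integral_const_mul, ← integral_const_mul, ← integral_const_mul,
      ← integral_add (i1.const_mul _) (i2.const_mul _),
      ← integral_add i12 (i3.const_mul _)]
    refine integral_mono (i4.const_mul _) (i12.add (i3.const_mul _)) fun x => ?_
    have hw := mul_le_weighted_sq (t := η * h e.1) (by positivity)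
      ((D (R.parent e.1.1))⁻¹ * (|v e.1.1 x| + |v e.2.1 x|)) (2 ^ d * |Mh.jump v e x|)
    have hsq : (|v e.1.1 x| + |v e.2.1 x|) ^ 2 ≤ 2 * (v e.1.1 x ^ 2 + v e.2.1 x ^ 2) := by
      rw [← sq_abs (v e.1.1 x), ← sq_abs (v e.2.1 x)]
      nlinarith [sq_nonneg (|v e.1.1 x| - |v e.2.1 x|)]
    simp only
    calc _ = (D (R.parent e.1.1))⁻¹ * (|v e.1.1 x| + |v e.2.1 x|) * (2 ^ d * |Mh.jump v e x|) := by
          field_simp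
      _ ≤ _ := hw
      _ = η * h e.1 * (D (R.parent e.1.1) ^ 2)⁻¹ * (|v e.1.1 x| + |v e.2.1 x|) ^ 2
          + 4 ^ d / (4 * η) * (h e.1)⁻¹ * Mh.jump v e x ^ 2 := by
        rw [mul_pow, mul_pow, sq_abs (Mh.jump v e x), ← pow_mul, mul_comm d 2, pow_mul, inv_pow]
        norm_num
        field_simp
      _ ≤ η * h e.1 * (D (R.parent e.1.1) ^ 2)⁻¹ * (2 * (v e.1.1 x ^ 2 + v e.2.1 x ^ 2))
          + 4 ^ d / (4 * η) * (h e.1)⁻¹ * Mh.jump v e x ^ 2 := by gcongr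
      _ = _ := by ring
  -- the traces are absorbed by the discrete trace inequality
  have htrace : ∑ T, ∑ i, Q (T, i) ≤ 1 / 4 * X := by
    have h1 : ∀ T i, Q (T, i) ≤ 2 * η * (D (R.parent T) ^ 2)⁻¹ * (Ct * I T) := fun T i => by
      have hDT := hD0 (R.parent T)
      exact mul_le_mul_of_nonneg_left (htr Mh hMh v hv1 T i) (by positivity)
    calc ∑ T, ∑ i, Q (T, i) ≤ ∑ T, ∑ _i : sh.Facet d, 2 * η * (D (R.parent T) ^ 2)⁻¹ * (Ct * I T) :=
          Finset.sum_le_sum fun T _ => Finset.sum_le_sum fun i _ => h1 T i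
      _ = 2 * η * (n * Ct) * X := by
          simp only [Finset.sum_const, Finset.card_univ, nsmul_eq_mul, hX, Finset.mul_sum]
          exact Finset.sum_congr rfl fun T _ => by ring
      _ ≤ 1 / 4 * X := mul_le_mul_of_nonneg_right hηn
          (Finset.sum_nonneg fun T _ => mul_nonneg (by positivity) (hI0 T))
  have hQsum : ∑ e ∈ Mh.intEdges, (Q e.1 + Q e.2) ≤ 1 / 4 * X := by
    refine le_trans ?_ htrace
    rw [hMh.sum_facets hd hΩ hreg hmh Q]
    exact le_add_of_nonneg_right (Finset.sum_nonneg fun e _ => hQ0 e)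
  set S₁ := ∑ T, G T with hS₁
  set S₂ := ∑ e ∈ Mh.intEdges, (h e.1)⁻¹ * J e with hS₂
  have hS₁0 : 0 ≤ S₁ := Finset.sum_nonneg fun T _ => hG0 T
  have hS₂0 : 0 ≤ S₂ := Finset.sum_nonneg fun e _ => mul_nonneg (inv_nonneg.2 (hh0 _).le) (hJ0 e)
  have hmain : X ≤ (1 / 4 * X + 4 ^ (d + 1) * S₁) + (1 / 4 * X + 4 ^ d / (4 * η) * S₂) := by
    calc X = ∑ K, (D K ^ 2)⁻¹ * ∫ x in MH.elem K, Mh.toFun v x ^ 2 := hcoarse.symm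
      _ ≤ ∑ K, (D K ^ 2)⁻¹ * (2 ^ d * D K *
          ((∑ T with R.parent T = K, ∫ x in Mh.elem T, 2 * |v T x| * ‖Mh.grad v T x‖)
          + ∑ e ∈ Mh.intEdges with R.parent e.1.1 = K ∧ R.parent e.2.1 = K,
            Mh.faceInt e.1 (fun x => (|v e.1.1 x| + |v e.2.1 x|) * |Mh.jump v e x|))) :=
        Finset.sum_le_sum fun K _ => mul_le_mul_of_nonneg_left
          (R.integral_sq_le hd hMh hMH hΩ hreg hmh hmH hv K) (by positivity)
      _ = (∑ K, ∑ T with R.parent T = K, (D (R.parent T) ^ 2)⁻¹ * (2 ^ d * D (R.parent T)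
            * ∫ x in Mh.elem T, 2 * |v T x| * ‖Mh.grad v T x‖))
          + ∑ K, ∑ e ∈ Mh.intEdges with R.parent e.1.1 = K ∧ R.parent e.2.1 = K,
            (D (R.parent e.1.1) ^ 2)⁻¹ * (2 ^ d * D (R.parent e.1.1)
            * Mh.faceInt e.1 (fun x => (|v e.1.1 x| + |v e.2.1 x|) * |Mh.jump v e x|)) := by
        rw [← Finset.sum_add_distrib]
        refine Finset.sum_congr rfl fun K _ => ?_
        rw [mul_add, mul_add, Finset.mul_sum, Finset.mul_sum, Finset.mul_sum, Finset.mul_sum]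
        congr 1
        · exact Finset.sum_congr rfl fun T hT => by rw [(Finset.mem_filter.1 hT).2]
        · exact Finset.sum_congr rfl fun e he => by rw [(Finset.mem_filter.1 he).2.1]
      _ ≤ _ := by
        refine add_le_add ?_ ?_
        · rw [Finset.sum_fiberwise]
          refine (Finset.sum_le_sum fun T _ => hvol T).trans_eq ?_
          rw [Finset.sum_add_distrib, ← Finset.mul_sum, ← Finset.mul_sum]
        · have hE0 : ∀ e, 0 ≤ Q e.1 + Q e.2 + 4 ^ d / (4 * η) * ((h e.1)⁻¹ * J e) := fun e => by
            have h1 := hQ0 e.1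
            have h2 := hQ0 e.2
            have h3 := hh0 e.1
            have h4 := hJ0 e
            positivity
          calc _ ≤ ∑ K, ∑ e ∈ Mh.intEdges with R.parent e.1.1 = K,
                  (Q e.1 + Q e.2 + 4 ^ d / (4 * η) * ((h e.1)⁻¹ * J e)) := by
                refine Finset.sum_le_sum fun K _ => (Finset.sum_le_sum fun e he => ?_).trans
                  (Finset.sum_le_sum_of_subset_of_nonneg (fun e he => ?_) fun e _ _ => hE0 e)
                · have h1 := Finset.mem_filter.1 he
                  exact hedge e h1.1 (h1.2.1.trans h1.2.2.symm)
                · have h1 := Finset.mem_filter.1 he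
                  exact Finset.mem_filter.2 ⟨h1.1, h1.2.1⟩
            _ = ∑ e ∈ Mh.intEdges, (Q e.1 + Q e.2 + 4 ^ d / (4 * η) * ((h e.1)⁻¹ * J e)) :=
                Finset.sum_fiberwise _ _ _
            _ = ∑ e ∈ Mh.intEdges, (Q e.1 + Q e.2) + 4 ^ d / (4 * η) * S₂ := by
                rw [Finset.sum_add_distrib, hS₂, Finset.mul_sum]
            _ ≤ _ := by linarith
  have hm1 : 4 ^ (d + 1) * S₁ ≤ max (4 ^ (d + 1)) (4 ^ d / (4 * η)) * S₁ :=
    mul_le_mul_of_nonneg_right (le_max_left _ _) hS₁0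
  have hm2 : 4 ^ d / (4 * η) * S₂ ≤ max (4 ^ (d + 1)) (4 ^ d / (4 * η)) * S₂ :=
    mul_le_mul_of_nonneg_right (le_max_right _ _) hS₂0
  change X ≤ _ * (S₁ + S₂)
  linarith

end

section

variable {d : ℕ} {s sh sH : Shape} {ρ : ℝ} {Ω : Set (Sp d)}

/-! ### The broken `H¹` norm and the mesh function -/

namespace Mesh

variable {M : Mesh d s}

/-- The square of the broken `H¹` norm, with jumps weighted by the inverse edge diameters. -/
def brokenH1Sq (M : Mesh d s) (Ω : Set (Sp d)) (v : Fin M.N → Sp d → ℝ) : ℝ :=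
  (∑ T, ∫ x in M.elem T, ‖M.grad v T x‖ ^ 2)
  + (∑ e ∈ M.intEdges, (Metric.diam (M.face e.1.1 e.1.2))⁻¹
      * M.faceInt e.1 (fun x => M.jump v e x ^ 2))
  + ∑ e ∈ M.bdEdges Ω, (Metric.diam (M.face e.1 e.2))⁻¹ * M.faceInt e (fun x => v e.1 x ^ 2)

theorem brokenH1Sq_nonneg (v : Fin M.N → Sp d → ℝ) : 0 ≤ M.brokenH1Sq Ω v := by
  refine add_nonneg (add_nonneg (Finset.sum_nonneg fun T _ => integral_nonneg fun x => sq_nonneg _)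
    (Finset.sum_nonneg fun e _ => mul_nonneg (inv_nonneg.2 Metric.diam_nonneg)
      (integral_nonneg fun x => sq_nonneg _)))
    (Finset.sum_nonneg fun e _ => mul_nonneg (inv_nonneg.2 Metric.diam_nonneg)
      (integral_nonneg fun x => sq_nonneg _))

theorem ShapeRegular.brokenH1Sq_le (hd : 2 ≤ d) (hM : M.ShapeRegular ρ)
    {A : Fin M.N → Sp d → (Sp d →L[ℝ] Sp d)} {α β c₀ : ℝ} (hα : 0 < α) (hc₀ : 0 < c₀)
    (hA : Diffusion M A α β) {σ : Set (Sp d) → ℝ} (hσ : ∀ T i, c₀ * α ≤ σ (M.face T i))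
    {v : Fin M.N → Sp d → ℝ} (hv : v ∈ M.P1) :
    M.brokenH1Sq Ω v ≤ max 1 c₀⁻¹ / α * M.normDSq Ω A σ v := by
  have hgc := hM.continuousOn_grad hd hv
  set m := max 1 c₀⁻¹ / α with hm
  have hm0 : 0 < m := div_pos (lt_max_of_lt_left one_pos) hα
  have h1 : ∀ T, ∫ x in M.elem T, ‖M.grad v T x‖ ^ 2
      ≤ m * ∫ x in M.elem T, ⟪A T x (M.grad v T x), M.grad v T x⟫ := by
    intro T
    have i2 : IntegrableOn (fun x => ⟪A T x (M.grad v T x), M.grad v T x⟫) (M.elem T) :=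
      integrableOn_elem (((hA.continuousOn T).clm_apply (hgc T)).inner (hgc T))
    rw [← integral_const_mul]
    refine setIntegral_mono_on (integrableOn_elem ((hgc T).norm.pow 2)) (i2.const_mul _)
      (M.measurableSet_elem T) fun x hx => ?_
    have h2 := hA.lower T x hx (M.grad v T x)
    calc ‖M.grad v T x‖ ^ 2 = 1 / α * (α * ‖M.grad v T x‖ ^ 2) := by field_simp
      _ ≤ m * (α * ‖M.grad v T x‖ ^ 2) := by
          refine mul_le_mul_of_nonneg_right ?_ (by positivity)
          exact div_le_div_of_nonneg_right (le_max_left _ _) hα.le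
      _ ≤ _ := mul_le_mul_of_nonneg_left h2 hm0.le
  have h2 : ∀ e : Fin M.N × s.Facet d, (Metric.diam (M.face e.1 e.2))⁻¹ ≤ m * M.pen σ e := by
    intro e
    have hh := diam_face_pos (M := M) (T := e.1) hd e.2
    rw [pen, ← mul_div_assoc, inv_eq_one_div]
    refine div_le_div_of_nonneg_right ?_ hh.le
    calc (1 : ℝ) = c₀⁻¹ / α * (c₀ * α) := by field_simp
      _ ≤ m * (c₀ * α) := by
          refine mul_le_mul_of_nonneg_right ?_ (by positivity)
          exact div_le_div_of_nonneg_right (le_max_right _ _) hα.le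
      _ ≤ _ := mul_le_mul_of_nonneg_left (hσ _ _) hm0.le
  rw [brokenH1Sq, normDSq, mul_add, mul_add, Finset.mul_sum, Finset.mul_sum, Finset.mul_sum]
  refine add_le_add (add_le_add (Finset.sum_le_sum fun T _ => h1 T)
    (Finset.sum_le_sum fun e _ => ?_)) (Finset.sum_le_sum fun e _ => ?_)
  · rw [← mul_assoc]
    exact mul_le_mul_of_nonneg_right (h2 e.1) (integral_nonneg fun x => sq_nonneg _)
  · rw [← mul_assoc]
    exact mul_le_mul_of_nonneg_right (h2 e) (integral_nonneg fun x => sq_nonneg _)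

theorem ShapeRegular.closure_interior_elem (hd : 2 ≤ d) (hM : M.ShapeRegular ρ) (T : Fin M.N) :
    closure (interior (M.elem T)) = M.elem T := by
  rw [(hM.convex_elem hd T).closure_interior_eq_closure_of_nonempty_interior
    (hM.interior_elem_nonempty hd), (M.isClosed_elem T).closure_eq]

theorem measurable_meshFun : Measurable M.meshFun := by
  unfold meshFun
  exact Finset.measurable_fun_sum _ fun T _ =>
    measurable_const.indicator isOpen_interior.measurableSet

theorem abs_meshFun_le (x : Sp d) : |M.meshFun x| ≤ ∑ T, Metric.diam (M.elem T) := by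
  refine (Finset.abs_sum_le_sum_abs _ _).trans (Finset.sum_le_sum fun T _ => ?_)
  by_cases hx : x ∈ interior (M.elem T)
  · rw [indicator_of_mem hx, abs_of_nonneg Metric.diam_nonneg]
  · rw [indicator_of_notMem hx, abs_zero]
    exact Metric.diam_nonneg

end Mesh

/-- The Cauchy–Schwarz inequality, recovered from a family of Young inequalities. -/
theorem sq_le_mul_of_forall_le {a U W : ℝ} (ha : 0 ≤ a) (hW : 0 ≤ W) (hU : 0 ≤ U)
    (h : ∀ t > 0, a ≤ t * U + W / (4 * t)) : a ^ 2 ≤ U * W := by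
  have hq : ∀ t : ℝ, 0 ≤ (4 * U) * (t * t) + (-(4 * a)) * t + W := by
    intro t
    rcases le_or_gt t 0 with ht | ht
    · nlinarith [mul_nonneg ha (neg_nonneg.2 ht), mul_nonneg hU (mul_self_nonneg t)]
    · have h1 := mul_le_mul_of_nonneg_left (h t ht) (by positivity : 0 ≤ 4 * t)
      have h2 : 4 * t * (t * U + W / (4 * t)) = 4 * U * (t * t) + W := by field_simp
      linarith
  have := discrim_le_zero hq
  rw [discrim] at this
  nlinarith

end

section

variable {d : ℕ} {s sh sH : Shape} {ρ : ℝ} {Ω : Set (Sp d)}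

/-! ### Finite-dimensional variational problems -/

/-- A definite bilinear form on a finite-dimensional space represents every linear functional. -/
theorem LinOn.existsUnique_of_definite {E : Type*} [AddCommGroup E] [Module ℝ E]
    {V : Submodule ℝ E} [FiniteDimensional ℝ V] {a : E → E → ℝ}
    (hl : ∀ v ∈ V, LinOn V fun u => a u v) (hr : ∀ u ∈ V, LinOn V (a u))
    (hdef : ∀ v ∈ V, a v v = 0 → v = 0) {L : E → ℝ} (hL : LinOn V L) :
    ∃! φ, φ ∈ V ∧ ∀ w ∈ V, a φ w = L w := by
  let f : V →ₗ[ℝ] Module.Dual ℝ V := LinearMap.mk₂ ℝ (fun u v : V => a u v)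
    (fun u u' v => (hl v v.2).map_add u.2 u'.2) (fun c u v => (hl v v.2).map_smul c u.2)
    (fun u v v' => (hr u u.2).map_add v.2 v'.2) (fun c u v => (hr u u.2).map_smul c v.2)
  have hinj : Function.Injective f := by
    rw [injective_iff_map_eq_zero]
    intro u hu
    exact Subtype.ext (hdef u u.2 (congrArg (fun g : Module.Dual ℝ V => g u) hu))
  have hsurj : Function.Surjective f :=
    (LinearMap.injective_iff_surjective_of_finrank_eq_finrank
      (Subspace.dual_finrank_eq).symm).1 hinj
  let l : Module.Dual ℝ V :=
    { toFun := fun v => L v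
      map_add' := fun u v => hL.map_add u.2 v.2
      map_smul' := fun c v => hL.map_smul c v.2 }
  obtain ⟨φ, hφ⟩ := hsurj l
  have hφ' : ∀ w : V, a φ w = L w := fun w => congrArg (fun g : Module.Dual ℝ V => g w) hφ
  refine ⟨φ, ⟨φ.2, fun w hw => hφ' ⟨w, hw⟩⟩, fun ψ ⟨hψ, h⟩ => ?_⟩
  have hsub : ψ - φ ∈ V := V.sub_mem hψ φ.2
  have h0 := hdef _ hsub (by
    rw [(hl _ hsub).map_sub hψ φ.2, h _ hsub, hφ' ⟨_, hsub⟩, sub_self])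
  exact sub_eq_zero.1 h0

namespace Mesh

variable {M : Mesh d s}

instance finiteDimensional_P1 : FiniteDimensional ℝ M.P1 := by
  classical
  let f : (Fin M.N → MvPolynomial.restrictDegree (Fin d) ℝ 1) →ₗ[ℝ] (Fin M.N → Sp d → ℝ) :=
    { toFun := fun p T x => if x ∈ M.elem T then
        MvPolynomial.eval (fun j => Function.invFunOn (M.F T) (s.ref d) x j) (p T).1 else 0
      map_add' := fun p q => by
        ext T x
        by_cases h : x ∈ M.elem T <;> simp [h]
      map_smul' := fun c p => by
        ext T x
        by_cases h : x ∈ M.elem T <;> simp [h, MvPolynomial.smul_eval] }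
  refine Submodule.finiteDimensional_of_le (S₂ := LinearMap.range f) fun v hv => ?_
  choose p hp hpv using fun T => (hv T).1
  have hpW : ∀ T, p T ∈ MvPolynomial.restrictDegree (Fin d) ℝ 1 := fun T =>
    (MvPolynomial.mem_restrictDegree _ _ _).2 fun m hm i =>
      MvPolynomial.degreeOf_le_iff.1 ((hp T).degreeOf_le i) m hm
  refine ⟨fun T => ⟨p T, hpW T⟩, ?_⟩
  ext T x
  change (if x ∈ M.elem T then _ else _) = _
  split_ifs with hx
  · rw [← hpv T _ (Function.invFunOn_mem hx), Function.invFunOn_eq hx]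
  · exact ((hv T).2 x hx).symm

theorem linOn_toFun (x : Sp d) : LinOn M.P1 fun v => M.toFun v x :=
  LinOn.sum fun T _ => fun u _ v _ c => by
    by_cases hx : x ∈ interior (M.elem T) <;> simp [hx]

theorem ShapeRegular.memLp_toFun (hd : 2 ≤ d) (hM : M.ShapeRegular ρ) (hΩ : volume Ω < ⊤)
    {v : Fin M.N → Sp d → ℝ} (hv : v ∈ M.P1) : MemLp (M.toFun v) 2 (volume.restrict Ω) := by
  obtain ⟨B, hB⟩ := hM.exists_bound_toFun hd hv
  have : IsFiniteMeasure (volume.restrict Ω : Measure (Sp d)) := ⟨by simpa using hΩ⟩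
  exact MemLp.of_bound (hM.aestronglyMeasurable_toFun hd hv).restrict B (ae_of_all _ hB)

theorem linOn_integral_mul_toFun {V : Submodule ℝ (Fin M.N → Sp d → ℝ)} (hV : V ≤ M.P1)
    (hΩ : MeasurableSet Ω) {g : Sp d → ℝ}
    (hi : ∀ v ∈ V, IntegrableOn (fun x => g x * M.toFun v x) Ω) :
    LinOn V fun v => ∫ x in Ω, g x * M.toFun v x :=
  LinOn.setIntegral hΩ (fun x _ => LinOn.const_mul (g x) fun u hu v hv c =>
    linOn_toFun x u (hV hu) v (hV hv) c) hi

/-- A broken polynomial that vanishes in the mean square vanishes. -/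
theorem ShapeRegular.eq_zero_of_integral_sq (hd : 2 ≤ d) (hM : M.ShapeRegular ρ)
    {v : Fin M.N → Sp d → ℝ} (hv : v ∈ M.P1) (h : ∀ T, ∫ x in M.elem T, v T x ^ 2 = 0) :
    v = 0 := by
  ext T x
  have hc := hM.pwCont hd hv T
  have hi : IntegrableOn (fun x => v T x ^ 2) (M.elem T) := integrableOn_elem (hc.pow 2)
  have hae : v T =ᵐ[volume.restrict (interior (M.elem T))] fun _ => 0 := by
    refine ae_restrict_of_ae_restrict_of_subset interior_subset ?_
    filter_upwards [(integral_eq_zero_iff_of_nonneg (fun x => sq_nonneg _) hi).1 (h T)] with x hx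
    exact pow_eq_zero_iff two_ne_zero |>.1 hx
  have hEq : EqOn (v T) (fun _ => 0) (interior (M.elem T)) :=
    Measure.eqOn_open_of_ae_eq hae isOpen_interior (hc.mono interior_subset) continuousOn_const
  by_cases hx : x ∈ M.elem T
  · exact hEq.of_subset_closure hc continuousOn_const interior_subset
      (hM.closure_interior_elem hd T).ge hx
  · exact (hv T).2 x hx

theorem ShapeRegular.integral_toFun_sq (hd : 2 ≤ d) (hM : M.ShapeRegular ρ) (hΩ : IsOpen Ω)
    (hreg : interior (closure Ω) = Ω) (hm : M.IsMeshOf Ω) {v : Fin M.N → Sp d → ℝ}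
    (hv : v ∈ M.P1) : ∫ x in Ω, M.toFun v x * M.toFun v x = ∑ T, ∫ x in M.elem T, v T x ^ 2 := by
  have hae : ∀ T, (fun x => M.toFun v x * M.toFun v x) =ᵐ[volume.restrict (M.elem T)]
      fun x => v T x ^ 2 := fun T => by
    filter_upwards [hM.toFun_ae_eq hd v T] with x hx
    rw [hx, sq]
  rw [hM.setIntegral_eq_sum hd hΩ hreg hm fun T => (integrable_congr (hae T)).2
    (integrableOn_elem ((hM.pwCont hd hv T).pow 2))]
  exact Finset.sum_congr rfl fun T _ => integral_congr_ae (hae T)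

theorem ShapeRegular.exists_isL2Proj (hd : 2 ≤ d) (hM : M.ShapeRegular ρ) (hΩ : IsOpen Ω)
    (hreg : interior (closure Ω) = Ω) (hm : M.IsMeshOf Ω) {g : Sp d → ℝ}
    (hg : MemLp g 2 (volume.restrict Ω)) : ∃ p, M.IsL2Proj Ω g p := by
  have hL2 := fun v (hv : v ∈ M.P1) => hM.memLp_toFun hd (volume_lt_top hm) hv
  obtain ⟨p, ⟨hp, h⟩, -⟩ := LinOn.existsUnique_of_definite (V := M.P1)
    (a := fun u v => ∫ x in Ω, M.toFun u x * M.toFun v x)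
    (fun v hv => by
      simp only [mul_comm _ (M.toFun v _)]
      exact linOn_integral_mul_toFun le_rfl hΩ.measurableSet fun u hu =>
        (hL2 v hv).integrable_mul (hL2 u hu))
    (fun u hu => linOn_integral_mul_toFun le_rfl hΩ.measurableSet fun v hv =>
      (hL2 u hu).integrable_mul (hL2 v hv))
    (fun v hv h => by
      rw [hM.integral_toFun_sq hd hΩ hreg hm hv, Finset.sum_eq_zero_iff_of_nonneg
        fun T _ => integral_nonneg fun x => sq_nonneg _] at h
      exact hM.eq_zero_of_integral_sq hd hv fun T => h T (Finset.mem_univ T))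
    (linOn_integral_mul_toFun (g := g) le_rfl hΩ.measurableSet fun v hv =>
      hg.integrable_mul (hL2 v hv))
  refine ⟨p, hp, fun w hw => ?_⟩
  have i1 : IntegrableOn (fun x => g x * M.toFun w x) Ω := hg.integrable_mul (hL2 w hw)
  have i2 : IntegrableOn (fun x => M.toFun p x * M.toFun w x) Ω :=
    (hL2 p hp).integrable_mul (hL2 w hw)
  simp only [sub_mul]
  rw [integral_sub i1 i2, h w hw, sub_self]

end Mesh

/-! ### The fine scale space and the corrector -/

variable {MH : Mesh d sH} {Mh : Mesh d sh}

theorem mem_fineSpace_iff {v : Fin Mh.N → Sp d → ℝ} : v ∈ fineSpace Mh MH Ω ↔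
    v ∈ Mh.P1 ∧ ∀ w ∈ MH.P1, ∫ x in Ω, MH.toFun w x * Mh.toFun v x = 0 := by
  simp only [fineSpace, Mesh.IsL2Proj, Mesh.toFun_zero, Pi.zero_apply, sub_zero, MH.P1.zero_mem,
    true_and, mem_ofPred_eq, mul_comm (Mh.toFun v _)]

theorem exists_submodule_fineSpace (hd : 2 ≤ d) (hMH : MH.ShapeRegular ρ)
    (hMh : Mh.ShapeRegular ρ) (hΩ : IsOpen Ω) (hmh : Mh.IsMeshOf Ω) :
    ∃ V : Submodule ℝ (Fin Mh.N → Sp d → ℝ), V ≤ Mh.P1 ∧ ∀ v, v ∈ V ↔ v ∈ fineSpace Mh MH Ω := by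
  have hvol := Mesh.volume_lt_top hmh
  have hlin : ∀ w ∈ MH.P1, LinOn Mh.P1 fun v => ∫ x in Ω, MH.toFun w x * Mh.toFun v x :=
    fun w hw => Mesh.linOn_integral_mul_toFun le_rfl hΩ.measurableSet fun v hv =>
      (hMH.memLp_toFun hd hvol hw).integrable_mul (hMh.memLp_toFun hd hvol hv)
  refine ⟨⟨⟨⟨fineSpace Mh MH Ω, fun {u v} hu hv => ?_⟩, ?_⟩, fun c v hv => ?_⟩,
    fun v hv => (mem_fineSpace_iff.1 hv).1, fun v => Iff.rfl⟩
  · rw [mem_fineSpace_iff] at *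
    refine ⟨Mh.P1.add_mem hu.1 hv.1, fun w hw => ?_⟩
    rw [(hlin w hw).map_add hu.1 hv.1, hu.2 w hw, hv.2 w hw, add_zero]
  · exact mem_fineSpace_iff.2 ⟨Mh.P1.zero_mem, fun w hw => (hlin w hw).map_zero⟩
  · rw [mem_fineSpace_iff] at *
    refine ⟨Mh.P1.smul_mem c hv.1, fun w hw => ?_⟩
    rw [(hlin w hw).map_smul c hv.1, hv.2 w hw, mul_zero]

theorem Refinement.toFun_restrict_ae_eq (R : Refinement Mh MH) (hd : 2 ≤ d)
    (hMh : Mh.ShapeRegular ρ) (hΩ : IsOpen Ω) (hreg : interior (closure Ω) = Ω)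
    (hmh : Mh.IsMeshOf Ω) (w : Fin MH.N → Sp d → ℝ) :
    Mh.toFun (R.restrict w) =ᵐ[volume.restrict Ω] MH.toFun w := by
  rw [hMh.restrict_eq_sum hd hΩ hreg hmh, ← Measure.sum_fintype, Filter.EventuallyEq,
    Measure.ae_sum_iff]
  intro T
  filter_upwards [hMh.ae_interior hd T] with x hx
  rw [Mesh.toFun_eq _ hx, Mesh.toFun_eq w (interior_mono (R.elem_subset T) hx), Refinement.restrict,
    indicator_of_mem (interior_subset hx)]

/-- Every fine function is the sum of a coarse function and a fine scale remainder. -/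
theorem Refinement.exists_sub_mem_fineSpace (R : Refinement Mh MH) (hd : 2 ≤ d)
    (hMH : MH.ShapeRegular ρ) (hMh : Mh.ShapeRegular ρ) (hΩ : IsOpen Ω)
    (hreg : interior (closure Ω) = Ω) (hmH : MH.IsMeshOf Ω) (hmh : Mh.IsMeshOf Ω)
    {v : Fin Mh.N → Sp d → ℝ} (hv : v ∈ Mh.P1) :
    ∃ p ∈ MH.P1, v - R.restrict p ∈ fineSpace Mh MH Ω := by
  have hvol := Mesh.volume_lt_top hmh
  obtain ⟨p, hp, h⟩ := hMH.exists_isL2Proj hd hΩ hreg hmH (hMh.memLp_toFun hd hvol hv)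
  refine ⟨p, hp, mem_fineSpace_iff.2 ⟨Mh.P1.sub_mem hv (R.nested p hp), fun w hw => ?_⟩⟩
  rw [← h w hw]
  refine integral_congr_ae ?_
  filter_upwards [R.toFun_restrict_ae_eq hd hMh hΩ hreg hmh p] with x hx
  have hsub : Mh.toFun (v - R.restrict p) x = Mh.toFun v x - Mh.toFun (R.restrict p) x :=
    (Mesh.linOn_toFun x).map_sub hv (R.nested p hp)
  rw [hsub, hx, mul_comm]

end

section

variable {d : ℕ} {s sh sH : Shape} {ρ : ℝ} {Ω : Set (Sp d)}

/-! ### The error estimate -/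

namespace Mesh

variable {M : Mesh d s}

theorem normCSq_nonneg (b : Sp d → Sp d) (v : Fin M.N → Sp d → ℝ) : 0 ≤ M.normCSq Ω b v :=
  add_nonneg (Finset.sum_nonneg fun e _ => integral_nonneg fun x => by positivity)
    (Finset.sum_nonneg fun e _ => integral_nonneg fun x => by positivity)

theorem ShapeRegular.normDSq_nonneg (hd : 2 ≤ d) (hM : M.ShapeRegular ρ)
    {A : Fin M.N → Sp d → (Sp d →L[ℝ] Sp d)} {α β c₀ : ℝ} (hα : 0 < α) (hc₀ : 0 < c₀)
    (hA : Diffusion M A α β) {σ : Set (Sp d) → ℝ} (hσ : PenaltyLarge M Ω A α σ c₀)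
    {v : Fin M.N → Sp d → ℝ} (hv : v ∈ M.P1) : 0 ≤ M.normDSq Ω A σ v := by
  have h := (brokenH1Sq_nonneg v).trans (hM.brokenH1Sq_le (Ω := Ω) hd hα hc₀ hA hσ.lower hv)
  exact nonneg_of_mul_nonneg_right h (div_pos (lt_max_of_lt_left one_pos) hα)

/-- The discontinuous Galerkin form controls the energy norm. -/
theorem ShapeRegular.normSq_le_a (hd : 2 ≤ d) (hM : M.ShapeRegular ρ) (hΩ : IsOpen Ω)
    (hreg : interior (closure Ω) = Ω) (hm : M.IsMeshOf Ω)
    {A : Fin M.N → Sp d → (Sp d →L[ℝ] Sp d)} {α β c₀ : ℝ} (hα : 0 < α) (hc₀ : 0 < c₀)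
    (hA : Diffusion M A α β) {σ : Set (Sp d) → ℝ} (hσ : PenaltyLarge M Ω A α σ c₀)
    {b : Sp d → Sp d} (hb : DivFreeW1inf Ω b) {v : Fin M.N → Sp d → ℝ} (hv : v ∈ M.P1) :
    M.normDSq Ω A σ v + M.normCSq Ω b v ≤ max 1 c₀⁻¹ * M.a Ω A σ b v v := by
  have h1 := hσ.coercive v hv
  have h2 := hM.aC_self hd hΩ hreg hm hb hv
  have h3 := normCSq_nonneg (Ω := Ω) (M := M) b v
  have h4 : M.normDSq Ω A σ v ≤ c₀⁻¹ * M.aD Ω A σ v v := by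
    rw [← div_eq_inv_mul, le_div_iff₀ hc₀, mul_comm]
    exact h1
  have h5 : 0 ≤ M.aD Ω A σ v v :=
    (mul_nonneg hc₀.le (hM.normDSq_nonneg hd hα hc₀ hA hσ hv)).trans h1
  rw [a, h2, mul_add]
  exact add_le_add (h4.trans (mul_le_mul_of_nonneg_right (le_max_right _ _) h5))
    (le_mul_of_one_le_left h3 (le_max_left _ _))

end Mesh

theorem sq_lpNorm_two {X : Type*} [MeasurableSpace X] {μ : Measure X} {g : X → ℝ}
    (hg : MemLp g 2 μ) : lpNorm g 2 μ ^ 2 = ∫ x, g x ^ 2 ∂μ := by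
  rw [lpNorm_eq_integral_norm_rpow_toReal two_ne_zero ENNReal.ofNat_ne_top hg.1]
  have h0 : 0 ≤ ∫ x, g x ^ 2 ∂μ := integral_nonneg fun x => sq_nonneg _
  simp only [ENNReal.toReal_ofNat, Real.rpow_ofNat, Real.norm_eq_abs, sq_abs]
  rw [← Real.rpow_natCast, ← Real.rpow_mul h0]
  norm_num

variable {MH : Mesh d sH} {Mh : Mesh d sh}

/-- The Cauchy–Schwarz inequality with the weights `H` and `H⁻¹`. -/
theorem Refinement.sq_integral_mul_toFun_le (R : Refinement Mh MH) (hd : 2 ≤ d)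
    (hMh : Mh.ShapeRegular ρ) (hΩ : IsOpen Ω) (hreg : interior (closure Ω) = Ω)
    (hmh : Mh.IsMeshOf Ω) {g : Sp d → ℝ} (hg : MemLp g 2 (volume.restrict Ω))
    {v : Fin Mh.N → Sp d → ℝ} (hv : v ∈ Mh.P1) :
    (∫ x in Ω, g x * Mh.toFun v x) ^ 2
      ≤ lpNorm (fun x => MH.meshFun x * g x) 2 (volume.restrict Ω) ^ 2
        * ∑ T, (Metric.diam (MH.elem (R.parent T)) ^ 2)⁻¹ * ∫ x in Mh.elem T, v T x ^ 2 := by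
  have hvL := hMh.memLp_toFun hd (Mesh.volume_lt_top hmh) hv
  have hHg : MemLp (fun x => MH.meshFun x * g x) 2 (volume.restrict Ω) :=
    hg.of_le_mul (c := ∑ K, Metric.diam (MH.elem K))
      (Mesh.measurable_meshFun.aestronglyMeasurable.mul hg.aestronglyMeasurable)
      (ae_of_all _ fun x => by
        rw [norm_mul]
        exact mul_le_mul_of_nonneg_right (Mesh.abs_meshFun_le x) (norm_nonneg _))
  set X := ∑ T, (Metric.diam (MH.elem (R.parent T)) ^ 2)⁻¹ * ∫ x in Mh.elem T, v T x ^ 2 with hX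
  have hX0 : 0 ≤ X := Finset.sum_nonneg fun T _ => mul_nonneg (by positivity)
    (integral_nonneg fun x => sq_nonneg _)
  have hmesh : ∀ T, ∀ᵐ x ∂(volume.restrict (Mh.elem T)),
      MH.meshFun x = Metric.diam (MH.elem (R.parent T)) ∧ Mh.toFun v x = v T x := fun T => by
    filter_upwards [hMh.ae_interior hd T] with x hx
    exact ⟨Mesh.meshFun_eq (interior_mono (R.elem_subset T) hx), Mesh.toFun_eq v hx⟩
  have hae : ∀ T, (fun x => ((MH.meshFun x)⁻¹ * Mh.toFun v x) ^ 2)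
      =ᵐ[volume.restrict (Mh.elem T)]
        fun x => (Metric.diam (MH.elem (R.parent T)) ^ 2)⁻¹ * v T x ^ 2 := fun T => by
    filter_upwards [hmesh T] with x hx
    rw [hx.1, hx.2, mul_pow, inv_pow]
  have hint : ∀ T, IntegrableOn (fun x => ((MH.meshFun x)⁻¹ * Mh.toFun v x) ^ 2) (Mh.elem T) :=
    fun T => (integrable_congr (hae T)).2
      ((Mesh.integrableOn_elem ((hMh.pwCont hd hv T).pow 2)).const_mul _)
  have hXeq : ∫ x in Ω, ((MH.meshFun x)⁻¹ * Mh.toFun v x) ^ 2 = X := by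
    rw [hMh.setIntegral_eq_sum hd hΩ hreg hmh hint]
    exact Finset.sum_congr rfl fun T _ => by
      rw [integral_congr_ae (hae T), integral_const_mul]
  have hne : ∀ᵐ x ∂(volume.restrict Ω), MH.meshFun x ≠ 0 := by
    rw [hMh.restrict_eq_sum hd hΩ hreg hmh, ← Measure.sum_fintype, Measure.ae_sum_iff]
    intro T
    filter_upwards [hmesh T] with x hx
    rw [hx.1]
    exact (Mesh.diam_elem_pos hd).ne'
  have iX : IntegrableOn (fun x => ((MH.meshFun x)⁻¹ * Mh.toFun v x) ^ 2) Ω :=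
    (hMh.integrableOn_iff hd hΩ hreg hmh).2 hint
  have iH : IntegrableOn (fun x => (MH.meshFun x * g x) ^ 2) Ω := hHg.integrable_sq
  rw [← sq_abs]
  refine sq_le_mul_of_forall_le (abs_nonneg _) hX0 (sq_nonneg _) fun t ht => ?_
  rw [sq_lpNorm_two hHg, ← hXeq, div_eq_inv_mul, ← integral_const_mul, ← integral_const_mul,
    ← integral_add (iH.const_mul _) (iX.const_mul _)]
  refine abs_integral_le_integral_abs.trans (integral_mono_ae (hg.integrable_mul hvL).abs
    ((iH.const_mul _).add (iX.const_mul _)) ?_)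
  filter_upwards [hne] with x hx
  have h := mul_le_weighted_sq ht |MH.meshFun x * g x| |(MH.meshFun x)⁻¹ * Mh.toFun v x|
  rw [← abs_mul, sq_abs, sq_abs, div_eq_inv_mul] at h
  refine le_trans (le_of_eq ?_) h
  congr 1
  field_simp

/-- On the fine scale space the form `a` controls the `L²` norm weighted with `H⁻¹`. -/
theorem exists_weighted_const (sh sH : Shape) (hd : 2 ≤ d) (ρ : ℝ) {c₀ : ℝ} (hc₀ : 0 < c₀) :
    ∃ C : ℝ, 0 ≤ C ∧
    ∀ (Ω : Set (Sp d)) (MH : Mesh d sH) (Mh : Mesh d sh) (R : Refinement Mh MH), IsOpen Ω →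
      interior (closure Ω) = Ω → MH.IsMeshOf Ω → Mh.IsMeshOf Ω → MH.ShapeRegular ρ →
      Mh.ShapeRegular ρ → ∀ (A : Fin Mh.N → Sp d → (Sp d →L[ℝ] Sp d)) (α β : ℝ), 0 < α →
      Diffusion Mh A α β → ∀ b : Sp d → Sp d, DivFreeW1inf Ω b →
      ∀ σ : Set (Sp d) → ℝ, PenaltyLarge Mh Ω A α σ c₀ → ∀ v ∈ fineSpace Mh MH Ω,
      ∑ T, (Metric.diam (MH.elem (R.parent T)) ^ 2)⁻¹ * ∫ x in Mh.elem T, v T x ^ 2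
        ≤ C / α * Mh.a Ω A σ b v v := by
  obtain ⟨Cp, hCp, hpo⟩ := exists_poincare_const sh sH hd ρ
  set m := max 1 c₀⁻¹ with hm
  have hm0 : 0 < m := lt_max_of_lt_left one_pos
  refine ⟨Cp * m * m, by positivity, ?_⟩
  intro Ω MH Mh R hΩ hreg hmH hmh hMH hMh A α β hα hA b hb σ hσ v hv
  have h1 : _ ≤ Cp * Mh.brokenH1Sq Ω v :=
    (hpo Ω MH Mh R hΩ hreg hmH hmh hMH hMh v hv).trans (mul_le_mul_of_nonneg_left
      (le_add_of_nonneg_right (Finset.sum_nonneg fun e _ => mul_nonneg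
        (inv_nonneg.2 Metric.diam_nonneg) (integral_nonneg fun x => sq_nonneg _))) hCp)
  have h2 := hMh.brokenH1Sq_le (Ω := Ω) hd hα hc₀ hA hσ.lower hv.1
  have h3 := hMh.normSq_le_a hd hΩ hreg hmh hα hc₀ hA hσ hb hv.1
  have h4 := Mesh.normCSq_nonneg (Ω := Ω) (M := Mh) b v
  calc _ ≤ _ := h1
    _ ≤ Cp * (m / α * (m * Mh.a Ω A σ b v v)) := by
        refine mul_le_mul_of_nonneg_left (h2.trans (mul_le_mul_of_nonneg_left ?_ ?_)) hCp
        · exact (le_add_of_nonneg_right h4).trans h3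
        · positivity
    _ = _ := by ring

theorem Diffusion.le {A : Fin Mh.N → Sp d → (Sp d →L[ℝ] Sp d)} {α β : ℝ} (hd : 2 ≤ d)
    (hA : Diffusion Mh A α β) (hΩ : Ω.Nonempty) (hmh : Mh.IsMeshOf Ω) : α ≤ β := by
  obtain ⟨x, hx⟩ := hΩ.closure
  rw [← hmh] at hx
  obtain ⟨T, hT⟩ := mem_iUnion.1 hx
  have h := (hA.lower T x hT (EuclideanSpace.single ⟨0, by omega⟩ 1)).trans (hA.upper T x hT _)
  simpa using h

/-- The corrector `𝔉` is well defined: the form `a` is definite on the fine scale space, because it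
controls a weighted `L²` norm there. -/
theorem existsUnique_isFineProj (hd : 2 ≤ d) {c₀ : ℝ} (hc₀ : 0 < c₀) (R : Refinement Mh MH)
    (hΩ : IsOpen Ω) (hreg : interior (closure Ω) = Ω) (hmH : MH.IsMeshOf Ω) (hmh : Mh.IsMeshOf Ω)
    (hMH : MH.ShapeRegular ρ) (hMh : Mh.ShapeRegular ρ)
    {A : Fin Mh.N → Sp d → (Sp d →L[ℝ] Sp d)} {α β : ℝ} (hα : 0 < α) (hA : Diffusion Mh A α β)
    {b : Sp d → Sp d} (hb : DivFreeW1inf Ω b) {σ : Set (Sp d) → ℝ}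
    (hσ : PenaltyLarge Mh Ω A α σ c₀) {v : Fin Mh.N → Sp d → ℝ} (hv : v ∈ Mh.P1) :
    ∃! φ, IsFineProj Mh MH Ω (Mh.a Ω A σ b) v φ := by
  obtain ⟨C, -, hC⟩ := exists_weighted_const sh sH hd ρ hc₀
  obtain ⟨V, hV, hVf⟩ := exists_submodule_fineSpace (MH := MH) hd hMH hMh hΩ hmh
  have : FiniteDimensional ℝ V := Submodule.finiteDimensional_of_le hV
  have hr : ∀ u ∈ Mh.P1, LinOn V (Mh.a Ω A σ b u) := fun u hu w hw w' hw' c =>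
    hMh.linOn_a_right hd hmh hA hb.continuousOn σ hu w (hV hw) w' (hV hw') c
  have h := LinOn.existsUnique_of_definite (V := V) (a := Mh.a Ω A σ b)
    (fun w hw u hu u' hu' c =>
      hMh.linOn_a_left hd hmh hA hb.continuousOn σ (hV hw) u (hV hu) u' (hV hu') c)
    (fun u hu => hr u (hV hu)) (fun w hw h0 => ?_) (hr v hv)
  · simpa only [IsFineProj, hVf] using h
  · have h1 := hC Ω MH Mh R hΩ hreg hmH hmh hMH hMh A α β hα hA b hb σ hσ w ((hVf w).1 hw)
    rw [h0, mul_zero] at h1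
    have hI : ∀ T, 0 ≤ ∫ x in Mh.elem T, w T x ^ 2 := fun T => integral_nonneg fun x => sq_nonneg _
    have hD : ∀ K, 0 < (Metric.diam (MH.elem K) ^ 2)⁻¹ := fun K =>
      inv_pos.2 (pow_pos (Mesh.diam_elem_pos hd) 2)
    have h2 := (Finset.sum_eq_zero_iff_of_nonneg fun T _ =>
      mul_nonneg (hD (R.parent T)).le (hI T)).1
      (le_antisymm h1 (Finset.sum_nonneg fun T _ => mul_nonneg (hD (R.parent T)).le (hI T)))
    exact hMh.eq_zero_of_integral_sq hd (hV hw) fun T =>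
      (mul_eq_zero.1 (h2 T (Finset.mem_univ T))).resolve_left (hD _).ne'

end

section

variable {d : ℕ} {sh sH : Shape} {ρ : ℝ} {Ω : Set (Sp d)} {Mh : Mesh d sh} {MH : Mesh d sH}

/-- The error `e = u_h - u_ms` and its fine scale part `e_f = 𝔉 e` have the same energy, and this
energy is the residual `f - Π_H f` tested with `e_f`. Indeed `e - e_f` lies in the multiscale space,
so that Galerkin orthogonality gives `a(e, e) = a(e, e_f)`, and `a(u_ms, e_f) = 0` because the
multiscale space is the `a`-orthogonal complement of the fine space. -/
theorem exists_fineSpace_energy_eq (hd : 2 ≤ d) {c₀ : ℝ} (hc₀ : 0 < c₀) (R : Refinement Mh MH)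
    (hΩ : IsOpen Ω) (hreg : interior (closure Ω) = Ω) (hmH : MH.IsMeshOf Ω) (hmh : Mh.IsMeshOf Ω)
    (hMH : MH.ShapeRegular ρ) (hMh : Mh.ShapeRegular ρ)
    {A : Fin Mh.N → Sp d → (Sp d →L[ℝ] Sp d)} {α β : ℝ} (hα : 0 < α) (hA : Diffusion Mh A α β)
    {b : Sp d → Sp d} (hb : DivFreeW1inf Ω b) {σ : Set (Sp d) → ℝ}
    (hσ : PenaltyLarge Mh Ω A α σ c₀) {f : Sp d → ℝ} (hf : MemLp f 2 (volume.restrict Ω))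
    {q : Fin MH.N → Sp d → ℝ} (hq : q ∈ MH.P1) {u_h u_ms : Fin Mh.N → Sp d → ℝ}
    (hu : IsGalerkin Mh Ω (Mh.a Ω A σ b) f (Mh.P1 : Set (Fin Mh.N → Sp d → ℝ)) u_h)
    (hms : IsGalerkin Mh Ω (Mh.a Ω A σ b) f (msSpace R Ω (Mh.a Ω A σ b)) u_ms) :
    u_h - u_ms ∈ Mh.P1 ∧ ∃ e_f ∈ fineSpace Mh MH Ω,
      Mh.a Ω A σ b (u_h - u_ms) (u_h - u_ms) = Mh.a Ω A σ b e_f e_f ∧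
      Mh.a Ω A σ b e_f e_f = ∫ x in Ω, (f x - MH.toFun q x) * Mh.toFun e_f x := by
  obtain ⟨V, hV, hVf⟩ := exists_submodule_fineSpace (MH := MH) hd hMH hMh hΩ hmh
  have hsub : ∀ {u v w}, u ∈ Mh.P1 → v ∈ Mh.P1 → w ∈ Mh.P1 →
      Mh.a Ω A σ b (u - v) w = Mh.a Ω A σ b u w - Mh.a Ω A σ b v w := fun hu hv hw =>
    (hMh.linOn_a_left hd hmh hA hb.continuousOn σ hw).map_sub hu hv
  have hsub' : ∀ {u v w}, u ∈ Mh.P1 → v ∈ Mh.P1 → w ∈ Mh.P1 →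
      Mh.a Ω A σ b u (v - w) = Mh.a Ω A σ b u v - Mh.a Ω A σ b u w := fun hu hv hw =>
    (hMh.linOn_a_right hd hmh hA hb.continuousOn σ hu).map_sub hv hw
  obtain ⟨⟨w, hw, φ, ⟨hφ, hφa⟩, rfl⟩, hmsa⟩ := hms
  have hRw : R.restrict w ∈ Mh.P1 := R.nested w hw
  obtain ⟨huh, hua⟩ := hu
  have hums : R.restrict w - φ ∈ Mh.P1 := Mh.P1.sub_mem hRw hφ.1
  set e := u_h - (R.restrict w - φ) with he
  have heP : e ∈ Mh.P1 := Mh.P1.sub_mem huh hums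
  obtain ⟨e_f, ⟨hef, hefa⟩, -⟩ :=
    existsUnique_isFineProj hd hc₀ R hΩ hreg hmH hmh hMH hMh hα hA hb hσ heP
  obtain ⟨p, hp, hg⟩ := R.exists_sub_mem_fineSpace hd hMH hMh hΩ hreg hmH hmh heP
  have hRp : R.restrict p ∈ Mh.P1 := R.nested p hp
  -- the function `e - e_f` is the corrected coarse function of `p = Π_H e`
  have hmem : e - e_f ∈ msSpace R Ω (Mh.a Ω A σ b) := by
    have hψ : e_f - (e - R.restrict p) ∈ fineSpace Mh MH Ω :=
      (hVf _).1 (V.sub_mem ((hVf _).2 hef) ((hVf _).2 hg))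
    refine ⟨p, hp, e_f - (e - R.restrict p), ⟨hψ, fun z hz => ?_⟩, by abel⟩
    rw [hsub hef.1 hg.1 hz.1, hsub heP hRp hz.1, hefa z hz]
    ring
  have horth : Mh.a Ω A σ b e (e - e_f) = 0 := by
    have hP : e - e_f ∈ Mh.P1 := Mh.P1.sub_mem heP hef.1
    rw [he, hsub huh hums hP, hua _ hP, hmsa _ hmem, sub_self]
  have hself : Mh.a Ω A σ b e e = Mh.a Ω A σ b e_f e_f := by
    rw [hsub' heP heP hef.1] at horth
    rw [hefa e_f hef]
    linarith
  refine ⟨heP, e_f, hef, hself, ?_⟩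
  rw [hefa e_f hef, he, hsub huh hums hef.1, hsub hRw hφ.1 hef.1, hφa e_f hef, sub_self, sub_zero,
    hua e_f hef.1]
  have hvol := Mesh.volume_lt_top hmh
  have hI1 := hf.integrable_mul (hMh.memLp_toFun hd hvol hef.1)
  have hI2 := (hMH.memLp_toFun hd hvol hq).integrable_mul (hMh.memLp_toFun hd hvol hef.1)
  have h0 := (mem_fineSpace_iff.1 hef).2 q hq
  simp only [sub_mul]
  refine ((integral_sub hI1 hI2).trans ?_).symm
  rw [show ∫ x in Ω, (MH.toFun q * Mh.toFun e_f) x = 0 from h0, sub_zero]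
  rfl

end

end DGMS

end

open DGMS in
theorem mainTheorem1 (d : ℕ) (hd : d = 2 ∨ d = 3) (sh sH : Shape) (ρ c₀ : ℝ) (hc₀ : 0 < c₀) :
    ∃ C : ℝ, 0 ≤ C ∧
      ∀ (Ω : Set (Sp d)), IsOpen Ω → Ω.Nonempty → interior (closure Ω) = Ω →
      ∀ (TH : Mesh d sH) (Th : Mesh d sh) (R : Refinement Th TH),
        TH.IsMeshOf Ω → Th.IsMeshOf Ω → TH.ShapeRegular ρ → Th.ShapeRegular ρ →
      ∀ (A : Fin Th.N → Sp d → (Sp d →L[ℝ] Sp d)) (α β : ℝ), 0 < α → Diffusion Th A α β →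
      ∀ b : Sp d → Sp d, DivFreeW1inf Ω b →
      ∀ σ : Set (Sp d) → ℝ, PenaltyLarge Th Ω A α σ c₀ →
        (∀ v ∈ Th.P1, ∃! φ, IsFineProj Th TH Ω (Th.a Ω A σ b) v φ) ∧
        ∀ f : Sp d → ℝ, MemLp f 2 (volume.restrict Ω) →
        ∀ Pf, TH.IsL2Proj Ω f Pf →
        ∀ u_h, IsGalerkin Th Ω (Th.a Ω A σ b) f (Th.P1 : Set (Fin Th.N → Sp d → ℝ)) u_h →
        ∀ u_ms, IsGalerkin Th Ω (Th.a Ω A σ b) f (msSpace R Ω (Th.a Ω A σ b)) u_ms →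
          Th.energyNorm Ω A σ b (u_h - u_ms) ≤
            C * (Real.sqrt (β / α) + lpNorm (fun x => TH.meshFun x • b x) ∞ (volume.restrict Ω) / α)
              * α ^ (-(1 / 2) : ℝ)
              * lpNorm (fun x => TH.meshFun x * (f x - TH.toFun Pf x)) 2 (volume.restrict Ω) := by
  have hd2 : 2 ≤ d := by omega
  obtain ⟨C, hC, hCw⟩ := exists_weighted_const sh sH hd2 ρ hc₀
  set m := max 1 c₀⁻¹ with hm
  have hm0 : 0 < m := lt_max_of_lt_left one_pos
  refine ⟨√(m * C), Real.sqrt_nonneg _, ?_⟩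
  intro Ω hΩ hne hreg TH Th R hmH hmh hMH hMh A α β hα hA b hb σ hσ
  refine ⟨fun v hv => existsUnique_isFineProj hd2 hc₀ R hΩ hreg hmH hmh hMH hMh hα hA hb hσ hv, ?_⟩
  intro f hf Pf hPf u_h hu u_ms hms
  obtain ⟨heP, e_f, hef, hself, hres⟩ := exists_fineSpace_energy_eq hd2 hc₀ R hΩ hreg hmH hmh hMH
    hMh hα hA hb hσ hf hPf.1 hu hms
  set η := lpNorm (fun x => TH.meshFun x * (f x - TH.toFun Pf x)) 2 (volume.restrict Ω) with hη
  set E := Th.a Ω A σ b e_f e_f with hE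
  have hη0 : 0 ≤ η := lpNorm_nonneg
  have hdual := R.sq_integral_mul_toFun_le hd2 hMh hΩ hreg hmh
    (hf.sub (hMH.memLp_toFun hd2 (Mesh.volume_lt_top hmh) hPf.1)) hef.1
  have hweight := hCw Ω TH Th R hΩ hreg hmH hmh hMH hMh A α β hα hA b hb σ hσ e_f hef
  have hnorm := hMh.normSq_le_a hd2 hΩ hreg hmh hα hc₀ hA hσ hb heP
  rw [hself] at hnorm
  have hsq : E ^ 2 ≤ η ^ 2 * (C / α * E) := by
    exact (congrArg (· ^ 2) hres).trans_le
      (hdual.trans (mul_le_mul_of_nonneg_left hweight (sq_nonneg η)))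
  have hEle : E ≤ η ^ 2 * (C / α) := by
    rcases le_or_gt E 0 with h | h
    · exact h.trans (by positivity)
    · nlinarith
  have hpow : α ^ (-(1 / 2) : ℝ) = √α⁻¹ := by
    rw [Real.rpow_neg hα.le, ← Real.sqrt_eq_rpow, Real.sqrt_inv]
  have hbound : Th.energyNorm Ω A σ b (u_h - u_ms) ≤ √(m * C) * α ^ (-(1 / 2) : ℝ) * η := by
    rw [hpow, ← Real.sqrt_mul (by positivity)]
    refine Real.sqrt_le_iff.2 ⟨by positivity, hnorm.trans ?_⟩
    rw [mul_pow, Real.sq_sqrt (by positivity)]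
    calc m * E ≤ m * (η ^ 2 * (C / α)) := mul_le_mul_of_nonneg_left hEle hm0.le
      _ = _ := by rw [div_eq_mul_inv]; ring
  -- the factor `C_A + ‖H b‖ / α` is at least `C_A ≥ 1`
  have hone : 1 ≤ √(β / α) + lpNorm (fun x => TH.meshFun x • b x) ∞ (volume.restrict Ω) / α :=
    le_add_of_le_of_nonneg
      (Real.one_le_sqrt.2 ((one_le_div hα).2 (hA.le hd2 hne hmh))) (div_nonneg lpNorm_nonneg hα.le)
  refine hbound.trans (mul_le_mul_of_nonneg_right (mul_le_mul_of_nonneg_right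
    (le_mul_of_one_le_right (Real.sqrt_nonneg _) hone) (Real.rpow_nonneg hα.le _)) hη0)
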